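/- **Setting.** Let $n\ge 1$, $0\le k\le n$, $\beta_1,\dots,\beta_k\in(0,1]$, $K>0$, and let $D=\{z\in\mathbb C^n: z_1\cdots z_k=0\}$. For $\epsilon\in[0,1]$ let $$g^{k}_{\beta,\epsilon}=\sum_{j\le k}\frac{\beta_j^2}{(|z_j|^2+\epsilon^2)^{1-\beta_j}}\,dz_j\otimes d\bar z_j+\sum_{j>k}dz_j\otimes d\bar z_j ,$$ and let $\xi=\xi(z)$ be its polar coordinates: $\xi_j=s_j(|z_j|)\,z_j/|z_j|$ with $s_j(\rho)=\int_0^\rho \beta_j(\tau^2+\epsilon^2)^{-(1-\beta_j)/2}d\tau$ for $j\le k$ (so $s_j=|z_j|^{\beta_j}$ if $\epsilon=0$), and $\xi_j=z_j$ for $j>k$. In the $\xi$-coordinates $D$ is again $\{\xi_1\cdots\xi_k=0\}$. For $Y=(y,s)$ let $C_r(Y)=B_r(y)\times(s-r^2,s]$, where $B_r(y)$ is the Euclidean ball in the $\xi$-coordinates, let $dV_E$ be the Lebesgue measure in these coordinates (and in time), and let $|C_r|$ be the measure of $C_r(Y)$. Let $g_t$, $t\in(s-r^2,s]$, be a time-differentiable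 family of Kähler metrics over $B_r(y)$ such that either $\epsilon=0$ and every $g_t$ is weak-conic with constant $K$, i.e. (locally) Hölder continuous, Kähler (the Kähler form being closed in the sense of distributions) and $K^{-1}g^k_{\beta,0}\le g_t\le K g^k_{\beta,0}$ away from $D$; or $0<\epsilon\le1$ and every $g_t$ is $\epsilon$-nearly-conic with constant $K$, i.e. (locally) Hölder continuous, Kähler and $K^{-1}g^k_{\beta,\epsilon}\le g_t\le K g^k_{\beta,\epsilon}$, also across $D$. Suppose that $\frac{\partial}{\partial t}dvol_{g_t}\le K\,dvol_{g_t}$ away from $D$. A weak subsolution of $\frac{\partial u}{\partial t}-\Delta_{g_t}u\le 0$ in $C_r(Y)$ is a function $u$ which, for some $\alpha\in(0,1)$, is locally of class $C^{2+\alpha,1+\alpha/2}$ on $C_r(Y)$ away from $D$, is bounded there, and satisfies the inequality classically there ($\Delta_{g_t}$ is the Laplace–Beltrami operator; time derivatives at $t=s$ are one-sided). **Proposition.** For every $R>0$ there is a constant $N>0$, depending only on $n,k,\beta,K$ and $R$ (in particular not on $\epsilon$, the metrics, $Y$, $u$, $\alpha$ or $r$), such that for all $\epsilon\in[0,1]$,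 all $0<r\le R$, all $Y=(y,s)$ with $y\notin D$, all families $g_t$ as above and all weak subsolutions $u$ in $C_r(Y)$, $$u(Y)\le \frac{N}{|C_r|}\int_{C_r(Y)}u^+\,dV_E .$$ -/

import Mathlib

open Set MeasureTheory

namespace ConicHeat

/-- Complex Euclidean space `ℂⁿ` with its Euclidean distance and Lebesgue measure. -/
abbrev Cn (n : ℕ) : Type := EuclideanSpace ℂ (Fin n)

/-- The divisor `D = {z₁ z₂ ⋯ z_k = 0}`. It is given by the same equation in the holomorphic
coordinates and in the polar coordinates. -/
def divisor (n k : ℕ) : Set (Cn n) := {z | ∃ j : Fin n, (j : ℕ) < k ∧ z j = 0}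

/-! ### Polar coordinates -/

/-- The solution of `ds/dρ = β / (ρ² + ε²) ^ ((1 - β) / 2)`, `s(0) = 0`. -/
noncomputable def polarRadius (β ε ρ : ℝ) : ℝ :=
  ∫ τ in (0 : ℝ)..ρ, β / (τ ^ 2 + ε ^ 2) ^ ((1 - β) / 2)

/-- For `ε = 0` the polar radius is `|z| ^ β`. -/
theorem polarRadius_zero {β ρ : ℝ} (hβ : 0 < β) (hρ : 0 ≤ ρ) :
    polarRadius β 0 ρ = ρ ^ β := by
  have h : polarRadius β 0 ρ = ∫ τ in (0 : ℝ)..ρ, β * τ ^ (β - 1) := by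
    unfold polarRadius
    refine intervalIntegral.integral_congr fun τ hτ => ?_
    rw [uIcc_of_le hρ] at hτ
    have h0 : 0 ≤ τ := hτ.1
    have h1 : (τ ^ 2 + (0 : ℝ) ^ 2) ^ ((1 - β) / 2) = τ ^ (1 - β) := by
      rw [zero_pow two_ne_zero, add_zero, ← Real.rpow_natCast, ← Real.rpow_mul h0]
      congr 1
      push_cast
      ring
    have h2 : τ ^ (β - 1) = (τ ^ (1 - β))⁻¹ := by
      rw [← Real.rpow_neg h0]
      congr 1
      ring
    change β / (τ ^ 2 + (0 : ℝ) ^ 2) ^ ((1 - β) / 2) = β * τ ^ (β - 1)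
    rw [h1, h2, div_eq_mul_inv]
  rw [h, intervalIntegral.integral_const_mul, integral_rpow (Or.inl (by linarith))]
  rw [sub_add_cancel, Real.zero_rpow hβ.ne']
  field_simp
  ring

/-- The map from holomorphic coordinates `z` to polar coordinates `ξ`:
`ξ_j = s_j e^{iθ_j}` with `s_j = polarRadius β_j ε |z_j|` and `e^{iθ_j} = z_j / |z_j|` for the
first `k` coordinates, and `ξ_j = z_j` for the others. -/
noncomputable def polarMap {n : ℕ} (k : ℕ) (β : Fin n → ℝ) (ε : ℝ) (z : Cn n) : Cn n :=
  WithLp.toLp 2 fun j =>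
    if (j : ℕ) < k then ((polarRadius (β j) ε ‖z j‖ / ‖z j‖ : ℝ) : ℂ) * z j else z j

/-! ### Kähler metrics, in holomorphic coordinates

A Hermitian metric is the matrix-valued function `g_{i j̄}`, standing for the Riemannian metric
`Re ∑ g_{i j̄} dz_i ⊗ dz̄_j`, so that the identity matrix is the Euclidean metric. -/

/-- Diagonal coefficients of the model metric `g^k_{β,ε}` (of `g^k_β` when `ε = 0`). -/
noncomputable def modelWeight {n : ℕ} (k : ℕ) (β : Fin n → ℝ) (ε : ℝ) (z : Cn n)
    (j : Fin n) : ℝ :=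
  if (j : ℕ) < k then β j ^ 2 / (‖z j‖ ^ 2 + ε ^ 2) ^ (1 - β j) else 1

/-- `g / K ≤ G ≤ K g` for the Hermitian matrix `G` and the diagonal matrix `g` with entries `m`. -/
def QuasiIsometric {n : ℕ} (K : ℝ) (m : Fin n → ℝ) (G : Matrix (Fin n) (Fin n) ℂ) : Prop :=
  G.IsHermitian ∧ ∀ v : Fin n → ℂ,
    K⁻¹ * ∑ j, m j * ‖v j‖ ^ 2 ≤ (∑ i, ∑ j, G i j * v i * starRingEnd ℂ (v j)).re ∧
    (∑ i, ∑ j, G i j * v i * starRingEnd ℂ (v j)).re ≤ K * ∑ j, m j * ‖v j‖ ^ 2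

/-- Hölder continuity on the compact subsets of `U`. -/
def HolderMetricOn {n : ℕ} (U : Set (Cn n)) (G : Cn n → Matrix (Fin n) (Fin n) ℂ) : Prop :=
  ∃ α : ℝ, 0 < α ∧ α < 1 ∧ ∀ Q : Set (Cn n), IsCompact Q → Q ⊆ U →
    ∃ C : ℝ, ∀ z ∈ Q, ∀ w ∈ Q, ∀ i j, ‖G z i j - G w i j‖ ≤ C * dist z w ^ α

/-- The holomorphic derivative `∂ψ/∂z_i = (∂ψ/∂x_i - √-1 ∂ψ/∂y_i) / 2`. -/
noncomputable def dz {n : ℕ} (ψ : Cn n → ℝ) (z : Cn n) (i : Fin n) : ℂ :=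
  (1 / 2 : ℂ) * ((fderiv ℝ ψ z (EuclideanSpace.single i 1) : ℝ)
    - Complex.I * (fderiv ℝ ψ z (EuclideanSpace.single i Complex.I) : ℝ))

/-- The form `(√-1 / 2) ∑ g_{i j̄} dz_i ∧ dz̄_j` is closed on `U`, i.e. `∂_k g_{i j̄} = ∂_i g_{k j̄}`,
in the sense of distributions since the metric is only Hölder continuous. -/
def KahlerClosedOn {n : ℕ} (U : Set (Cn n)) (G : Cn n → Matrix (Fin n) (Fin n) ℂ) : Prop :=
  ∀ ψ : Cn n → ℝ, ContDiff ℝ (⊤ : ℕ∞) ψ → HasCompactSupport ψ → tsupport ψ ⊆ U →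
    ∀ i j l : Fin n, ∫ z, G z i j * dz ψ z l = ∫ z, G z l j * dz ψ z i

/-- A weak-conic Kähler metric on `Ω`, with quasi-isometric constant `K`: all conditions are
imposed away from the divisor. -/
structure IsWeakConic {n : ℕ} (k : ℕ) (β : Fin n → ℝ) (K : ℝ) (Ω : Set (Cn n))
    (G : Cn n → Matrix (Fin n) (Fin n) ℂ) : Prop where
  holder : HolderMetricOn (Ω \ divisor n k) G
  kahler : KahlerClosedOn (Ω \ divisor n k) G
  quasiIsometric : ∀ z ∈ Ω \ divisor n k, QuasiIsometric K (modelWeight k β 0 z) (G z)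

/-- An `ε`-nearly-conic Kähler metric on `Ω`, with quasi-isometric constant `K`: the conditions
are imposed across the divisor. -/
structure IsNearlyConic {n : ℕ} (k : ℕ) (β : Fin n → ℝ) (ε K : ℝ) (Ω : Set (Cn n))
    (G : Cn n → Matrix (Fin n) (Fin n) ℂ) : Prop where
  holder : HolderMetricOn Ω G
  kahler : KahlerClosedOn Ω G
  quasiIsometric : ∀ z ∈ Ω, QuasiIsometric K (modelWeight k β ε z) (G z)

/-- The family `G t`, `t ∈ I`, is differentiable in time and `∂_t dvol_t ≤ K dvol_t` on `U`.
The volume form of `G t` is `det (g_{i j̄})` times the Lebesgue measure. -/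
def VolumeGrowthLE {n : ℕ} (K : ℝ) (U : Set (Cn n)) (I : Set ℝ)
    (G : ℝ → Cn n → Matrix (Fin n) (Fin n) ℂ) : Prop :=
  ∀ z ∈ U, ∀ t ∈ I,
    (∀ i j, DifferentiableWithinAt ℝ (fun τ => G τ z i j) I t) ∧
    derivWithin (fun τ => (G τ z).det.re) I t ≤ K * (G t z).det.re

/-- The complex Hessian `∂²f / ∂z_i ∂z̄_j`. -/
noncomputable def complexHessian {n : ℕ} (f : Cn n → ℝ) (z : Cn n) (i j : Fin n) : ℂ :=
  let H : Cn n → Cn n → ℝ := fun v w => fderiv ℝ (fderiv ℝ f) z v w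
  let e : Fin n → Cn n := fun i => EuclideanSpace.single i 1
  let e' : Fin n → Cn n := fun i => EuclideanSpace.single i Complex.I
  (1 / 4 : ℂ) * (((H (e i) (e j) + H (e' i) (e' j) : ℝ) : ℂ)
    + Complex.I * ((H (e i) (e' j) - H (e' i) (e j) : ℝ) : ℂ))

/-- The Laplace-Beltrami operator of the Kähler metric `Re ∑ g_{i j̄} dz_i ⊗ dz̄_j`, which is
`4 ∑ g^{i j̄} ∂²f / ∂z_i ∂z̄_j` with `∑_j g^{i j̄} g_{l j̄} = δ_{il}`; for the identity matrix it is
the Euclidean Laplacian of `ℝ²ⁿ`. -/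
noncomputable def laplacian {n : ℕ} (G : Matrix (Fin n) (Fin n) ℂ) (f : Cn n → ℝ)
    (z : Cn n) : ℝ :=
  4 * (∑ i, ∑ j, G⁻¹ j i * complexHessian f z i j).re

/-! ### Parabolic cylinders and weak subsolutions, in polar coordinates -/

/-- The time interval `(s - r², s]`. -/
def timeInterval (s r : ℝ) : Set ℝ := Ioc (s - r ^ 2) s

/-- The parabolic cylinder `C_r(Y) = B_r(y) × (s - r², s]`, `Y = (y, s)`. -/
def cylinder {n : ℕ} (Y : Cn n × ℝ) (r : ℝ) : Set (Cn n × ℝ) :=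
  Metric.ball Y.1 r ×ˢ timeInterval Y.2 r

/-- Hölder continuity with exponent `α`, with respect to the parabolic distance, on the compact
subsets of `Q`. -/
def LocallyParabolicHolder {n : ℕ} {F : Type*} [NormedAddCommGroup F] (α : ℝ)
    (Q : Set (Cn n × ℝ)) (f : Cn n × ℝ → F) : Prop :=
  ∀ A : Set (Cn n × ℝ), IsCompact A → A ⊆ Q → ∃ C : ℝ, ∀ p ∈ A, ∀ q ∈ A,
    ‖f p - f q‖ ≤ C * (dist p.1 q.1 + √|p.2 - q.2|) ^ α

/-- `u ∈ C^{2+α, 1+α/2}` on `V × I`: the derivatives `u`, `Du`, `D²u`, `∂_t u` exist and are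
locally Hölder continuous (time derivatives are one-sided at an endpoint of `I`). -/
structure IsParabolicC2Alpha {n : ℕ} (α : ℝ) (V : Set (Cn n)) (I : Set ℝ)
    (u : Cn n × ℝ → ℝ) : Prop where
  space : ∀ x ∈ V, ∀ t ∈ I, ContDiffAt ℝ 2 (fun x' => u (x', t)) x
  time : ∀ x ∈ V, ∀ t ∈ I, DifferentiableWithinAt ℝ (fun τ => u (x, τ)) I t
  holder : LocallyParabolicHolder α (V ×ˢ I) u
  holder_grad : LocallyParabolicHolder α (V ×ˢ I)
    fun p => fderiv ℝ (fun x => u (x, p.2)) p.1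
  holder_hess : LocallyParabolicHolder α (V ×ˢ I)
    fun p => fderiv ℝ (fderiv ℝ fun x => u (x, p.2)) p.1
  holder_time : LocallyParabolicHolder α (V ×ˢ I)
    fun p => derivWithin (fun τ => u (p.1, τ)) I p.2

/-- `u`, a function of the polar coordinates and time, is a weak subsolution of
`∂u/∂t - Δ_{g_t} u ≤ 0` in `C_r(Y)`: it is `C^{2+α, 1+α/2}` away from the divisor, bounded, and
satisfies the inequality classically away from the divisor. The metric is written in the
holomorphic coordinates `z`, so the inequality is evaluated on `u (ξ(z), t)`. -/
structure IsWeakSubsolution {n : ℕ} (k : ℕ) (β : Fin n → ℝ) (ε : ℝ)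
    (G : ℝ → Cn n → Matrix (Fin n) (Fin n) ℂ) (Y : Cn n × ℝ) (r : ℝ)
    (u : Cn n × ℝ → ℝ) : Prop where
  regular : ∃ α : ℝ, 0 < α ∧ α < 1 ∧
    IsParabolicC2Alpha α (Metric.ball Y.1 r \ divisor n k) (timeInterval Y.2 r) u
  bounded : ∃ M : ℝ, ∀ x ∈ Metric.ball Y.1 r \ divisor n k, ∀ t ∈ timeInterval Y.2 r,
    |u (x, t)| ≤ M
  subsolution : ∀ z ∈ polarMap k β ε ⁻¹' Metric.ball Y.1 r \ divisor n k,
    ∀ t ∈ timeInterval Y.2 r,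
      derivWithin (fun τ => u (polarMap k β ε z, τ)) (timeInterval Y.2 r) t
        - laplacian (G t z) (fun z' => u (polarMap k β ε z', t)) z ≤ 0

end ConicHeat

/-! The proof is a De Giorgi iteration in the polar coordinates, carried out away from $D$, with a
logarithmic barrier replacing any information on $u$ near $D$.

Why the constants do not see $\epsilon$. The polar coordinate on each factor is a radial map with
radial stretching $b=ds/d\rho$ and tangential stretching $s/\rho$, and $b\le s/\rho\le b/\beta$ for
every $\epsilon$. The model weight is exactly $b^2$ (`modelWeight_eq`), so in the $\xi$-coordinates
a metric with constant $K$ is uniformly equivalent to the Euclidean one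
(`coform_comp_polarMap_bounds`, `polarVolume_bounds`), with a constant depending only on
$n,k,\beta,K$.

Why there is a divergence structure. The metric is only Hölder continuous, so its coefficients
cannot be differentiated. However $\det(g)\,\Delta_g$ is the contraction of the adjugate matrix with
the complex Hessian, and the rows of the adjugate of a closed matrix field are divergence free (the
Piola identity, `sum_wirtinger_adjugate`). Mollification preserves closedness, so the identity
survives weakly for continuous metrics (`sum_integral_adjugate_mul_dz`) and yields integration by
parts (`integral_mul_laplacian`). Testing with $\varphi^2(u-l)_+^2$ gives an energy inequality on
each time slice (`slice_energy_holomorphic`), which the change of variables carries to polar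
coordinates (`slice_energy_polar`).

Why the divisor does no harm. The function $\sum_{j<k}(\log|z_j|-c)$, with indices starting at $0$
as in the code, is pluriharmonic, hence annihilated by the Laplacian of every Kähler metric, and it
tends to $-\infty$ at $D$. Adding $\tau>0$ times it to the bounded function $u$ keeps the
differential inequality and makes the sum nonpositive on a neighbourhood $O$ of $D$
(`exists_isOpen_withBarrier_nonpos`). Truncations at levels $l\ge0$ then vanish near $D$ and are
honest $C^1$ test functions. The structure `EnergySubsolution` records what is left: an energy
inequality on $V$ and nonpositivity on $V\cap O$. No constant depends on $\tau$ or $O$, so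
$\tau\to0$ at the end.

Why an energy subsolution obeys a mean value inequality. A Caccioppoli inequality for $(w-l)_+^3$
with a time weight, combined with a Faber-Krahn inequality on slices, makes the mass of truncations
decay superlinearly along shrinking cylinders and rising levels (`exists_deGiorgi_step`), so small
$L^3$ mass bounds the value at the centre of the top (`exists_deGiorgi_bound`). The passage from
$L^3$ to $L^1$ maximises $d^{2n+2}w_+$, with $d$ the parabolic distance to the parabolic boundary:
near an almost maximal point $P$ the function is bounded by a multiple of $w(P)$, so $\int
w_+^3\lesssim w(P)^2\int w_+$ (`exists_mean_value`). -/

namespace ConicHeat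

/-! ### The Piola identity for closed matrix fields. -/

/-- The `∂/∂z_i` component of a real-linear functional. -/
noncomputable def wirtinger {n : ℕ} (L : Cn n →L[ℝ] ℂ) (i : Fin n) : ℂ :=
  (1 / 2 : ℂ) * (L (EuclideanSpace.single i 1)
    - Complex.I * L (EuclideanSpace.single i Complex.I))

/-- The determinant as a continuous real-multilinear map of the rows. -/
noncomputable def detRows (n : ℕ) :
    ContinuousMultilinearMap ℝ (fun _ : Fin n => Fin n → ℂ) ℂ where
  toMultilinearMap :=
    ((Matrix.detRowAlternating (n := Fin n) (R := ℂ)).toMultilinearMap).restrictScalars ℝ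
  cont := by
    change Continuous fun M : Fin n → Fin n → ℂ => Matrix.det (Matrix.of M)
    exact Continuous.matrix_det (continuous_id)

/-- The determinant is multilinear in its rows, so its derivative replaces one row at a time. A
Wirtinger derivative is a fixed complex combination of two directional derivatives, and linearity in
the replaced row moves that combination inside the determinant. -/
theorem hasFDerivAt_det {n : ℕ} {M : Cn n → Matrix (Fin n) (Fin n) ℂ}
    {M' : Fin n → Fin n → Cn n →L[ℝ] ℂ} {z : Cn n}
    (h : ∀ i j, HasFDerivAt (fun z => M z i j) (M' i j) z) :
    ∃ D : Cn n →L[ℝ] ℂ, HasFDerivAt (fun z => (M z).det) D z ∧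
      ∀ i, wirtinger D i = ∑ l, ((M z).updateRow l fun j => wirtinger (M' l j) i).det := by
  have h1 : HasFDerivAt (fun z : Cn n => (fun i => (fun j => M z i j) : Fin n → Fin n → ℂ))
      (ContinuousLinearMap.pi fun i => ContinuousLinearMap.pi fun j => M' i j) z :=
    hasFDerivAt_pi.2 fun i => hasFDerivAt_pi.2 fun j => h i j
  have h2 := ((detRows n).hasFDerivAt (fun i j => M z i j)).comp z h1
  refine ⟨_, h2, fun i => ?_⟩
  have key : ∀ v : Cn n, ((detRows n).linearDeriv (fun i j => M z i j)
      |>.comp (ContinuousLinearMap.pi fun i => ContinuousLinearMap.pi fun j => M' i j)) v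
      = ∑ l, ((M z).updateRow l fun j => M' l j v).det := by
    intro v
    simp only [ContinuousLinearMap.comp_apply, ContinuousMultilinearMap.linearDeriv_apply]
    rfl
  unfold wirtinger
  rw [key, key, Finset.mul_sum, ← Finset.sum_sub_distrib, Finset.mul_sum]
  refine Finset.sum_congr rfl fun l _ => ?_
  rw [← Matrix.det_updateRow_smul, sub_eq_add_neg, neg_eq_neg_one_mul,
    ← Matrix.det_updateRow_smul, ← Matrix.det_updateRow_add, ← Matrix.det_updateRow_smul]
  congr 2
  ext j
  simp [sub_eq_add_neg]

/-- The Piola identity: the rows of the adjugate of a closed matrix field are divergence free. -/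
theorem sum_wirtinger_adjugate {n : ℕ} {A : Cn n → Matrix (Fin n) (Fin n) ℂ}
    {A' : Fin n → Fin n → Cn n →L[ℝ] ℂ} {z : Cn n}
    (h : ∀ i j, HasFDerivAt (fun z => A z i j) (A' i j) z)
    (hc : ∀ i j l, wirtinger (A' i j) l = wirtinger (A' l j) i) (j : Fin n) :
    ∑ i, wirtinger (fderiv ℝ (fun z => (A z).adjugate j i) z) i = 0 := by
  classical
  have h1 : ∀ i, wirtinger (fderiv ℝ (fun z => (A z).adjugate j i) z) i
      = ∑ l, if l = i then 0 else (((A z).updateRow i (Pi.single j 1)).updateRow l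
          fun m => wirtinger (A' l m) i).det := by
    intro i
    have h2 : ∀ a b, HasFDerivAt (fun z => ((A z).updateRow i (Pi.single j 1)) a b)
        (if a = i then 0 else A' a b) z := by
      intro a b
      by_cases hai : a = i
      · subst hai
        simpa using hasFDerivAt_const _ z
      · simpa [hai, Matrix.updateRow_ne hai] using h a b
    obtain ⟨D, hD, hw⟩ := hasFDerivAt_det h2
    have : (fun z => (A z).adjugate j i) = fun z => ((A z).updateRow i (Pi.single j 1)).det := by
      ext z; rw [Matrix.adjugate_apply]
    rw [this, hD.fderiv, hw]
    refine Finset.sum_congr rfl fun l _ => ?_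
    by_cases hl : l = i
    · subst hl
      simp only [if_true]
      refine Matrix.det_eq_zero_of_row_eq_zero l fun m => ?_
      simp [wirtinger]
    · simp [hl]
  simp_rw [h1]
  set F : Fin n → Fin n → ℂ := fun i l => if l = i then 0 else
    (((A z).updateRow i (Pi.single j 1)).updateRow l fun m => wirtinger (A' l m) i).det with hF
  -- The two matrices carry the unit vector and a differentiated row in exchanged positions.
  -- Closedness identifies the differentiated rows, so they differ by the transposition of rows `i`
  -- and `l`, and the double sum cancels in pairs. The diagonal entry is `0` because row `i` is
  -- constant.
  have hanti : ∀ i l, F i l = - F l i := by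
    intro i l
    by_cases hl : l = i
    · subst hl; simp [hF]
    · have hl' : i ≠ l := Ne.symm hl
      simp only [hF, hl, hl', if_false]
      have : (((A z).updateRow l (Pi.single j 1)).updateRow i fun m => wirtinger (A' i m) l)
          = (((A z).updateRow i (Pi.single j 1)).updateRow l fun m => wirtinger (A' l m) i).submatrix
            (Equiv.swap i l) id := by
        ext a b
        by_cases hai : a = i
        · subst hai; simp [hc]
        · by_cases hal : a = l
          · subst hal; simp [Matrix.updateRow_apply, hl, hl']
          · rw [Matrix.submatrix_apply, Equiv.swap_apply_of_ne_of_ne hai hal]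
            simp [Matrix.updateRow_apply, hai, hal]
      rw [this, Matrix.det_permute, Equiv.Perm.sign_swap hl']
      simp
  have hs : ∑ i, ∑ l, F i l = - ∑ i, ∑ l, F i l := by
    conv_rhs => rw [Finset.sum_comm, ← Finset.sum_neg_distrib]
    refine Finset.sum_congr rfl fun i _ => ?_
    rw [← Finset.sum_neg_distrib]
    exact Finset.sum_congr rfl fun l _ => hanti i l
  exact self_eq_neg.1 hs

theorem contDiff_det {n : ℕ} {m : WithTop ℕ∞} {A : Cn n → Matrix (Fin n) (Fin n) ℂ}
    (h : ∀ i j, ContDiff ℝ m fun z => A z i j) : ContDiff ℝ m fun z => (A z).det := by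
  simp only [Matrix.det_apply]
  refine ContDiff.sum fun σ _ => ?_
  refine ContDiff.const_smul _ ?_
  exact contDiff_prod fun i _ => h _ _

theorem contDiff_adjugate {n : ℕ} {m : WithTop ℕ∞} {A : Cn n → Matrix (Fin n) (Fin n) ℂ}
    (h : ∀ i j, ContDiff ℝ m fun z => A z i j) (a b : Fin n) :
    ContDiff ℝ m fun z => (A z).adjugate a b := by
  simp only [Matrix.adjugate_apply]
  refine contDiff_det fun i j => ?_
  by_cases hi : i = b
  · subst hi; simpa using contDiff_const
  · simpa [Matrix.updateRow_ne hi] using h i j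

end ConicHeat

/-! ### Mollification, and the weak Piola identity for continuous metrics. -/

namespace ConicHeat
open scoped Convolution

theorem dz_eq_wirtinger {n : ℕ} {ψ : Cn n → ℝ} {z : Cn n} (h : DifferentiableAt ℝ ψ z)
    (i : Fin n) : dz ψ z i = wirtinger (fderiv ℝ (fun x => (ψ x : ℂ)) z) i := by
  have h1 : HasFDerivAt (fun x => (ψ x : ℂ)) (Complex.ofRealCLM.comp (fderiv ℝ ψ z)) z :=
    Complex.ofRealCLM.hasFDerivAt.comp z h.hasFDerivAt
  rw [h1.fderiv]
  rfl

theorem continuous_dz {n : ℕ} {ψ : Cn n → ℝ} (h : ContDiff ℝ 1 ψ) (i : Fin n) :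
    Continuous fun z => dz ψ z i := by
  have := h.continuous_fderiv one_ne_zero
  unfold dz
  fun_prop

theorem dz_eq_zero_of_notMem_tsupport {n : ℕ} {ψ : Cn n → ℝ} {z : Cn n} (h : z ∉ tsupport ψ)
    (i : Fin n) : dz ψ z i = 0 := by
  have : fderiv ℝ ψ z = 0 := by
    by_contra hne
    exact h (support_fderiv_subset ℝ hne)
  simp [dz, this]

theorem hasCompactSupport_dz {n : ℕ} {ψ : Cn n → ℝ} (h : HasCompactSupport ψ) (i : Fin n) :
    HasCompactSupport fun z => dz ψ z i :=
  HasCompactSupport.intro h fun _ hz => dz_eq_zero_of_notMem_tsupport hz i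

theorem integral_mul_dz {n : ℕ} {a : Cn n → ℂ} {ψ : Cn n → ℝ} (ha : ContDiff ℝ 1 a)
    (hψ : ContDiff ℝ 1 ψ) (hc : HasCompactSupport ψ) (i : Fin n) :
    ∫ z, a z * dz ψ z i = - ∫ z, wirtinger (fderiv ℝ a z) i * (ψ z : ℂ) := by
  have hψc : ContDiff ℝ 1 fun x => (ψ x : ℂ) := Complex.ofRealCLM.contDiff.comp hψ
  have hcc : HasCompactSupport fun x => (ψ x : ℂ) := hc.comp_left (g := Complex.ofReal) rfl
  have c1 := ha.continuous_fderiv one_ne_zero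
  have c2 := hψc.continuous_fderiv one_ne_zero
  have i1 : ∀ v, Integrable fun x => fderiv ℝ a x v * (ψ x : ℂ) := fun v =>
    ((c1.clm_apply continuous_const).mul hψc.continuous).integrable_of_hasCompactSupport
      hcc.mul_left
  have i2 : ∀ v, Integrable fun x => a x * fderiv ℝ (fun x => (ψ x : ℂ)) x v := fun v =>
    (ha.continuous.mul (c2.clm_apply continuous_const)).integrable_of_hasCompactSupport
      (HasCompactSupport.mul_left (f := a) (hcc.fderiv_apply ℝ v))
  have i3 : Integrable fun x => a x * (ψ x : ℂ) :=
    (ha.continuous.mul hψc.continuous).integrable_of_hasCompactSupport hcc.mul_left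
  have key : ∀ v, ∫ x, a x * fderiv ℝ (fun x => (ψ x : ℂ)) x v
      = - ∫ x, fderiv ℝ a x v * (ψ x : ℂ) := fun v =>
    integral_mul_fderiv_eq_neg_fderiv_mul_of_integrable (i1 v) (i2 v) i3
      (fun x _ => ha.differentiable one_ne_zero x) (fun x _ => hψc.differentiable one_ne_zero x)
  have e1 : ∀ z, a z * dz ψ z i = (1 / 2 : ℂ) *
      (a z * fderiv ℝ (fun x => (ψ x : ℂ)) z (EuclideanSpace.single i 1)
        - Complex.I * (a z * fderiv ℝ (fun x => (ψ x : ℂ)) z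
            (EuclideanSpace.single i Complex.I))) := by
    intro z
    rw [dz_eq_wirtinger (hψ.differentiable one_ne_zero z), wirtinger]
    ring
  have e2 : ∀ z, wirtinger (fderiv ℝ a z) i * (ψ z : ℂ) = (1 / 2 : ℂ) *
      (fderiv ℝ a z (EuclideanSpace.single i 1) * (ψ z : ℂ)
        - Complex.I * (fderiv ℝ a z (EuclideanSpace.single i Complex.I) * (ψ z : ℂ))) := by
    intro z
    rw [wirtinger]
    ring
  simp_rw [e1, e2]
  rw [integral_const_mul, integral_const_mul, integral_sub (i2 _) ((i2 _).const_mul _),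
    integral_sub (i1 _) ((i1 _).const_mul _), integral_const_mul, integral_const_mul, key, key]
  ring

/-- Mollification of a locally integrable function. -/
noncomputable def mollify {n : ℕ} (φ : ContDiffBump (0 : Cn n)) (g : Cn n → ℂ) : Cn n → ℂ :=
  g ⋆[(ContinuousLinearMap.lsmul ℝ ℝ).flip, volume] (φ.normed volume)

theorem contDiff_mollify {n : ℕ} (φ : ContDiffBump (0 : Cn n)) {g : Cn n → ℂ}
    (hg : LocallyIntegrable g) : ContDiff ℝ 1 (mollify φ g) :=
  HasCompactSupport.contDiff_convolution_right _ φ.hasCompactSupport_normed hg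
    (φ.contDiff_normed (n := 1))

theorem fderiv_mollify_apply {n : ℕ} (φ : ContDiffBump (0 : Cn n)) {g : Cn n → ℂ}
    (hg : LocallyIntegrable g) (x v : Cn n) :
    fderiv ℝ (mollify φ g) x v = ∫ t, (fderiv ℝ (φ.normed volume) (x - t) v) • g t := by
  have h := HasCompactSupport.hasFDerivAt_convolution_right
    ((ContinuousLinearMap.lsmul ℝ ℝ).flip : ℂ →L[ℝ] ℝ →L[ℝ] ℂ)
    (φ.hasCompactSupport_normed (μ := (volume : Measure (Cn n)))) hg
    (φ.contDiff_normed (n := 1)) x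
  unfold mollify
  rw [h.fderiv, convolution_precompR_apply _ hg
    ((φ.hasCompactSupport_normed (μ := (volume : Measure (Cn n)))).fderiv ℝ) ((φ.contDiff_normed (n := 1)).continuous_fderiv one_ne_zero)]
  rfl

/-- The derivative falls on the kernel, and reading it in the integration variable costs a sign. In
this form the right side is a pairing with a test function, to which distributional closedness
applies. -/
theorem wirtinger_mollify {n : ℕ} (φ : ContDiffBump (0 : Cn n)) {g : Cn n → ℂ}
    (hg : LocallyIntegrable g) (x : Cn n) (l : Fin n) :
    wirtinger (fderiv ℝ (mollify φ g) x) l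
      = - ∫ t, g t * dz (fun t => φ.normed volume (x - t)) t l := by
  have hφ : ContDiff ℝ 1 (φ.normed (volume : Measure (Cn n))) := φ.contDiff_normed (n := 1)
  have hi : ∀ v, Integrable fun t => (fderiv ℝ (φ.normed volume) (x - t) v) • g t := by
    intro v
    have := (φ.hasCompactSupport_normed (μ := (volume : Measure (Cn n)))).fderiv_apply ℝ v
    have h2 : HasCompactSupport fun t => fderiv ℝ (φ.normed volume) (x - t) v :=
      this.comp_homeomorph (Homeomorph.subLeft x)
    refine hg.integrable_smul_left_of_hasCompactSupport ?_ h2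
    exact ((hφ.continuous_fderiv one_ne_zero).comp (continuous_const.sub continuous_id)).clm_apply
      continuous_const
  have hd : ∀ t v, fderiv ℝ (fun t => φ.normed volume (x - t)) t v
      = - fderiv ℝ (φ.normed volume) (x - t) v := by
    intro t v
    have h1 : HasFDerivAt (fun t => x - t) (-ContinuousLinearMap.id ℝ (Cn n)) t :=
      (hasFDerivAt_id t).const_sub x
    have h2 := (hφ.differentiable one_ne_zero (x - t)).hasFDerivAt.comp t h1
    have h3 : HasFDerivAt (fun t => φ.normed volume (x - t)) _ t := h2
    rw [h3.fderiv]
    simp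
  unfold wirtinger
  rw [fderiv_mollify_apply φ hg, fderiv_mollify_apply φ hg, ← integral_const_mul,
    ← integral_sub (hi _) ((hi _).const_mul _), ← integral_const_mul, ← integral_neg]
  refine integral_congr_ae (Filter.Eventually.of_forall fun t => ?_)
  simp only [dz, hd, Complex.real_smul]
  push_cast
  ring

end ConicHeat

namespace ConicHeat
open scoped Convolution Topology
open Filter

theorem dist_mollify_le {n : ℕ} (φ : ContDiffBump (0 : Cn n)) {g : Cn n → ℂ}
    (hg : LocallyIntegrable g) {x : Cn n} {η : ℝ}
    (h : ∀ y ∈ Metric.ball x φ.rOut, dist (g y) (g x) ≤ η) : dist (mollify φ g x) (g x) ≤ η := by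
  unfold mollify
  rw [convolution_flip]
  exact φ.dist_normed_convolution_le hg.aestronglyMeasurable h

/-- At a point of the support of `ψ` the translated bump is supported in `K₀`, hence in `U`, and is
therefore an admissible test function for `KahlerClosedOn`. So the mollified field is classically
closed there and the pointwise Piola identity applies; one integration by parts then moves the
derivative onto `ψ`. -/
theorem sum_integral_adjugate_mollify {n : ℕ} {U K₀ : Set (Cn n)}
    {G : Cn n → Matrix (Fin n) (Fin n) ℂ}
    (hG : KahlerClosedOn U G) (hK₀ : K₀ ⊆ U)
    (hint : ∀ i j, LocallyIntegrable (K₀.indicator fun z => G z i j))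
    (φ : ContDiffBump (0 : Cn n)) {ψ : Cn n → ℝ} (hψ : ContDiff ℝ 1 ψ) (hc : HasCompactSupport ψ)
    (hφ : ∀ z ∈ tsupport ψ, Metric.closedBall z φ.rOut ⊆ K₀) (j : Fin n) :
    ∑ i, ∫ z, (Matrix.of fun a b => mollify φ (K₀.indicator fun z => G z a b) z).adjugate j i
      * dz ψ z i = 0 := by
  set A : Cn n → Matrix (Fin n) (Fin n) ℂ :=
    fun z => Matrix.of fun a b => mollify φ (K₀.indicator fun z => G z a b) z with hA
  have hsm : ∀ a b, ContDiff ℝ 1 fun z => A z a b := fun a b => contDiff_mollify φ (hint a b)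
  have hadj := fun a b => contDiff_adjugate hsm a b
  have h1 : ∀ i, ∫ z, (A z).adjugate j i * dz ψ z i
      = - ∫ z, wirtinger (fderiv ℝ (fun z => (A z).adjugate j i) z) i * (ψ z : ℂ) :=
    fun i => integral_mul_dz (hadj j i) hψ hc i
  have h2 : ∀ i, Integrable fun z =>
      wirtinger (fderiv ℝ (fun z => (A z).adjugate j i) z) i * (ψ z : ℂ) := by
    intro i
    have c1 := (hadj j i).continuous_fderiv one_ne_zero
    refine Continuous.integrable_of_hasCompactSupport ?_ (HasCompactSupport.mul_left
      (hc.comp_left (g := Complex.ofReal) rfl))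
    refine Continuous.mul ?_ (Complex.continuous_ofReal.comp hψ.continuous)
    unfold wirtinger
    fun_prop
  change ∑ i, ∫ z, (A z).adjugate j i * dz ψ z i = 0
  simp_rw [h1]
  rw [Finset.sum_neg_distrib, ← integral_finsetSum _ fun i _ => h2 i, neg_eq_zero]
  refine integral_eq_zero_of_ae (Eventually.of_forall fun z => ?_)
  change ∑ i, wirtinger (fderiv ℝ (fun z => (A z).adjugate j i) z) i * (ψ z : ℂ) = 0
  rw [← Finset.sum_mul]
  by_cases hz : z ∈ tsupport ψ
  · rw [sum_wirtinger_adjugate (A' := fun a b => fderiv ℝ (fun z => A z a b) z)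
      (fun a b => ((hsm a b).differentiable one_ne_zero z).hasFDerivAt) ?_, zero_mul]
    intro a b l
    have hcl := hG (fun t => φ.normed volume (z - t))
      ((φ.contDiff_normed (n := ⊤)).comp (contDiff_const.sub contDiff_id))
      ((φ.hasCompactSupport_normed (μ := (volume : Measure (Cn n)))).comp_homeomorph
        (Homeomorph.subLeft z)) ?_ a b l
    · have hind : ∀ a l, (∫ t, (K₀.indicator fun z => G z a b) t *
          dz (fun t => φ.normed volume (z - t)) t l)
          = ∫ t, G t a b * dz (fun t => φ.normed volume (z - t)) t l := by
        intro a l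
        refine integral_congr_ae (Eventually.of_forall fun t => ?_)
        by_cases ht : t ∈ K₀
        · simp [ht]
        · have : dz (fun t => φ.normed volume (z - t)) t l = 0 := by
            refine dz_eq_zero_of_notMem_tsupport ?_ l
            intro hmem
            refine ht (hφ z hz ?_)
            have := tsupport_comp_subset_preimage (φ.normed volume)
              (f := fun t => z - t) (by fun_prop) hmem
            rw [mem_preimage, φ.tsupport_normed_eq] at this
            simpa [dist_eq_norm, norm_sub_rev] using this
          simp [this]
      change wirtinger (fderiv ℝ (mollify φ (K₀.indicator fun z => G z a b)) z) l
        = wirtinger (fderiv ℝ (mollify φ (K₀.indicator fun z => G z l b)) z) a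
      rw [wirtinger_mollify φ (hint a b), wirtinger_mollify φ (hint l b), hind, hind, hcl]
    · refine Subset.trans (fun t hmem => ?_) hK₀
      refine hφ z hz ?_
      have := tsupport_comp_subset_preimage (φ.normed volume)
        (f := fun t => z - t) (by fun_prop) hmem
      rw [mem_preimage, φ.tsupport_normed_eq] at this
      simpa [dist_eq_norm, norm_sub_rev] using this
  · simp [image_eq_zero_of_notMem_tsupport hz]

/-- A continuous matrix field closed in the sense of distributions has a divergence free
adjugate in the sense of distributions. -/
theorem sum_integral_adjugate_mul_dz {n : ℕ} {U : Set (Cn n)} (hU : IsOpen U)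
    {G : Cn n → Matrix (Fin n) (Fin n) ℂ} (hcont : ∀ i j, ContinuousOn (fun z => G z i j) U)
    (hG : KahlerClosedOn U G) {ψ : Cn n → ℝ} (hψ : ContDiff ℝ 1 ψ) (hc : HasCompactSupport ψ)
    (hs : tsupport ψ ⊆ U) (j : Fin n) :
    ∑ i, ∫ z, (G z).adjugate j i * dz ψ z i = 0 := by
  have hc' : IsCompact (tsupport ψ) := hc
  -- The compact thickening leaves room for mollification at all scales at most `δ`. Restricting the
  -- metric to it makes the entries integrable without any control near the boundary of `U`.
  obtain ⟨δ, hδ, hδU⟩ := hc'.exists_cthickening_subset_open hU hs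
  set K₀ := Metric.cthickening δ (tsupport ψ) with hK₀
  have hK₀c : IsCompact K₀ := hc'.cthickening
  have hint : ∀ i j, LocallyIntegrable (K₀.indicator fun z => G z i j) := fun i j =>
    (((hcont i j).mono hδU).integrableOn_compact hK₀c).integrable_indicator
      hK₀c.measurableSet |>.locallyIntegrable
  have hball : ∀ z ∈ tsupport ψ, Metric.closedBall z δ ⊆ K₀ := fun z hz =>
    Metric.closedBall_subset_cthickening hz δ
  let φ : ℕ → ContDiffBump (0 : Cn n) := fun m =>
    ⟨δ / (m + 2) / 2, δ / (m + 2), by positivity, by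
      have : (0 : ℝ) < δ / (m + 2) := by positivity
      linarith⟩
  have hout : ∀ m, (φ m).rOut ≤ δ := fun m => by
    refine div_le_self hδ.le ?_
    have : (0 : ℝ) ≤ m := Nat.cast_nonneg m
    linarith
  have hlim : Tendsto (fun m => (φ m).rOut) atTop (𝓝 0) := by
    have h1 : Tendsto (fun m : ℕ => (m : ℝ) + 2) atTop atTop :=
      tendsto_atTop_add_const_right _ _ tendsto_natCast_atTop_atTop
    exact h1.const_div_atTop δ
  have hz0 := fun m => sum_integral_adjugate_mollify hG hδU hint (φ m) hψ hc
    (fun z hz => (Metric.closedBall_subset_closedBall (hout m)).trans (hball z hz)) j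
  set A : ℕ → Cn n → Matrix (Fin n) (Fin n) ℂ :=
    fun m z => Matrix.of fun a b => mollify (φ m) (K₀.indicator fun z => G z a b) z with hA
  have hmem : tsupport ψ ⊆ K₀ := Metric.self_subset_cthickening _
  -- uniform convergence of the entries on the support
  have hunif : ∀ η > 0, ∀ᶠ m in atTop, ∀ z ∈ tsupport ψ, ∀ a b, dist (A m z a b) (G z a b) ≤ η := by
    intro η hη
    have h1 : ∀ a b, ∀ᶠ m in atTop, ∀ z ∈ tsupport ψ, dist (A m z a b) (G z a b) ≤ η := by
      intro a b
      have huc := hK₀c.uniformContinuousOn_of_continuous ((hcont a b).mono hδU)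
      rw [Metric.uniformContinuousOn_iff] at huc
      obtain ⟨d, hd, hd'⟩ := huc η hη
      filter_upwards [hlim.eventually (gt_mem_nhds hd)] with m hm z hz
      have := dist_mollify_le (φ m) (hint a b) (x := z) (η := η) ?_
      · rwa [indicator_of_mem (hmem hz)] at this
      · intro y hy
        have hyK : y ∈ K₀ := hball z hz (Metric.closedBall_subset_closedBall (hout m)
          (Metric.ball_subset_closedBall hy))
        rw [indicator_of_mem hyK, indicator_of_mem (hmem hz)]
        exact (hd' y hyK z (hmem hz) (lt_trans hy hm)).le
    filter_upwards [eventually_all.2 fun a => eventually_all.2 fun b => h1 a b] with m hm z hz a b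
      using hm a b z hz
  have hGb : ∃ M : ℝ, ∀ z ∈ tsupport ψ, ∀ a b, ‖G z a b‖ ≤ M := by
    have h1 : ∀ a b, ∃ M : ℝ, ∀ z ∈ tsupport ψ, ‖G z a b‖ ≤ M := fun a b =>
      hc'.exists_bound_of_continuousOn ((hcont a b).mono hs)
    choose M hM using h1
    refine ⟨∑ a, ∑ b, |M a b|, fun z hz a b => (hM a b z hz).trans ?_⟩
    refine (le_abs_self _).trans ?_
    refine (Finset.single_le_sum (f := fun b => |M a b|) (fun _ _ => abs_nonneg _)
      (Finset.mem_univ b)).trans ?_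
    exact Finset.single_le_sum (f := fun a => ∑ b, |M a b|)
      (fun _ _ => Finset.sum_nonneg fun _ _ => abs_nonneg _) (Finset.mem_univ a)
  obtain ⟨M, hM⟩ := hGb
  have hadjc : ∀ a b, Continuous fun B : Fin n → Fin n → ℂ => (Matrix.of B).adjugate a b :=
    fun a b => (Continuous.matrix_adjugate continuous_id).matrix_elem a b
  -- The adjugate is bounded on a ball of matrices. Radius `|M| + 1` suffices, because the mollified
  -- entries are eventually within `1` of those of `G`; this provides the dominating function.
  have hadjb : ∀ i, ∃ C : ℝ, ∀ B ∈ Metric.closedBall (0 : Fin n → Fin n → ℂ) (|M| + 1),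
      ‖(Matrix.of B).adjugate j i‖ ≤ C := fun i =>
    (isCompact_closedBall _ _).exists_bound_of_continuousOn (hadjc j i).continuousOn
  have htend : ∀ i, Tendsto (fun m => ∫ z, (A m z).adjugate j i * dz ψ z i) atTop
      (𝓝 (∫ z, (G z).adjugate j i * dz ψ z i)) := by
    intro i
    obtain ⟨C, hC⟩ := hadjb i
    refine tendsto_integral_filter_of_dominated_convergence (fun z => C * ‖dz ψ z i‖) ?_ ?_ ?_ ?_
    · refine Eventually.of_forall fun m => ?_
      have hsm : ∀ a b, ContDiff ℝ 1 fun z => A m z a b := fun a b =>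
        contDiff_mollify (φ m) (hint a b)
      exact ((contDiff_adjugate hsm j i).continuous.mul
        (continuous_dz hψ i)).aestronglyMeasurable
    · filter_upwards [hunif 1 one_pos] with m hm
      refine Eventually.of_forall fun z => ?_
      by_cases hz : z ∈ tsupport ψ
      · rw [norm_mul]
        refine mul_le_mul_of_nonneg_right (hC (fun a b => A m z a b) ?_) (norm_nonneg _)
        rw [mem_closedBall_zero_iff]
        refine (pi_norm_le_iff_of_nonneg (by positivity)).2 fun a =>
          (pi_norm_le_iff_of_nonneg (by positivity)).2 fun b => ?_
        have e1 := hm z hz a b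
        have e2 := hM z hz a b
        rw [dist_eq_norm] at e1
        have e3 := norm_add_le (A m z a b - G z a b) (G z a b)
        rw [sub_add_cancel] at e3
        linarith [le_abs_self M]
      · simp [dz_eq_zero_of_notMem_tsupport hz]
    · exact ((continuous_dz hψ i).integrable_of_hasCompactSupport
        (hasCompactSupport_dz hc i)).norm.const_mul C
    · refine Eventually.of_forall fun z => ?_
      by_cases hz : z ∈ tsupport ψ
      · refine Tendsto.mul_const _ ?_
        have h1 : Tendsto (fun m => (A m z : Fin n → Fin n → ℂ)) atTop (𝓝 (G z)) := by
          refine tendsto_pi_nhds.2 fun a => tendsto_pi_nhds.2 fun b => ?_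
          rw [Metric.tendsto_atTop']
          intro η hη
          obtain ⟨N, hN⟩ := eventually_atTop.1 (hunif (η / 2) (by positivity))
          exact ⟨N, fun m hm => (hN m hm.le z hz a b).trans_lt (by linarith)⟩
        exact ((hadjc j i).tendsto _).comp h1
      · simp [dz_eq_zero_of_notMem_tsupport hz]
  have h3 := tendsto_finsetSum Finset.univ fun i _ => htend i
  exact tendsto_nhds_unique h3 (by
    have : (fun m => ∑ i, ∫ z, (A m z).adjugate j i * dz ψ z i) = fun _ => 0 := funext hz0
    rw [this]; exact tendsto_const_nhds)

end ConicHeat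

/-! ### Linear algebra of metrics comparable to a diagonal model. -/

namespace ConicHeat

/-- The sesquilinear form `∑ M_{ij} v_i conj(w_j)`. -/
noncomputable def sesq {n : ℕ} (M : Matrix (Fin n) (Fin n) ℂ) (v w : Fin n → ℂ) : ℂ :=
  ∑ i, ∑ j, M i j * v i * starRingEnd ℂ (w j)

theorem sesq_add_smul {n : ℕ} (M : Matrix (Fin n) (Fin n) ℂ) (hM : M.IsHermitian)
    (s t : ℝ) (v w : Fin n → ℂ) :
    (sesq M (fun i => s * v i + t * w i) (fun i => s * v i + t * w i)).re
      = s ^ 2 * (sesq M v v).re + 2 * s * t * (sesq M v w).re + t ^ 2 * (sesq M w w).re := by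
  have h : (sesq M w v).re = (sesq M v w).re := by
    have : sesq M w v = starRingEnd ℂ (sesq M v w) := by
      unfold sesq
      rw [map_sum, Finset.sum_comm]
      refine Finset.sum_congr rfl fun i _ => ?_
      rw [map_sum]
      refine Finset.sum_congr rfl fun j _ => ?_
      rw [map_mul, map_mul, Complex.conj_conj]
      have := hM.apply j i
      rw [← this]
      simp only [RCLike.star_def]
      ring
    rw [this, Complex.conj_re]
  have e : sesq M (fun i => s * v i + t * w i) (fun i => s * v i + t * w i)
      = (s ^ 2 : ℝ) * sesq M v v + (s * t : ℝ) * sesq M v w + (s * t : ℝ) * sesq M w v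
        + (t ^ 2 : ℝ) * sesq M w w := by
    unfold sesq
    simp only [Finset.mul_sum, ← Finset.sum_add_distrib]
    refine Finset.sum_congr rfl fun i _ => Finset.sum_congr rfl fun j _ => ?_
    simp only [map_add, map_mul, Complex.conj_ofReal]
    push_cast
    ring
  rw [e]
  simp only [Complex.add_re, Complex.re_ofReal_mul, h]
  ring

theorem quasiIsometric_sesq {n : ℕ} {K : ℝ} {m : Fin n → ℝ} {G : Matrix (Fin n) (Fin n) ℂ}
    (h : QuasiIsometric K m G) (v : Fin n → ℂ) :
    K⁻¹ * ∑ j, m j * ‖v j‖ ^ 2 ≤ (sesq G v v).re ∧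
      (sesq G v v).re ≤ K * ∑ j, m j * ‖v j‖ ^ 2 := h.2 v

/-- Conjugation by the diagonal matrix with entries $m_j^{-1/2}$ turns `G` into a Hermitian matrix
whose spectrum lies in $[K^{-1},K]$. The determinant of `G` is the product of those eigenvalues
times $\prod m_j$, hence real and two-sidedly bounded. -/
theorem det_bounds_of_quasiIsometric {n : ℕ} {K : ℝ} (hK : 0 < K) {m : Fin n → ℝ}
    (hm : ∀ j, 0 < m j) {G : Matrix (Fin n) (Fin n) ℂ} (h : QuasiIsometric K m G) :
    ((G.det.re : ℝ) : ℂ) = G.det ∧ K⁻¹ ^ n * ∏ j, m j ≤ G.det.re ∧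
      G.det.re ≤ K ^ n * ∏ j, m j := by
  set d : Fin n → ℂ := fun j => (((√(m j))⁻¹ : ℝ) : ℂ) with hd
  set H : Matrix (Fin n) (Fin n) ℂ := Matrix.diagonal d * G * Matrix.diagonal d with hH
  have hHij : ∀ i j, H i j = d i * G i j * d j := fun i j => by
    rw [hH, Matrix.mul_diagonal, Matrix.diagonal_mul]
  have hHh : H.IsHermitian := by
    ext i j
    rw [Matrix.conjTranspose_apply, hHij, hHij, ← h.1.apply i j]
    simp [hd]
    ring
  have hdet : H.det = (∏ j, ((m j)⁻¹ : ℝ) : ℝ) * G.det := by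
    rw [hH, Matrix.det_mul, Matrix.det_mul, Matrix.det_diagonal]
    have : (((∏ j, ((m j)⁻¹ : ℝ) : ℝ)) : ℂ) = (∏ j, d j) * ∏ j, d j := by
      rw [← Finset.prod_mul_distrib, Complex.ofReal_prod]
      refine Finset.prod_congr rfl fun j _ => ?_
      simp only [hd]
      rw [← Complex.ofReal_mul, ← mul_inv, Real.mul_self_sqrt (hm j).le]
    rw [this]; ring
  have heig : ∀ i, K⁻¹ ≤ hHh.eigenvalues i ∧ hHh.eigenvalues i ≤ K := by
    intro i
    set x : EuclideanSpace ℂ (Fin n) := hHh.eigenvectorBasis i with hx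
    have hxn : ∑ j, ‖x j‖ ^ 2 = 1 := by
      rw [← EuclideanSpace.norm_sq_eq, hx, OrthonormalBasis.norm_eq_one]; norm_num
    have e1 := hHh.eigenvalues_eq i
    set v : Fin n → ℂ := fun j => starRingEnd ℂ (d j * x j) with hv
    have e2 : hHh.eigenvalues i = (sesq G v v).re := by
      rw [e1]
      unfold sesq
      simp only [dotProduct, Matrix.mulVec, Finset.mul_sum, RCLike.re_eq_complex_re]
      congr 1
      refine Finset.sum_congr rfl fun a _ => Finset.sum_congr rfl fun b _ => ?_
      simp only [hHij, hv, Complex.conj_conj, map_mul, hd, Complex.conj_ofReal, Pi.star_apply,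
        RCLike.star_def, hx]
      ring
    have e3 : ∑ j, m j * ‖v j‖ ^ 2 = 1 := by
      rw [← hxn]
      refine Finset.sum_congr rfl fun j _ => ?_
      simp only [hv, RCLike.norm_conj, norm_mul, hd, Complex.norm_real, mul_pow, Real.norm_eq_abs,
        sq_abs, inv_pow, Real.sq_sqrt (hm j).le]
      rw [← mul_assoc, mul_inv_cancel₀ (hm j).ne', one_mul]
    have := quasiIsometric_sesq h v
    rw [e3, mul_one, mul_one, ← e2] at this
    exact this
  have hprod : H.det = ((∏ i, hHh.eigenvalues i : ℝ) : ℂ) := by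
    rw [hHh.det_eq_prod_eigenvalues, Complex.ofReal_prod]; rfl
  have hmp : 0 < ∏ j, m j := Finset.prod_pos fun j _ => hm j
  have hGdet : G.det = ((∏ j, m j) * ∏ i, hHh.eigenvalues i : ℝ) := by
    rw [Complex.ofReal_mul, ← hprod, hdet, ← mul_assoc, ← Complex.ofReal_mul,
      ← Finset.prod_mul_distrib]
    simp [mul_inv_cancel₀ (hm _).ne']
  rw [hGdet, Complex.ofReal_re]
  have lo : K⁻¹ ^ n ≤ ∏ i, hHh.eigenvalues i := by
    have := Finset.prod_le_prod (s := Finset.univ) (f := fun _ : Fin n => K⁻¹)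
      (g := hHh.eigenvalues) (fun _ _ => by positivity) (fun i _ => (heig i).1)
    simpa using this
  have hi : ∏ i, hHh.eigenvalues i ≤ K ^ n := by
    have := Finset.prod_le_prod (s := Finset.univ) (g := fun _ : Fin n => K)
      (f := hHh.eigenvalues) (fun i _ => (inv_pos.2 hK).le.trans (heig i).1)
      (fun i _ => (heig i).2)
    simpa using this
  refine ⟨rfl, ?_, ?_⟩
  · rw [mul_comm]; gcongr
  · rw [mul_comm]; gcongr

/-- The cometric times the volume density, `det(g) g^{i j̄} a_i conj(b_j)`. -/
noncomputable def coform {n : ℕ} (G : Matrix (Fin n) (Fin n) ℂ) (a b : Fin n → ℂ) : ℝ :=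
  (∑ i, ∑ j, G.adjugate j i * a i * starRingEnd ℂ (b j)).re

theorem coform_eq_sesq {n : ℕ} (G : Matrix (Fin n) (Fin n) ℂ) (a b : Fin n → ℂ) :
    coform G a b = (sesq G.adjugate.transpose a b).re := rfl

theorem isHermitian_adjugate_transpose {n : ℕ} {G : Matrix (Fin n) (Fin n) ℂ}
    (h : G.IsHermitian) : G.adjugate.transpose.IsHermitian :=
  h.adjugate.transpose

/-- The cometric of a quasi-isometric metric is quasi-isometric to the model cometric. -/
theorem coform_bounds {n : ℕ} {K : ℝ} (hK : 0 < K) {m : Fin n → ℝ}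
    (hm : ∀ j, 0 < m j) {G : Matrix (Fin n) (Fin n) ℂ} (h : QuasiIsometric K m G)
    (a : Fin n → ℂ) :
    G.det.re * (K⁻¹ * ∑ j, (m j)⁻¹ * ‖a j‖ ^ 2) ≤ coform G a a ∧
      coform G a a ≤ G.det.re * (K * ∑ j, (m j)⁻¹ * ‖a j‖ ^ 2) := by
  obtain ⟨hre, hlo, -⟩ := det_bounds_of_quasiIsometric hK hm h
  have hdpos : 0 < G.det.re := lt_of_lt_of_le
    (mul_pos (pow_pos (inv_pos.2 hK) _) (Finset.prod_pos fun j _ => hm j)) hlo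
  have hdet : G.det ≠ 0 := by
    rw [← hre]; exact_mod_cast hdpos.ne'
  -- Raising the index: with $Gu=a$ and $v=\bar u$, the form `coform G a a` equals $\det G$ times
  -- the value of the metric at `v`. It remains to compare this value with the weighted norm of `a`.
  set u : Fin n → ℂ := G⁻¹.mulVec a with hu
  set v : Fin n → ℂ := fun j => starRingEnd ℂ (u j) with hv
  have hGu : G.mulVec u = a := by
    rw [hu, Matrix.mulVec_mulVec, Matrix.mul_nonsing_inv _ (isUnit_iff_ne_zero.2 hdet),
      Matrix.one_mulVec]
  have hadj : G.adjugate.mulVec a = G.det • u := by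
    rw [← hGu, Matrix.mulVec_mulVec, Matrix.adjugate_mul, Matrix.smul_mulVec,
      Matrix.one_mulVec]
  have hS : ∀ x : Fin n → ℂ, sesq G x v = ∑ i, x i * a i := by
    intro x
    unfold sesq
    refine Finset.sum_congr rfl fun i _ => ?_
    rw [← hGu, Matrix.mulVec, dotProduct, Finset.mul_sum]
    refine Finset.sum_congr rfl fun j _ => ?_
    simp only [hv, Complex.conj_conj]
    ring
  have hq : coform G a a = G.det.re * (sesq G v v).re := by
    have e1 : ∑ i, ∑ j, G.adjugate j i * a i * starRingEnd ℂ (a j)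
        = G.det * starRingEnd ℂ (sesq G v v) := by
      rw [hS, map_sum, Finset.sum_comm, Finset.mul_sum]
      refine Finset.sum_congr rfl fun j _ => ?_
      rw [← Finset.sum_mul]
      have : ∑ i, G.adjugate j i * a i = G.det * u j := by
        have := congrFun hadj j
        simpa [Matrix.mulVec, dotProduct] using this
      rw [this, map_mul]
      simp only [hv, Complex.conj_conj]
      ring
    rw [coform, e1, ← hre, Complex.re_ofReal_mul, Complex.conj_re, Complex.ofReal_re]
  set p := ∑ j, (m j)⁻¹ * ‖a j‖ ^ 2 with hp
  set q := (sesq G v v).re with hqq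
  rw [hq]
  have hKi := inv_pos.2 hK
  constructor
  · refine mul_le_mul_of_nonneg_left ?_ hdpos.le
    -- The dual vector of `a` for the model weights, so that its pairing with `v` is `p`.
    -- Nonnegativity of the form at $K^{-1}x-v$ reads $K^{-2}(x,x)-2K^{-1}p+q\ge0$, and $(x,x)\le
    -- Kp$ gives $q\ge K^{-1}p$.
    set x : Fin n → ℂ := fun j => ((m j)⁻¹ : ℝ) * starRingEnd ℂ (a j) with hx
    have h1 : (sesq G x v).re = p := by
      rw [hS, Complex.re_sum, hp]
      refine Finset.sum_congr rfl fun j _ => ?_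
      simp only [hx]
      rw [mul_assoc, Complex.re_ofReal_mul, mul_comm (starRingEnd ℂ (a j)), Complex.mul_conj,
        Complex.ofReal_re, Complex.normSq_eq_norm_sq]
    have h2 : (sesq G x x).re ≤ K * p := by
      refine (quasiIsometric_sesq h x).2.trans_eq ?_
      congr 1
      refine Finset.sum_congr rfl fun j _ => ?_
      simp only [hx, norm_mul, RCLike.norm_conj, Complex.norm_real, mul_pow, Real.norm_eq_abs,
        sq_abs]
      have := (hm j).ne'
      field_simp
    have h3 := sesq_add_smul G h.1 K⁻¹ (-1) x v
    have h4 : 0 ≤ (sesq G (fun i => (K⁻¹ : ℝ) * x i + (-1 : ℝ) * v i)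
        (fun i => (K⁻¹ : ℝ) * x i + (-1 : ℝ) * v i)).re := by
      refine le_trans ?_ (quasiIsometric_sesq h _).1
      exact mul_nonneg hKi.le (Finset.sum_nonneg fun j _ => mul_nonneg (hm j).le (sq_nonneg _))
    rw [h3, h1] at h4
    have h5 : K⁻¹ ^ 2 * (sesq G x x).re ≤ K⁻¹ * p := by
      have := mul_le_mul_of_nonneg_left h2 (sq_nonneg K⁻¹)
      refine this.trans_eq ?_
      field_simp
    change K⁻¹ * p ≤ q
    linarith
  · refine mul_le_mul_of_nonneg_left ?_ hdpos.le
    -- Young's inequality with weight `K`: the half containing `v` is at most $q/2$ by the lower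
    -- metric bound and is absorbed.
    have h1 : q ≤ ∑ j, (1 / 2) * (K⁻¹ * (m j * ‖v j‖ ^ 2) + K * ((m j)⁻¹ * ‖a j‖ ^ 2)) := by
      rw [hqq, hS, Complex.re_sum]
      refine Finset.sum_le_sum fun j _ => ?_
      refine (Complex.re_le_norm _).trans ?_
      rw [norm_mul]
      have hmj := hm j
      have : 0 ≤ (K * m j)⁻¹ * (m j * ‖v j‖ - K * ‖a j‖) ^ 2 := by positivity
      have e : (K * m j)⁻¹ * (m j * ‖v j‖ - K * ‖a j‖) ^ 2
          = K⁻¹ * (m j * ‖v j‖ ^ 2) + K * ((m j)⁻¹ * ‖a j‖ ^ 2) - 2 * (‖v j‖ * ‖a j‖) := by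
        field_simp
        ring
      linarith
    rw [← Finset.mul_sum, Finset.sum_add_distrib, ← Finset.mul_sum, ← Finset.mul_sum] at h1
    have h2 := (quasiIsometric_sesq h v).1
    change q ≤ K * p
    linarith

end ConicHeat

/-! ### Integration by parts for the Laplacian of a continuous Kähler metric. -/

namespace ConicHeat
open scoped Topology
open Filter

/-- The source of most of the integrability below: the integrands are continuous only near a compact
set avoiding the divisor and vanish outside it, so nothing has to be known elsewhere. -/
theorem integrable_of_continuousOn_of_eq_zero {X F : Type*} [TopologicalSpace X] [T2Space X]
    [MeasurableSpace X] [OpensMeasurableSpace X] {μ : Measure X} [IsFiniteMeasureOnCompacts μ]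
    [NormedAddCommGroup F] {f : X → F} {A : Set X} (hA : IsCompact A)
    (hf : ContinuousOn f A) (h0 : ∀ x ∉ A, f x = 0) : Integrable f μ := by
  refine (integrableOn_iff_integrable_of_support_subset (s := A) fun x hx => ?_).1
    (hf.integrableOn_compact' hA hA.measurableSet)
  by_contra hxA
  exact hx (h0 x hxA)

theorem contDiff_of_contDiffAt_tsupport {E F : Type*} [NormedAddCommGroup E] [NormedSpace ℝ E]
    [NormedAddCommGroup F] [NormedSpace ℝ F] {m : WithTop ℕ∞} {f : E → F}
    (h : ∀ x ∈ tsupport f, ContDiffAt ℝ m f x) : ContDiff ℝ m f := by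
  refine contDiff_iff_contDiffAt.2 fun x => ?_
  by_cases hx : x ∈ tsupport f
  · exact h x hx
  · exact contDiffAt_const.congr_of_eventuallyEq (notMem_tsupport_iff_eventuallyEq.1 hx)

theorem dz_mul {n : ℕ} {f g : Cn n → ℝ} {z : Cn n} (hf : DifferentiableAt ℝ f z)
    (hg : DifferentiableAt ℝ g z) (i : Fin n) :
    dz (fun z => f z * g z) z i = dz f z i * g z + f z * dz g z i := by
  have h : HasFDerivAt (fun z => f z * g z) _ z := hf.hasFDerivAt.mul hg.hasFDerivAt
  unfold dz
  rw [h.fderiv]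
  simp only [add_apply, smul_apply, smul_eq_mul]
  push_cast
  ring

theorem contDiffAt_fderiv_apply {n : ℕ} {W : Cn n → ℝ} {z : Cn n} (hW : ContDiffAt ℝ 2 W z)
    (v : Cn n) : ContDiffAt ℝ 1 (fun z => fderiv ℝ W z v) z :=
  (hW.fderiv_right (m := 1) (by norm_num)).clm_apply contDiffAt_const

theorem fderiv_fderiv_apply {n : ℕ} {W : Cn n → ℝ} {z : Cn n} (hW : ContDiffAt ℝ 2 W z)
    (v w : Cn n) : fderiv ℝ (fun z => fderiv ℝ W z v) z w = fderiv ℝ (fderiv ℝ W) z w v := by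
  have h1 : HasFDerivAt (fderiv ℝ W) (fderiv ℝ (fderiv ℝ W) z) z :=
    ((hW.fderiv_right (m := 1) (by norm_num)).differentiableAt one_ne_zero).hasFDerivAt
  have h2 := h1.clm_apply (hasFDerivAt_const v z)
  rw [h2.fderiv]
  simp

theorem continuousOn_adjugate {n : ℕ} {U : Set (Cn n)} {G : Cn n → Matrix (Fin n) (Fin n) ℂ}
    (hcont : ∀ i j, ContinuousOn (fun z => G z i j) U) (a b : Fin n) :
    ContinuousOn (fun z => (G z).adjugate a b) U := by
  have h1 : Continuous fun B : Fin n → Fin n → ℂ => (Matrix.of B).adjugate a b :=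
    (Continuous.matrix_adjugate continuous_id).matrix_elem a b
  have h2 : ContinuousOn (fun z => (fun i j => G z i j : Fin n → Fin n → ℂ)) U :=
    continuousOn_pi.2 fun i => continuousOn_pi.2 fun j => hcont i j
  exact h1.comp_continuousOn h2

theorem continuousOn_det {n : ℕ} {U : Set (Cn n)} {G : Cn n → Matrix (Fin n) (Fin n) ℂ}
    (hcont : ∀ i j, ContinuousOn (fun z => G z i j) U) :
    ContinuousOn (fun z => (G z).det) U := by
  have h1 : Continuous fun B : Fin n → Fin n → ℂ => (Matrix.of B).det :=
    Continuous.matrix_det continuous_id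
  have h2 : ContinuousOn (fun z => (fun i j => G z i j : Fin n → Fin n → ℂ)) U :=
    continuousOn_pi.2 fun i => continuousOn_pi.2 fun j => hcont i j
  exact h1.comp_continuousOn h2

theorem continuousOn_dz {n : ℕ} {W : Cn n → ℝ} {V : Set (Cn n)} (hV : IsOpen V)
    (hW : ContDiffOn ℝ 1 W V) (j : Fin n) : ContinuousOn (fun z => dz W z j) V := by
  have := hW.continuousOn_fderiv_of_isOpen hV le_rfl
  unfold dz
  fun_prop

theorem continuousOn_coform {n : ℕ} {U : Set (Cn n)} {G : Cn n → Matrix (Fin n) (Fin n) ℂ}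
    (hcont : ∀ i j, ContinuousOn (fun z => G z i j) U) {a b : Cn n → Fin n → ℂ}
    (ha : ∀ i, ContinuousOn (fun z => a z i) U) (hb : ∀ i, ContinuousOn (fun z => b z i) U) :
    ContinuousOn (fun z => coform (G z) (a z) (b z)) U := by
  unfold coform
  refine Complex.continuous_re.comp_continuousOn ?_
  refine continuousOn_finsetSum _ fun i _ => continuousOn_finsetSum _ fun j _ => ?_
  exact ((continuousOn_adjugate hcont j i).mul (ha i)).mul
    (Complex.continuous_conj.comp_continuousOn (hb j))

/-- The volume density turns the inverse matrix into the adjugate, which is the divergence-free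
object. -/
theorem laplacian_mul_det {n : ℕ} {G : Matrix (Fin n) (Fin n) ℂ}
    (hre : ((G.det.re : ℝ) : ℂ) = G.det) (h0 : G.det ≠ 0) (W : Cn n → ℝ) (z : Cn n) :
    laplacian G W z * G.det.re
      = 4 * (∑ j, ∑ i, G.adjugate j i * complexHessian W z i j).re := by
  have h1 : ∀ i j, G.adjugate j i = G.det * G⁻¹ j i := by
    intro i j
    rw [Matrix.inv_def, Matrix.smul_apply, smul_eq_mul, ← mul_assoc,
      Ring.mul_inverse_cancel _ (isUnit_iff_ne_zero.2 h0), one_mul]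
  unfold laplacian
  simp_rw [h1, mul_assoc]
  rw [Finset.sum_comm]
  simp_rw [← Finset.mul_sum]
  rw [← hre, Complex.re_ofReal_mul, Complex.ofReal_re]
  ring

/-- Integration by parts for the Laplacian of a Kähler metric which is only continuous. -/
theorem integral_mul_laplacian {n : ℕ} {V : Set (Cn n)} (hV : IsOpen V)
    {G : Cn n → Matrix (Fin n) (Fin n) ℂ} (hcont : ∀ i j, ContinuousOn (fun z => G z i j) V)
    (hG : KahlerClosedOn V G)
    (hdet : ∀ z ∈ V, (((G z).det.re : ℝ) : ℂ) = (G z).det ∧ (G z).det ≠ 0)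
    {W : Cn n → ℝ} (hW : ContDiffOn ℝ 2 W V) {η : Cn n → ℝ} (hη : ContDiff ℝ 1 η)
    (hc : HasCompactSupport η) (hs : tsupport η ⊆ V) :
    Integrable (fun z => η z * laplacian (G z) W z * (G z).det.re) ∧
    ∫ z, η z * laplacian (G z) W z * (G z).det.re
      = -4 * ∫ z, coform (G z) (dz η z) (dz W z) := by
  have hWa : ∀ z ∈ V, ContDiffAt ℝ 2 W z := fun z hz => hW.contDiffAt (hV.mem_nhds hz)
  have hc' : IsCompact (tsupport η) := hc
  -- Real test functions for the weak Piola identity. The directions $e_j$ and $\sqrt{-1}\,e_j$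
  -- combine to $\eta\,\partial W/\partial\bar z_j$, which is $C^1$ because `W` is $C^2$ on the
  -- support of `η`.
  have hψ : ∀ v : Cn n, ContDiff ℝ 1 fun z => η z * ((1 / 2) * fderiv ℝ W z v) := by
    intro v
    refine contDiff_of_contDiffAt_tsupport fun z hz => ?_
    have hz' : z ∈ tsupport η := tsupport_mul_subset_left hz
    exact hη.contDiffAt.mul (contDiffAt_const.mul (contDiffAt_fderiv_apply (hWa z (hs hz')) v))
  have hψs : ∀ v : Cn n, tsupport (fun z => η z * ((1 / 2) * fderiv ℝ W z v)) ⊆ tsupport η :=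
    fun v => tsupport_mul_subset_left
  have hψc : ∀ v : Cn n, HasCompactSupport fun z => η z * ((1 / 2) * fderiv ℝ W z v) :=
    fun v => hc.mul_right
  have hweak : ∀ v j, ∑ i, ∫ z, (G z).adjugate j i *
      dz (fun z => η z * ((1 / 2) * fderiv ℝ W z v)) z i = 0 := fun v j =>
    sum_integral_adjugate_mul_dz hV hcont hG (hψ v) (hψc v) ((hψs v).trans hs) j
  have hint : ∀ v j i, Integrable fun z => (G z).adjugate j i *
      dz (fun z => η z * ((1 / 2) * fderiv ℝ W z v)) z i := by
    intro v j i
    refine integrable_of_continuousOn_of_eq_zero hc'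
      (((continuousOn_adjugate hcont j i).mono hs).mul (continuous_dz (hψ v) i).continuousOn) ?_
    intro z hz
    rw [dz_eq_zero_of_notMem_tsupport (fun h => hz (hψs v h)), mul_zero]
  set e : Fin n → Cn n := fun i => EuclideanSpace.single i 1 with he
  set e' : Fin n → Cn n := fun i => EuclideanSpace.single i Complex.I with he'
  have hsum : ∫ z, ∑ j, ∑ i, (G z).adjugate j i *
      (dz (fun z => η z * ((1 / 2) * fderiv ℝ W z (e j))) z i
        + Complex.I * dz (fun z => η z * ((1 / 2) * fderiv ℝ W z (e' j))) z i) = 0 := by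
    have e1 : ∀ j i z, (G z).adjugate j i *
      (dz (fun z => η z * ((1 / 2) * fderiv ℝ W z (e j))) z i
        + Complex.I * dz (fun z => η z * ((1 / 2) * fderiv ℝ W z (e' j))) z i)
      = (G z).adjugate j i * dz (fun z => η z * ((1 / 2) * fderiv ℝ W z (e j))) z i
        + Complex.I * ((G z).adjugate j i *
          dz (fun z => η z * ((1 / 2) * fderiv ℝ W z (e' j))) z i) := fun j i z => by ring
    simp_rw [e1]
    have hint2 : ∀ j i, Integrable fun z => (G z).adjugate j i *
        dz (fun z => η z * ((1 / 2) * fderiv ℝ W z (e j))) z i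
        + Complex.I * ((G z).adjugate j i *
          dz (fun z => η z * ((1 / 2) * fderiv ℝ W z (e' j))) z i) := fun j i =>
      (hint _ j i).add ((hint _ j i).const_mul _)
    rw [integral_finsetSum _ fun j _ => integrable_finsetSum _ fun i _ => hint2 j i]
    refine Finset.sum_eq_zero fun j _ => ?_
    rw [integral_finsetSum _ fun i _ => hint2 j i]
    have : ∀ i, ∫ z, ((G z).adjugate j i *
        dz (fun z => η z * ((1 / 2) * fderiv ℝ W z (e j))) z i
        + Complex.I * ((G z).adjugate j i *
          dz (fun z => η z * ((1 / 2) * fderiv ℝ W z (e' j))) z i))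
        = (∫ z, (G z).adjugate j i * dz (fun z => η z * ((1 / 2) * fderiv ℝ W z (e j))) z i)
        + Complex.I * ∫ z, (G z).adjugate j i *
          dz (fun z => η z * ((1 / 2) * fderiv ℝ W z (e' j))) z i := fun i => by
      rw [integral_add (hint _ j i) ((hint _ j i).const_mul _), integral_const_mul]
    simp_rw [this]
    rw [Finset.sum_add_distrib, ← Finset.mul_sum, hweak, hweak]
    simp
  -- Leibniz rule for $\partial_i(\eta\,\partial_{\bar j}W)$. Since `W` is real, $\partial_{\bar
  -- j}W$ is the conjugate of $\partial_jW$; the second term carries the complex Hessian, and off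
  -- the support of `η` every term is zero.
  have hpt : ∀ z j i, dz (fun z => η z * ((1 / 2) * fderiv ℝ W z (e j))) z i
        + Complex.I * dz (fun z => η z * ((1 / 2) * fderiv ℝ W z (e' j))) z i
      = dz η z i * starRingEnd ℂ (dz W z j) + η z * complexHessian W z i j := by
    intro z j i
    by_cases hz : z ∈ tsupport η
    · have hWz := hWa z (hs hz)
      have hd : ∀ v, DifferentiableAt ℝ (fun z => (1 / 2) * fderiv ℝ W z v) z := fun v =>
        ((contDiffAt_fderiv_apply hWz v).differentiableAt one_ne_zero).const_mul _
      have hdd : ∀ v w, fderiv ℝ (fun z => (1 / 2) * fderiv ℝ W z v) z w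
          = (1 / 2) * fderiv ℝ (fderiv ℝ W) z w v := by
        intro v w
        have h0 := (contDiffAt_fderiv_apply hWz v).differentiableAt one_ne_zero
        rw [fderiv_const_mul h0, smul_apply, fderiv_fderiv_apply hWz, smul_eq_mul]
      rw [dz_mul (hη.differentiable one_ne_zero z) (hd _),
        dz_mul (hη.differentiable one_ne_zero z) (hd _)]
      have e1 : dz (fun z => (1 / 2) * fderiv ℝ W z (e j)) z i
          + Complex.I * dz (fun z => (1 / 2) * fderiv ℝ W z (e' j)) z i
          = complexHessian W z i j := by
        simp only [dz, hdd, complexHessian, he, he']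
        push_cast
        linear_combination (-(1 / 4) * (fderiv ℝ (fderiv ℝ W) z
          (EuclideanSpace.single i Complex.I) (EuclideanSpace.single j Complex.I) : ℂ))
            * Complex.I_sq
      have e2 : ((1 / 2 * fderiv ℝ W z (e j) : ℝ) : ℂ)
          + Complex.I * ((1 / 2 * fderiv ℝ W z (e' j) : ℝ) : ℂ) = starRingEnd ℂ (dz W z j) := by
        simp only [dz, he, he', map_mul, map_sub, Complex.conj_ofReal, Complex.conj_I, map_div₀,
          map_one, map_ofNat]
        push_cast
        ring
      rw [← e1, ← e2]
      ring
    · rw [dz_eq_zero_of_notMem_tsupport (fun h => hz (hψs _ h)),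
        dz_eq_zero_of_notMem_tsupport (fun h => hz (hψs _ h)), dz_eq_zero_of_notMem_tsupport hz,
        image_eq_zero_of_notMem_tsupport hz]
      simp
  simp_rw [hpt] at hsum
  have hcof : ∀ z, (∑ j, ∑ i, (G z).adjugate j i *
      (dz η z i * starRingEnd ℂ (dz W z j) + η z * complexHessian W z i j)).re
      = coform (G z) (dz η z) (dz W z)
        + (1 / 4) * (η z * laplacian (G z) W z * (G z).det.re) := by
    intro z
    simp only [mul_add, Finset.sum_add_distrib, Complex.add_re]
    congr 1
    · unfold coform
      rw [Finset.sum_comm]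
      simp only [mul_assoc]
    · by_cases hz : z ∈ tsupport η
      · rw [mul_assoc, laplacian_mul_det (hdet z (hs hz)).1 (hdet z (hs hz)).2]
        have : ∀ j i, (G z).adjugate j i * ((η z : ℂ) * complexHessian W z i j)
            = (η z : ℂ) * ((G z).adjugate j i * complexHessian W z i j) := fun j i => by ring
        simp_rw [this, ← Finset.mul_sum]
        rw [Complex.re_ofReal_mul]
        ring
      · simp [image_eq_zero_of_notMem_tsupport hz]
  have hWd : ∀ j, ContinuousOn (fun z => dz W z j) V := fun j =>
    continuousOn_dz hV (hW.of_le (by norm_num)) j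
  have i1 : Integrable fun z => coform (G z) (dz η z) (dz W z) := by
    refine integrable_of_continuousOn_of_eq_zero hc'
      ((continuousOn_coform hcont (fun i => (continuous_dz hη i).continuousOn) hWd).mono hs) ?_
    intro z hz
    simp [coform, dz_eq_zero_of_notMem_tsupport hz]
  have hint3 : Integrable fun z => ∑ j, ∑ i, (G z).adjugate j i *
      (dz η z i * starRingEnd ℂ (dz W z j) + η z * complexHessian W z i j) := by
    refine integrable_finsetSum _ fun j _ => integrable_finsetSum _ fun i _ => ?_
    have := (hint (e j) j i).add ((hint (e' j) j i).const_mul Complex.I)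
    refine this.congr (Eventually.of_forall fun z => ?_)
    change (G z).adjugate j i * _ + Complex.I * ((G z).adjugate j i * _) = _
    change _ = (G z).adjugate j i * _
    rw [← hpt]
    ring
  have hre : ∫ z, (coform (G z) (dz η z) (dz W z)
      + (1 / 4) * (η z * laplacian (G z) W z * (G z).det.re)) = 0 := by
    have h := integral_re hint3
    rw [hsum] at h
    simp only [RCLike.re_eq_complex_re, hcof] at h
    exact h.trans Complex.zero_re
  have i2 : Integrable fun z => η z * laplacian (G z) W z * (G z).det.re := by
    have h := (hint3.re.sub i1).const_mul 4
    refine h.congr (Eventually.of_forall fun z => ?_)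
    have := hcof z
    simp only [Pi.sub_apply, RCLike.re_eq_complex_re]
    rw [this]
    ring
  refine ⟨i2, ?_⟩
  rw [integral_add i1 (i2.const_mul _), integral_const_mul] at hre
  linarith

end ConicHeat

/-! ### The energy inequality on a time slice. -/

namespace ConicHeat
open scoped Topology
open Filter

theorem integrableOn_of_continuousOn_of_eq_zero {X F : Type*} [TopologicalSpace X] [T2Space X]
    [MeasurableSpace X] [OpensMeasurableSpace X] {μ : Measure X} [IsFiniteMeasureOnCompacts μ]
    [NormedAddCommGroup F] {f : X → F} {A V : Set X} (hA : IsCompact A) (hAV : A ⊆ V)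
    (hV : MeasurableSet V) (hf : ContinuousOn f A) (h0 : ∀ x ∈ V \ A, f x = 0) :
    IntegrableOn f V μ := by
  rw [← integrable_indicator_iff hV]
  refine integrable_of_continuousOn_of_eq_zero hA ?_ fun x hx => ?_
  · exact hf.congr fun x hx => indicator_of_mem (hAV hx) f
  · by_cases hxV : x ∈ V
    · rw [indicator_of_mem hxV, h0 x ⟨hxV, hx⟩]
    · exact indicator_of_notMem hxV f

/-- Powers at least two of the positive part are $C^1$. This is why truncations occur squared and
cubed: they are classical test functions and no weak derivatives are needed. -/
theorem hasDerivAt_max_zero_pow (m : ℕ) (x : ℝ) :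
    HasDerivAt (fun x : ℝ => max x 0 ^ (m + 2)) ((m + 2) * max x 0 ^ (m + 1)) x := by
  rcases lt_trichotomy x 0 with hx | hx | hx
  · have h1 : (fun x : ℝ => max x 0 ^ (m + 2)) =ᶠ[𝓝 x] fun _ => 0 := by
      filter_upwards [gt_mem_nhds hx] with y hy
      rw [max_eq_right hy.le, zero_pow (by omega)]
    rw [max_eq_right hx.le, zero_pow (by omega), mul_zero]
    exact (hasDerivAt_const x 0).congr_of_eventuallyEq h1
  · subst hx
    rw [max_self, zero_pow (by omega), mul_zero, hasDerivAt_iff_isLittleO_nhds_zero]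
    simp only [zero_add, max_self, smul_zero, sub_zero, zero_pow (show m + 2 ≠ 0 by omega)]
    refine Asymptotics.IsBigO.trans_isLittleO (g := fun h : ℝ => h ^ (m + 2)) ?_ ?_
    · refine Asymptotics.IsBigO.of_bound 1 (Eventually.of_forall fun h => ?_)
      rw [one_mul, norm_pow, norm_pow]
      refine pow_le_pow_left₀ (norm_nonneg _) ?_ _
      rw [Real.norm_eq_abs, Real.norm_eq_abs, abs_of_nonneg (le_max_right _ _)]
      exact max_le (le_abs_self h) (abs_nonneg h)
    · have := Asymptotics.isLittleO_pow_pow (𝕜 := ℝ) (show 1 < m + 2 by omega)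
      simpa using this
  · have h1 : (fun x : ℝ => max x 0 ^ (m + 2)) =ᶠ[𝓝 x] fun x => x ^ (m + 2) := by
      filter_upwards [lt_mem_nhds hx] with y hy
      rw [max_eq_left hy.le]
    rw [max_eq_left hx.le]
    have := (hasDerivAt_pow (m + 2) x).congr_of_eventuallyEq h1
    simpa using this

theorem contDiff_max_zero_pow (m : ℕ) : ContDiff ℝ 1 fun x : ℝ => max x 0 ^ (m + 2) := by
  rw [contDiff_one_iff_deriv]
  refine ⟨fun x => (hasDerivAt_max_zero_pow m x).differentiableAt, ?_⟩
  rw [funext fun x => (hasDerivAt_max_zero_pow m x).deriv]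
  fun_prop

theorem dz_comp {n : ℕ} {f : Cn n → ℝ} {h : ℝ → ℝ} {h' : ℝ} {z : Cn n}
    (hh : HasDerivAt h h' (f z)) (hf : DifferentiableAt ℝ f z) (i : Fin n) :
    dz (fun z => h (f z)) z i = h' * dz f z i := by
  have h1 : HasFDerivAt (fun z => h (f z)) _ z := hh.comp_hasFDerivAt z hf.hasFDerivAt
  unfold dz
  rw [h1.fderiv]
  simp only [smul_apply, smul_eq_mul]
  push_cast
  ring

theorem coform_add_smul_left {n : ℕ} (G : Matrix (Fin n) (Fin n) ℂ) (s t : ℝ)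
    (a b c : Fin n → ℂ) :
    coform G (fun i => s * a i + t * b i) c = s * coform G a c + t * coform G b c := by
  unfold coform
  rw [← Complex.re_ofReal_mul, ← Complex.re_ofReal_mul, ← Complex.add_re]
  congr 1
  simp only [Finset.mul_sum, ← Finset.sum_add_distrib]
  refine Finset.sum_congr rfl fun i _ => Finset.sum_congr rfl fun j _ => ?_
  ring

/-- The energy inequality in holomorphic coordinates on a time slice. -/
theorem slice_energy_holomorphic {n : ℕ} {V A : Set (Cn n)} (hV : IsOpen V) (hA : IsCompact A)
    (hAV : A ⊆ V) {G : Cn n → Matrix (Fin n) (Fin n) ℂ}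
    (hcont : ∀ i j, ContinuousOn (fun z => G z i j) V) (hG : KahlerClosedOn V G)
    (hherm : ∀ z ∈ V, (G z).IsHermitian)
    (hdet : ∀ z ∈ V, (((G z).det.re : ℝ) : ℂ) = (G z).det ∧ 0 < (G z).det.re)
    (hpos : ∀ z ∈ V, ∀ a, 0 ≤ coform (G z) a a)
    {W φ wt : Cn n → ℝ} (hW : ContDiffOn ℝ 2 W V) (hφ : ContDiffOn ℝ 1 φ V)
    (hwt : ContinuousOn wt V) (hsub : ∀ z ∈ V, wt z ≤ laplacian (G z) W z) (l : ℝ)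
    (h0 : ∀ z ∈ V \ A, φ =ᶠ[𝓝 z] (fun _ => 0) ∨ W z ≤ l) :
    IntegrableOn (fun z => φ z ^ 2 * max (W z - l) 0 ^ 2 * wt z * (G z).det.re) V ∧
    IntegrableOn (fun z => -4 * (φ z ^ 2 * max (W z - l) 0 * coform (G z) (dz W z) (dz W z))
        + 4 * (max (W z - l) 0 ^ 3 * coform (G z) (dz φ z) (dz φ z))) V ∧
    ∫ z in V, φ z ^ 2 * max (W z - l) 0 ^ 2 * wt z * (G z).det.re
      ≤ ∫ z in V, (-4 * (φ z ^ 2 * max (W z - l) 0 * coform (G z) (dz W z) (dz W z))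
        + 4 * (max (W z - l) 0 ^ 3 * coform (G z) (dz φ z) (dz φ z))) := by
  -- The test function $\varphi^2f^2$ with $f=(W-l)_+$. Paired with a time derivative it produces
  -- that of $f^3/3$, which is why all masses below are cubic.
  set η : Cn n → ℝ := V.indicator fun z => φ z ^ 2 * max (W z - l) 0 ^ 2 with hη
  have hηV : ∀ z ∈ V, η z = φ z ^ 2 * max (W z - l) 0 ^ 2 := fun z hz => indicator_of_mem hz _
  have hη0 : ∀ z ∉ A, η z = 0 := by
    intro z hz
    by_cases hzV : z ∈ V
    · rw [hηV z hzV]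
      rcases h0 z ⟨hzV, hz⟩ with h | h
      · rw [h.self_of_nhds]; simp
      · rw [max_eq_right (by linarith)]; simp
    · exact indicator_of_notMem hzV _
  have hts : tsupport η ⊆ A := closure_minimal (fun z hz => by
    by_contra h
    exact hz (hη0 z h)) hA.isClosed
  have hηc : HasCompactSupport η := HasCompactSupport.intro hA hη0
  have hWa : ∀ z ∈ V, ContDiffAt ℝ 2 W z := fun z hz => hW.contDiffAt (hV.mem_nhds hz)
  have hφa : ∀ z ∈ V, ContDiffAt ℝ 1 φ z := fun z hz => hφ.contDiffAt (hV.mem_nhds hz)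
  have hηe : ∀ z ∈ V, η =ᶠ[𝓝 z] fun z => φ z ^ 2 * max (W z - l) 0 ^ 2 := fun z hz => by
    filter_upwards [hV.mem_nhds hz] with y hy using hηV y hy
  have hη1 : ContDiff ℝ 1 η := by
    refine contDiff_of_contDiffAt_tsupport fun z hz => ?_
    have hzV := hAV (hts hz)
    refine ContDiffAt.congr_of_eventuallyEq ?_ (hηe z hzV)
    refine ((hφa z hzV).pow 2).mul ?_
    exact ContDiffAt.comp z (contDiff_max_zero_pow 0).contDiffAt
      (((hWa z hzV).of_le (by norm_num)).sub contDiffAt_const)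
  have hdz : ∀ z ∈ V, dz η z = fun i =>
      ((2 * φ z * max (W z - l) 0 ^ 2 : ℝ) : ℂ) * dz φ z i
        + ((2 * φ z ^ 2 * max (W z - l) 0 : ℝ) : ℂ) * dz W z i := by
    intro z hz
    funext i
    have e1 : dz η z i = dz (fun z => φ z ^ 2 * max (W z - l) 0 ^ 2) z i := by
      unfold dz
      rw [(hηe z hz).fderiv_eq]
    have d1 := (hφa z hz).differentiableAt one_ne_zero
    have d2 := (hWa z hz).differentiableAt two_ne_zero
    have d3 : HasDerivAt (fun x : ℝ => max (x - l) 0 ^ 2) (2 * max (W z - l) 0) (W z) := by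
      have := (hasDerivAt_max_zero_pow 0 (W z - l)).comp_sub_const (W z) l
      simpa using this
    have d4 : HasDerivAt (fun x : ℝ => x ^ 2) (2 * φ z) (φ z) := by
      simpa using hasDerivAt_pow 2 (φ z)
    have d5 : DifferentiableAt ℝ (fun z => max (W z - l) 0 ^ 2) z :=
      d3.differentiableAt.comp z d2
    have d6 : DifferentiableAt ℝ (fun z => φ z ^ 2) z := d4.differentiableAt.comp z d1
    rw [e1, dz_mul d6 d5, dz_comp d3 d2, dz_comp d4 d1]
    push_cast
    ring
  obtain ⟨i1, e1⟩ := integral_mul_laplacian hV hcont hG (fun z hz => ⟨(hdet z hz).1, by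
    rw [← (hdet z hz).1]; exact_mod_cast (hdet z hz).2.ne'⟩) hW hη1 hηc (hts.trans hAV)
  have hfc : ContinuousOn (fun z => max (W z - l) 0) V := by
    have := hW.continuousOn
    fun_prop
  have hWd : ∀ j, ContinuousOn (fun z => dz W z j) V := fun j =>
    continuousOn_dz hV (hW.of_le (by norm_num)) j
  have hφd : ∀ j, ContinuousOn (fun z => dz φ z j) V := fun j => continuousOn_dz hV hφ j
  have hdc : ContinuousOn (fun z => (G z).det.re) V :=
    Complex.continuous_re.comp_continuousOn (continuousOn_det hcont)
  have j1 : IntegrableOn (fun z => φ z ^ 2 * max (W z - l) 0 ^ 2 * wt z * (G z).det.re) V := by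
    refine integrableOn_of_continuousOn_of_eq_zero hA hAV hV.measurableSet
      (((((hφ.continuousOn.pow 2).mul (hfc.pow 2)).mul hwt).mul hdc).mono hAV) fun z hz => ?_
    have := hη0 z hz.2
    rw [hηV z hz.1] at this
    rw [this]; simp
  have j2 : IntegrableOn (fun z => -4 * (φ z ^ 2 * max (W z - l) 0 *
      coform (G z) (dz W z) (dz W z))
        + 4 * (max (W z - l) 0 ^ 3 * coform (G z) (dz φ z) (dz φ z))) V := by
    refine integrableOn_of_continuousOn_of_eq_zero hA hAV hV.measurableSet
      (ContinuousOn.mono ?_ hAV) fun z hz => ?_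
    · exact (continuousOn_const.mul (((hφ.continuousOn.pow 2).mul hfc).mul
        (continuousOn_coform hcont hWd hWd))).add
        (continuousOn_const.mul ((hfc.pow 3).mul (continuousOn_coform hcont hφd hφd)))
    · rcases h0 z hz with h | h
      · have : dz φ z = fun _ => 0 := by
          funext i
          unfold dz
          rw [h.fderiv_eq]; simp
        rw [this, h.self_of_nhds]
        simp [coform]
      · rw [max_eq_right (by linarith)]; simp
  refine ⟨j1, j2, ?_⟩
  calc ∫ z in V, φ z ^ 2 * max (W z - l) 0 ^ 2 * wt z * (G z).det.re
      ≤ ∫ z in V, η z * laplacian (G z) W z * (G z).det.re := by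
        refine setIntegral_mono_on j1 i1.integrableOn hV.measurableSet fun z hz => ?_
        rw [hηV z hz]
        refine mul_le_mul_of_nonneg_right ?_ (hdet z hz).2.le
        exact mul_le_mul_of_nonneg_left (hsub z hz) (by positivity)
    _ = ∫ z, η z * laplacian (G z) W z * (G z).det.re := by
        refine setIntegral_eq_integral_of_forall_compl_eq_zero fun z hz => ?_
        rw [hη0 z fun h => hz (hAV h)]; simp
    _ = -4 * ∫ z in V, coform (G z) (dz η z) (dz W z) := by
        rw [e1, setIntegral_eq_integral_of_forall_compl_eq_zero]
        intro z hz
        simp [coform, dz_eq_zero_of_notMem_tsupport fun h => hz (hAV (hts h))]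
    _ = ∫ z in V, -4 * coform (G z) (dz η z) (dz W z) := by rw [integral_const_mul]
    _ ≤ _ := by
        refine setIntegral_mono_on ?_ j2 hV.measurableSet fun z hz => ?_
        · refine IntegrableOn.integrable ?_
          refine integrableOn_of_continuousOn_of_eq_zero hA hAV hV.measurableSet
            (ContinuousOn.mono ?_ hAV) fun z hz => ?_
          · exact continuousOn_const.mul (continuousOn_coform hcont
              (fun i => (continuous_dz hη1 i).continuousOn) hWd)
          · simp [coform, dz_eq_zero_of_notMem_tsupport fun h => hz.2 (hts h)]
        · rw [hdz z hz, coform_add_smul_left]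
          set f := max (W z - l) 0 with hf
          have hf0 : 0 ≤ f := le_max_right _ _
          -- Nonnegativity of the cometric at $f\,d\varphi+\varphi\,dW$, multiplied by `f`, bounds
          -- the cross term of $\langle d\eta,dW\rangle$. It consumes half of the gradient term and
          -- leaves the factor $4$ on both terms.
          have h1 := hpos z hz fun i => (f : ℂ) * dz φ z i + (φ z : ℂ) * dz W z i
          rw [coform_eq_sesq, sesq_add_smul _ (isHermitian_adjugate_transpose (hherm z hz)),
            ← coform_eq_sesq, ← coform_eq_sesq, ← coform_eq_sesq] at h1
          have h2 := mul_nonneg hf0 h1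
          nlinarith [h2]

end ConicHeat

/-! ### Faber-Krahn inequality and subsolutions in energy form. -/

namespace ConicHeat
open scoped Topology ENNReal NNReal
open Filter

theorem finrank_real_Cn (n : ℕ) : Module.finrank ℝ (Cn n) = 2 * n := by
  rw [finrank_real_of_complex, finrank_euclideanSpace_fin]

/-- A Faber-Krahn inequality. -/
theorem exists_faberKrahn {n : ℕ} (hn : 1 ≤ n) :
    ∃ C : ℝ, 0 < C ∧ ∀ (g : Cn n → ℝ) (ω : ℝ), ContDiff ℝ 1 g → HasCompactSupport g → 0 ≤ ω →
      volume (Function.support g) ≤ ENNReal.ofReal ω →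
      ∫ x, |g x| ≤ C * ω ^ ((1 : ℝ) / (2 * n)) * ∫ x, ‖fderiv ℝ g x‖ := by
  have hn' : (1 : ℝ) ≤ n := by exact_mod_cast hn
  set d : ℝ := 2 * n with hd
  have hd1 : 1 < d := by linarith
  -- The Sobolev exponent of $W^{1,1}$ in real dimension $d=2n$. Hölder's inequality against the
  -- indicator of the support converts the $L^p$ bound into an $L^1$ bound with the factor
  -- $|\mathrm{supp}|^{1/d}$.
  set p : ℝ := d / (d - 1) with hp
  have hconj : Real.HolderConjugate (Module.finrank ℝ (Cn n) : ℝ) p := by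
    rw [finrank_real_Cn]
    push_cast
    exact Real.HolderConjugate.conjExponent hd1
  have hconj' : p.HolderConjugate d := by
    have := hconj.symm
    rw [finrank_real_Cn] at this
    push_cast at this
    exact this
  set c := lintegralPowLePowLIntegralFDerivConst (volume : Measure (Cn n)) p with hc
  have hp0 : 0 < p := hconj'.pos
  refine ⟨(c : ℝ) ^ (1 / p) + 1, by positivity, fun g ω hg hgc hω hvol => ?_⟩
  have hfd := hg.continuous_fderiv one_ne_zero
  have i1 : Integrable g := hg.continuous.integrable_of_hasCompactSupport hgc
  have i2 : Integrable (fderiv ℝ g) := hfd.integrable_of_hasCompactSupport (hgc.fderiv ℝ)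
  have gns := lintegral_pow_le_pow_lintegral_fderiv (volume : Measure (Cn n)) hg hgc hconj
  set S := Function.support g with hS
  have hSm : MeasurableSet S := (hg.continuous.isOpen_support).measurableSet
  have h1 : ∫⁻ x, ‖g x‖ₑ = ∫⁻ x, ‖g x‖ₑ * S.indicator 1 x := by
    refine lintegral_congr fun x => ?_
    by_cases hx : x ∈ S
    · simp [hx]
    · rw [Function.notMem_support.1 hx]; simp
  have h2 := ENNReal.lintegral_mul_le_Lp_mul_Lq (volume : Measure (Cn n)) hconj'
    (f := fun x => ‖g x‖ₑ) (g := S.indicator 1) hg.continuous.enorm.aemeasurable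
    (measurable_one.indicator hSm).aemeasurable
  have h3 : ∫⁻ x, (S.indicator (1 : Cn n → ℝ≥0∞) x) ^ d = volume S := by
    rw [← lintegral_indicator_one hSm]
    refine lintegral_congr fun x => ?_
    by_cases hx : x ∈ S
    · simp [hx]
    · simp [hx, ENNReal.zero_rpow_of_pos (by linarith : 0 < d)]
  have h4 : ∫⁻ x, ‖g x‖ₑ ≤ (c : ℝ≥0∞) ^ (1 / p) * (∫⁻ x, ‖fderiv ℝ g x‖ₑ)
      * ENNReal.ofReal ω ^ (1 / d) := by
    rw [h1]
    refine h2.trans ?_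
    rw [h3]
    have hd0 : 0 ≤ 1 / d := by positivity
    refine mul_le_mul' ?_ (ENNReal.rpow_le_rpow hvol hd0)
    refine (ENNReal.rpow_le_rpow gns (by positivity)).trans_eq ?_
    rw [ENNReal.mul_rpow_of_nonneg _ _ (by positivity), ← ENNReal.rpow_mul, mul_one_div_cancel
      hp0.ne', ENNReal.rpow_one]
  have h5 : ∫ x, |g x| = (∫⁻ x, ‖g x‖ₑ).toReal := integral_norm_eq_lintegral_enorm
    i1.aestronglyMeasurable
  have h6 : ∫ x, ‖fderiv ℝ g x‖ = (∫⁻ x, ‖fderiv ℝ g x‖ₑ).toReal :=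
    integral_norm_eq_lintegral_enorm i2.aestronglyMeasurable
  have hfin : ∫⁻ x, ‖fderiv ℝ g x‖ₑ ≠ ∞ := i2.2.ne
  have h7 := ENNReal.toReal_mono ?_ h4
  · rw [← h5, ENNReal.toReal_mul, ENNReal.toReal_mul, ← h6, ← ENNReal.toReal_rpow,
      ← ENNReal.toReal_rpow, ENNReal.toReal_ofReal hω, ENNReal.coe_toReal] at h7
    refine h7.trans ?_
    have a1 : 0 ≤ ∫ x, ‖fderiv ℝ g x‖ := integral_nonneg fun _ => norm_nonneg _
    have a2 : 0 ≤ ω ^ (1 / d) := Real.rpow_nonneg hω _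
    have := mul_nonneg a1 a2
    nlinarith
  · refine ENNReal.mul_ne_top (ENNReal.mul_ne_top ?_ hfin) ?_
    · exact ENNReal.rpow_ne_top_of_nonneg (by positivity) ENNReal.coe_ne_top
    · exact ENNReal.rpow_ne_top_of_nonneg (by positivity) ENNReal.ofReal_ne_top

/-- A family of functions on `(V ∪ O) × I`, nonpositive on `O` and of class `C¹` on `V`, which
satisfies the energy inequality of a subsolution of a uniformly parabolic equation in divergence
form, with volume density `γ`. -/
structure EnergySubsolution {n : ℕ} (Λ K : ℝ) (V O : Set (Cn n)) (I : Set ℝ)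
    (w wt γ : Cn n × ℝ → ℝ) : Prop where
  isOpen_V : IsOpen V
  isOpen_O : IsOpen O
  nonpos : ∀ x ∈ V ∩ O, ∀ t ∈ I, w (x, t) ≤ 0
  cont : ContinuousOn w (V ×ˢ I)
  cont_t : ContinuousOn wt (V ×ˢ I)
  deriv_t : ∀ x ∈ V, ∀ t ∈ I, HasDerivWithinAt (fun τ => w (x, τ)) (wt (x, t)) I t
  contDiff : ∀ t ∈ I, ContDiffOn ℝ 1 (fun x => w (x, t)) V
  meas : AEStronglyMeasurable γ (volume.restrict (V ×ˢ I))
  bounds : ∀ x ∈ V, ∀ t ∈ I, Λ⁻¹ ≤ γ (x, t) ∧ γ (x, t) ≤ Λ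
  deriv_vol : ∀ x ∈ V, ∀ t ∈ I, ∃ γ' : ℝ,
    HasDerivWithinAt (fun τ => γ (x, τ)) γ' I t ∧ γ' ≤ K * γ (x, t)
  energy : ∀ t ∈ I, ∀ l : ℝ, 0 ≤ l → ∀ φ : Cn n → ℝ, ContDiff ℝ 1 φ → HasCompactSupport φ →
    tsupport φ ⊆ V ∪ O →
    ∫ x in V, φ x ^ 2 * max (w (x, t) - l) 0 ^ 2 * wt (x, t) * γ (x, t)
      ≤ ∫ x in V, (-Λ⁻¹ * (φ x ^ 2 * max (w (x, t) - l) 0 * ‖fderiv ℝ (fun y => w (y, t)) x‖ ^ 2)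
        + Λ * (max (w (x, t) - l) 0 ^ 3 * ‖fderiv ℝ φ x‖ ^ 2))

section Slice

variable {n : ℕ} {V O : Set (Cn n)} {v φ : Cn n → ℝ} {l : ℝ}

/-- The set `tsupport φ \ O` is a compact subset of `V`, and outside it either the cutoff or the
truncation vanishes. Hence a cutoff may cross the divisor while the truncated functions stay
compactly supported away from it. -/
theorem truncation_eq_zero (hO : ∀ x ∈ V ∩ O, v x ≤ 0) (hl : 0 ≤ l) {x : Cn n}
    (hx : x ∈ V \ (tsupport φ \ O)) : x ∉ tsupport φ ∨ max (v x - l) 0 = 0 := by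
  by_cases h : x ∈ tsupport φ
  · right
    have hxO : x ∈ O := by
      by_contra h'
      exact hx.2 ⟨h, h'⟩
    exact max_eq_right (by linarith [hO x ⟨hx.1, hxO⟩])
  · exact Or.inl h

theorem isCompact_tsupport_diff (hOo : IsOpen O) (hφc : HasCompactSupport φ) :
    IsCompact (tsupport φ \ O) := IsCompact.diff hφc hOo

theorem tsupport_diff_subset (hφs : tsupport φ ⊆ V ∪ O) : tsupport φ \ O ⊆ V := fun _ hx =>
  (hφs hx.1).resolve_right hx.2

theorem integrableOn_sq_mul_cube (hV : IsOpen V) (hOo : IsOpen O)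
    (hO : ∀ x ∈ V ∩ O, v x ≤ 0) (hv : ContDiffOn ℝ 1 v V) (hl : 0 ≤ l)
    (hφ : ContDiff ℝ 1 φ) (hφc : HasCompactSupport φ) (hφs : tsupport φ ⊆ V ∪ O) :
    IntegrableOn (fun x => φ x ^ 2 * max (v x - l) 0 ^ 3) V := by
  refine integrableOn_of_continuousOn_of_eq_zero (isCompact_tsupport_diff hOo hφc)
    (tsupport_diff_subset hφs) hV.measurableSet ?_ fun x hx => ?_
  · have := hv.continuousOn.mono (tsupport_diff_subset hφs)
    have := hφ.continuous
    fun_prop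
  · rcases truncation_eq_zero hO hl hx with h | h
    · simp [image_eq_zero_of_notMem_tsupport h]
    · simp [h]

theorem integrableOn_cube_mul_fderiv (hV : IsOpen V) (hOo : IsOpen O)
    (hO : ∀ x ∈ V ∩ O, v x ≤ 0) (hv : ContDiffOn ℝ 1 v V) (hl : 0 ≤ l)
    (hφ : ContDiff ℝ 1 φ) (hφc : HasCompactSupport φ) (hφs : tsupport φ ⊆ V ∪ O) :
    IntegrableOn (fun x => max (v x - l) 0 ^ 3 * ‖fderiv ℝ φ x‖ ^ 2) V := by
  refine integrableOn_of_continuousOn_of_eq_zero (isCompact_tsupport_diff hOo hφc)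
    (tsupport_diff_subset hφs) hV.measurableSet ?_ fun x hx => ?_
  · have := hv.continuousOn.mono (tsupport_diff_subset hφs)
    have := hφ.continuous_fderiv one_ne_zero
    fun_prop
  · rcases truncation_eq_zero hO hl hx with h | h
    · have : fderiv ℝ φ x = 0 := by
        by_contra hne
        exact h (support_fderiv_subset ℝ hne)
      simp [this]
    · simp [h]

theorem integrableOn_sq_mul_fderiv (hV : IsOpen V) (hOo : IsOpen O)
    (hO : ∀ x ∈ V ∩ O, v x ≤ 0) (hv : ContDiffOn ℝ 1 v V) (hl : 0 ≤ l)
    (hφ : ContDiff ℝ 1 φ) (hφc : HasCompactSupport φ) (hφs : tsupport φ ⊆ V ∪ O) :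
    IntegrableOn (fun x => φ x ^ 2 * max (v x - l) 0 * ‖fderiv ℝ v x‖ ^ 2) V := by
  refine integrableOn_of_continuousOn_of_eq_zero (isCompact_tsupport_diff hOo hφc)
    (tsupport_diff_subset hφs) hV.measurableSet ?_ fun x hx => ?_
  · have := hv.continuousOn.mono (tsupport_diff_subset hφs)
    have := (hv.continuousOn_fderiv_of_isOpen hV le_rfl).mono (tsupport_diff_subset hφs)
    have := hφ.continuous
    fun_prop
  · rcases truncation_eq_zero hO hl hx with h | h
    · simp [image_eq_zero_of_notMem_tsupport h]
    · simp [h]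

/-- The Faber-Krahn inequality for truncations `φ² (v - l)₊³`. -/
theorem exists_faberKrahn_truncation (hn : 1 ≤ n) :
    ∃ C : ℝ, 0 < C ∧ ∀ (V O : Set (Cn n)) (v φ : Cn n → ℝ) (l ω : ℝ), IsOpen V → IsOpen O →
      (∀ x ∈ V ∩ O, v x ≤ 0) → ContDiffOn ℝ 1 v V → 0 ≤ l →
      ContDiff ℝ 1 φ → HasCompactSupport φ → tsupport φ ⊆ V ∪ O → 0 < ω →
      volume {x ∈ V | φ x ≠ 0 ∧ l < v x} ≤ ENNReal.ofReal ω →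
      ∫ x in V, φ x ^ 2 * max (v x - l) 0 ^ 3 ≤ C * ω ^ ((1 : ℝ) / n) *
        ((∫ x in V, φ x ^ 2 * max (v x - l) 0 * ‖fderiv ℝ v x‖ ^ 2)
          + ∫ x in V, max (v x - l) 0 ^ 3 * ‖fderiv ℝ φ x‖ ^ 2) := by
  obtain ⟨C, hC, hFK⟩ := exists_faberKrahn hn
  have hn' : (1 : ℝ) ≤ n := by exact_mod_cast hn
  refine ⟨15 * C ^ 2, by positivity, fun V O v φ l ω hV hOo hO hv hl hφ hφc hφs hω hvol => ?_⟩
  have i1 := integrableOn_sq_mul_cube hV hOo hO hv hl hφ hφc hφs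
  have i2 := integrableOn_sq_mul_fderiv hV hOo hO hv hl hφ hφc hφs
  have i3 := integrableOn_cube_mul_fderiv hV hOo hO hv hl hφ hφc hφs
  set g : Cn n → ℝ := V.indicator fun x => φ x ^ 2 * max (v x - l) 0 ^ 3 with hg
  have hgV : ∀ x ∈ V, g x = φ x ^ 2 * max (v x - l) 0 ^ 3 := fun x hx => indicator_of_mem hx _
  have hgV' : ∀ x ∉ V, g x = 0 := fun x hx => indicator_of_notMem hx _
  have hge : ∀ x ∈ V, g =ᶠ[𝓝 x] fun x => φ x ^ 2 * max (v x - l) 0 ^ 3 := fun x hx => by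
    filter_upwards [hV.mem_nhds hx] with y hy using hgV y hy
  have hg0 : ∀ x ∉ tsupport φ \ O, g x = 0 := by
    intro x hx
    by_cases hxV : x ∈ V
    · rw [hgV x hxV]
      rcases truncation_eq_zero hO hl ⟨hxV, hx⟩ with h | h
      · simp [image_eq_zero_of_notMem_tsupport h]
      · simp [h]
    · exact hgV' x hxV
  have hS := isCompact_tsupport_diff hOo hφc
  have hSV := tsupport_diff_subset hφs
  have hts : tsupport g ⊆ tsupport φ \ O := closure_minimal (fun z hz => by
    by_contra h
    exact hz (hg0 z h)) hS.isClosed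
  have hgc : HasCompactSupport g := HasCompactSupport.intro hS hg0
  have hd : ∀ x ∈ V, HasFDerivAt g ((φ x ^ 2) • ((3 * max (v x - l) 0 ^ 2) • fderiv ℝ v x)
      + (max (v x - l) 0 ^ 3) • ((2 * φ x) • fderiv ℝ φ x)) x := by
    intro x hx
    have d1 := (hφ.differentiable one_ne_zero x).hasFDerivAt
    have d2 := ((hv.contDiffAt (hV.mem_nhds hx)).differentiableAt one_ne_zero).hasFDerivAt
    have d3 : HasDerivAt (fun y : ℝ => max (y - l) 0 ^ 3) (3 * max (v x - l) 0 ^ 2) (v x) := by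
      have := (hasDerivAt_max_zero_pow 1 (v x - l)).comp_sub_const (v x) l
      norm_num at this
      exact this
    have d4 : HasDerivAt (fun x : ℝ => x ^ 2) (2 * φ x) (φ x) := by
      simpa using hasDerivAt_pow 2 (φ x)
    have := (d4.comp_hasFDerivAt x d1).mul (d3.comp_hasFDerivAt x d2)
    exact this.congr_of_eventuallyEq (hge x hx)
  have hg1 : ContDiff ℝ 1 g := by
    refine contDiff_of_contDiffAt_tsupport fun x hx => ?_
    have hxV := hSV (hts hx)
    refine ContDiffAt.congr_of_eventuallyEq ?_ (hge x hxV)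
    refine (hφ.contDiffAt.pow 2).mul ?_
    exact ContDiffAt.comp x (contDiff_max_zero_pow 1).contDiffAt
      ((hv.contDiffAt (hV.mem_nhds hxV)).sub contDiffAt_const)
  have hsupp : Function.support g ⊆ {x ∈ V | φ x ≠ 0 ∧ l < v x} := by
    intro x hx
    have hxV : x ∈ V := by
      by_contra h
      exact hx (hgV' x h)
    refine ⟨hxV, fun h => hx ?_, ?_⟩
    · rw [hgV x hxV, h]; simp
    · by_contra h
      refine hx ?_
      rw [hgV x hxV, max_eq_right (by linarith)]; simp
  have hfk := hFK g ω hg1 hgc hω.le ((measure_mono hsupp).trans hvol)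
  have e1 : ∫ x, |g x| = ∫ x in V, φ x ^ 2 * max (v x - l) 0 ^ 3 := by
    rw [← integral_indicator hV.measurableSet]
    refine integral_congr_ae (Eventually.of_forall fun x => ?_)
    change |g x| = g x
    refine abs_of_nonneg ?_
    by_cases hx : x ∈ V
    · rw [hgV x hx]; positivity
    · rw [hgV' x hx]
  have e2 : ∫ x, ‖fderiv ℝ g x‖ = ∫ x in V, ‖fderiv ℝ g x‖ := by
    rw [setIntegral_eq_integral_of_forall_compl_eq_zero]
    intro x hx
    have : fderiv ℝ g x = 0 := by
      by_contra hne
      exact hx (hSV (hts (support_fderiv_subset ℝ hne)))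
    simp [this]
  set θ := ω ^ ((1 : ℝ) / (2 * n)) with hθ
  have hθ0 : 0 < θ := Real.rpow_pos_of_pos hω _
  have hθ2 : θ ^ 2 = ω ^ ((1 : ℝ) / n) := by
    rw [hθ, ← Real.rpow_natCast, ← Real.rpow_mul hω.le]
    congr 1
    have : (n : ℝ) ≠ 0 := by linarith
    field_simp
    norm_num
  set c := C * θ with hc
  have hc0 : 0 < c := by positivity
  set A := ∫ x in V, φ x ^ 2 * max (v x - l) 0 ^ 3 with hA
  set B := ∫ x in V, φ x ^ 2 * max (v x - l) 0 * ‖fderiv ℝ v x‖ ^ 2 with hB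
  set D := ∫ x in V, max (v x - l) 0 ^ 3 * ‖fderiv ℝ φ x‖ ^ 2 with hD
  have hB0 : 0 ≤ B := setIntegral_nonneg hV.measurableSet fun x _ => by positivity
  have hD0 : 0 ≤ D := setIntegral_nonneg hV.measurableSet fun x _ => by positivity
  -- Young's inequality for $\nabla(\varphi^2f^3)$, written as completed squares. The parameters
  -- make the coefficient of $\varphi^2f^3$ exactly $1/(2c)$: multiplied by the constant `c` of the
  -- Faber-Krahn inequality it is half the left side, and is absorbed. The factors $15c/2$ then
  -- become the final $15C^2$.
  have hpt : ∫ x in V, ‖fderiv ℝ g x‖ ≤ ∫ x in V, ((1 / (2 * c)) *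
      (φ x ^ 2 * max (v x - l) 0 ^ 3) + ((15 * c / 2) *
        (φ x ^ 2 * max (v x - l) 0 * ‖fderiv ℝ v x‖ ^ 2)
      + (15 * c / 2) * (max (v x - l) 0 ^ 3 * ‖fderiv ℝ φ x‖ ^ 2))) := by
    refine setIntegral_mono_on ?_ ((i1.const_mul _).add ((i2.const_mul _).add (i3.const_mul _)))
      hV.measurableSet fun x hx => ?_
    · exact ((hg1.continuous_fderiv one_ne_zero).integrable_of_hasCompactSupport
        (hgc.fderiv ℝ)).norm.integrableOn
    · rw [(hd x hx).fderiv]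
      refine (norm_add_le _ _).trans ?_
      simp only [norm_smul, Real.norm_eq_abs]
      set f := max (v x - l) 0 with hf
      have hf0 : 0 ≤ f := le_max_right _ _
      set X := ‖fderiv ℝ v x‖
      set Z := ‖fderiv ℝ φ x‖
      have a1 : |φ x ^ 2| * (|3 * f ^ 2| * X) = 3 * |φ x| ^ 2 * f ^ 2 * X := by
        rw [abs_of_nonneg (by positivity : (0 : ℝ) ≤ 3 * f ^ 2), abs_pow]; ring
      have a2 : |f ^ 3| * (|2 * φ x| * Z) = 2 * |φ x| * f ^ 3 * Z := by
        rw [abs_of_nonneg (by positivity : (0 : ℝ) ≤ f ^ 3), abs_mul, abs_two]; ring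
      rw [a1, a2, ← sq_abs (φ x)]
      set P := |φ x|
      have s1 : 0 ≤ f * (P * f - 5 * c * (P * X)) ^ 2 := by positivity
      have s2 : 0 ≤ f ^ 3 * (P - 5 * c * Z) ^ 2 := by positivity
      have s3 : 0 ≤ f ^ 3 * Z ^ 2 := by positivity
      have t1 : 3 * P ^ 2 * f ^ 2 * X + 2 * P * f ^ 3 * Z + (3 / (10 * c)) *
          (f * (P * f - 5 * c * (P * X)) ^ 2) + (1 / (5 * c)) * (f ^ 3 * (P - 5 * c * Z) ^ 2)
          + (5 * c / 2) * (f ^ 3 * Z ^ 2)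
          = 1 / (2 * c) * (P ^ 2 * f ^ 3) + (15 * c / 2 * (P ^ 2 * f * X ^ 2)
            + 15 * c / 2 * (f ^ 3 * Z ^ 2)) := by
        field_simp
        ring
      have u1 : 0 ≤ (3 / (10 * c)) * (f * (P * f - 5 * c * (P * X)) ^ 2) := by positivity
      have u2 : 0 ≤ (1 / (5 * c)) * (f ^ 3 * (P - 5 * c * Z) ^ 2) := by positivity
      have u3 : 0 ≤ (5 * c / 2) * (f ^ 3 * Z ^ 2) := by positivity
      linarith
  have i23 : IntegrableOn (fun x => (15 * c / 2) *
      (φ x ^ 2 * max (v x - l) 0 * ‖fderiv ℝ v x‖ ^ 2)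
      + (15 * c / 2) * (max (v x - l) 0 ^ 3 * ‖fderiv ℝ φ x‖ ^ 2)) V :=
    (i2.const_mul _).add (i3.const_mul _)
  rw [integral_add (i1.const_mul _) i23, integral_const_mul] at hpt
  have hpt2 : ∫ x in V, ((15 * c / 2) * (φ x ^ 2 * max (v x - l) 0 * ‖fderiv ℝ v x‖ ^ 2)
      + (15 * c / 2) * (max (v x - l) 0 ^ 3 * ‖fderiv ℝ φ x‖ ^ 2))
      = (15 * c / 2) * B + (15 * c / 2) * D := by
    rw [integral_add (i2.const_mul _) (i3.const_mul _), integral_const_mul, integral_const_mul]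
  rw [hpt2] at hpt
  rw [e1, e2] at hfk
  have := mul_le_mul_of_nonneg_left hpt hc0.le
  have e3 : c * (1 / (2 * c) * A + (15 * c / 2 * B + 15 * c / 2 * D))
      = A / 2 + c ^ 2 * (15 / 2) * (B + D) := by
    field_simp
  rw [e3] at this
  have e4 : 15 * C ^ 2 * ω ^ ((1 : ℝ) / n) * (B + D) = 15 * c ^ 2 * (B + D) := by
    rw [← hθ2, hc]; ring
  rw [e4]
  linarith

end Slice


/-! ### Energy growth in time and the Caccioppoli inequality. -/

namespace EnergySubsolution

variable {n : ℕ} {Λ K : ℝ} {V O : Set (Cn n)} {I : Set ℝ} {w wt γ : Cn n × ℝ → ℝ}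

theorem integrableOn_prod (H : EnergySubsolution Λ K V O I w wt γ) {S : Set (Cn n)}
    (hS : IsCompact S) (hSV : S ⊆ V) {t₁ t₂ : ℝ} (hI : Icc t₁ t₂ ⊆ I) {F : Cn n × ℝ → ℝ}
    (hF : ContinuousOn F (V ×ˢ I)) (h0 : ∀ x ∈ V \ S, ∀ t ∈ I, F (x, t) = 0) :
    IntegrableOn F (V ×ˢ Ioc t₁ t₂) := by
  have h1 : IntegrableOn F (V ×ˢ Icc t₁ t₂) := by
    refine integrableOn_of_continuousOn_of_eq_zero (hS.prod isCompact_Icc)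
      (prod_mono_left hSV) (H.isOpen_V.measurableSet.prod measurableSet_Icc)
      (hF.mono (prod_mono hSV hI)) ?_
    rintro ⟨x, t⟩ ⟨⟨hx, ht⟩, hn⟩
    exact h0 x ⟨hx, fun h => hn ⟨h, ht⟩⟩ t (hI ht)
  exact h1.mono_set (prod_mono_right Ioc_subset_Icc_self)

theorem integrableOn_prod_mul (H : EnergySubsolution Λ K V O I w wt γ) (hΛ : 0 < Λ)
    {S : Set (Cn n)} (hS : IsCompact S) (hSV : S ⊆ V) {t₁ t₂ : ℝ} (hI : Icc t₁ t₂ ⊆ I)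
    {F : Cn n × ℝ → ℝ} (hF : ContinuousOn F (V ×ˢ I))
    (h0 : ∀ x ∈ V \ S, ∀ t ∈ I, F (x, t) = 0) :
    IntegrableOn (fun p => F p * γ p) (V ×ˢ Ioc t₁ t₂) := by
  have h1 := H.integrableOn_prod hS hSV hI hF h0
  have hsub : V ×ˢ Ioc t₁ t₂ ⊆ V ×ˢ I := prod_mono_right (Ioc_subset_Icc_self.trans hI)
  have hm : MeasurableSet (V ×ˢ Ioc t₁ t₂) := H.isOpen_V.measurableSet.prod measurableSet_Ioc
  refine Integrable.mul_bdd (c := Λ) h1 (H.meas.mono_measure (Measure.restrict_mono_set _ hsub)) ?_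
  refine (ae_restrict_iff' hm).2 (Eventually.of_forall fun p hp => ?_)
  have := H.bounds p.1 hp.1 p.2 (hsub hp).2
  have h0 : 0 < Λ⁻¹ := inv_pos.2 hΛ
  rw [Real.norm_eq_abs, abs_le]
  constructor
  · have : 0 ≤ γ p := h0.le.trans this.1
    linarith
  · exact this.2

theorem continuousOn_slice {F : Cn n × ℝ → ℝ} (hF : ContinuousOn F (V ×ˢ I)) {t : ℝ}
    (ht : t ∈ I) : ContinuousOn (fun x => F (x, t)) V :=
  hF.comp (by fun_prop) fun _ hx => ⟨hx, ht⟩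

theorem continuousOn_time {F : Cn n × ℝ → ℝ} (hF : ContinuousOn F (V ×ˢ I)) {x : Cn n}
    (hx : x ∈ V) : ContinuousOn (fun t => F (x, t)) I :=
  hF.comp (by fun_prop) fun _ ht => ⟨hx, ht⟩

theorem restrict_prod_eq {U : Set (Cn n)} {t₁ t₂ : ℝ} :
    (volume.restrict (U ×ˢ Ioc t₁ t₂) : Measure (Cn n × ℝ))
      = (volume.restrict U).prod (volume.restrict (Ioc t₁ t₂)) := by
  rw [Measure.volume_eq_prod, Measure.prod_restrict]

theorem integrableOn_slice_integral {U : Set (Cn n)} {t₁ t₂ : ℝ} {F : Cn n × ℝ → ℝ}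
    (hF : IntegrableOn F (U ×ˢ Ioc t₁ t₂)) :
    IntegrableOn (fun t => ∫ x in U, F (x, t)) (Ioc t₁ t₂) := by
  unfold IntegrableOn at hF
  rw [restrict_prod_eq] at hF
  exact hF.integral_prod_right

/-- The weighted energy at time `t₂` is bounded by the time integral of its derivative. -/
theorem time_energy (H : EnergySubsolution Λ K V O I w wt γ) (hΛ : 0 < Λ) {l : ℝ}
    (hl : 0 ≤ l) {φ : Cn n → ℝ} (hφ : ContDiff ℝ 1 φ) (hφc : HasCompactSupport φ)
    (hφs : tsupport φ ⊆ V ∪ O) {t₁ t₂ : ℝ} (h12 : t₁ ≤ t₂) (hI : Icc t₁ t₂ ⊆ I) :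
    (t₂ - t₁) * Λ⁻¹ * ∫ x in V, φ x ^ 2 * max (w (x, t₂) - l) 0 ^ 3
      ≤ ∫ t in t₁..t₂, ∫ x in V, ((t - t₁) * (3 *
          (φ x ^ 2 * max (w (x, t) - l) 0 ^ 2 * wt (x, t) * γ (x, t))
          + K * (φ x ^ 2 * max (w (x, t) - l) 0 ^ 3 * γ (x, t)))
          + φ x ^ 2 * max (w (x, t) - l) 0 ^ 3 * γ (x, t)) := by
  set S := tsupport φ \ O with hSdef
  have hS := isCompact_tsupport_diff H.isOpen_O hφc
  have hSV := tsupport_diff_subset hφs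
  have hfz : ∀ x ∈ V \ S, ∀ t ∈ I, φ x = 0 ∨ max (w (x, t) - l) 0 = 0 := by
    intro x hx t ht
    rcases truncation_eq_zero (v := fun x => w (x, t)) (fun x hx => H.nonpos x hx t ht) hl hx
      with h | h
    · exact Or.inl (image_eq_zero_of_notMem_tsupport h)
    · exact Or.inr h
  -- The density `γ` is kept out of `M₀`: it is only bounded and measurable, whereas `M₀` is
  -- continuous and vanishes off a compact set, so the product is integrable.
  set M₀ : Cn n × ℝ → ℝ := fun p => (p.2 - t₁) * (3 *
    (φ p.1 ^ 2 * max (w p - l) 0 ^ 2 * wt p) + K * (φ p.1 ^ 2 * max (w p - l) 0 ^ 3))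
    + φ p.1 ^ 2 * max (w p - l) 0 ^ 3 with hM₀
  have hwc := H.cont
  have hwtc := H.cont_t
  have hφcont := hφ.continuous
  have hM₀c : ContinuousOn M₀ (V ×ˢ I) := by
    have : ContinuousOn (fun p : Cn n × ℝ => φ p.1) (V ×ˢ I) :=
      (hφcont.comp continuous_fst).continuousOn
    fun_prop
  have hM₀z : ∀ x ∈ V \ S, ∀ t ∈ I, M₀ (x, t) = 0 := by
    intro x hx t ht
    rcases hfz x hx t ht with h | h <;> simp [hM₀, h]
  have hMint := H.integrableOn_prod_mul hΛ hS hSV hI hM₀c hM₀z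
  have hmem : ∀ t ∈ Ioo t₁ t₂, I ∈ 𝓝 t := fun t ht =>
    Filter.mem_of_superset (Icc_mem_nhds ht.1 ht.2) hI
  have ht2 : t₂ ∈ I := hI ⟨h12, le_rfl⟩
  -- pointwise in space
  have hpt : ∀ x ∈ V, (t₂ - t₁) * Λ⁻¹ * (φ x ^ 2 * max (w (x, t₂) - l) 0 ^ 3)
      ≤ ∫ t in Ioc t₁ t₂, M₀ (x, t) * γ (x, t) := by
    intro x hx
    have hlow : (t₂ - t₁) * Λ⁻¹ * (φ x ^ 2 * max (w (x, t₂) - l) 0 ^ 3)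
        ≤ (t₂ - t₁) * (φ x ^ 2 * max (w (x, t₂) - l) 0 ^ 3 * γ (x, t₂)) := by
      rw [mul_assoc, mul_comm Λ⁻¹]
      refine mul_le_mul_of_nonneg_left ?_ (by linarith)
      exact mul_le_mul_of_nonneg_left (H.bounds x hx t₂ ht2).1 (by positivity)
    refine hlow.trans ?_
    have hγc : ContinuousOn (fun t => γ (x, t)) I := fun t ht => by
      obtain ⟨γ', h, -⟩ := H.deriv_vol x hx t ht
      exact h.continuousWithinAt
    have hwx := continuousOn_time hwc hx
    have hwtx := continuousOn_time hwtc hx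
    choose! γ' hγ' hγK using H.deriv_vol x hx
    have hg : ∀ t ∈ I, HasDerivWithinAt
        (fun t => (t - t₁) * (φ x ^ 2 * max (w (x, t) - l) 0 ^ 3 * γ (x, t)))
        (1 * (φ x ^ 2 * max (w (x, t) - l) 0 ^ 3 * γ (x, t)) + (t - t₁) *
          ((φ x ^ 2 * (3 * max (w (x, t) - l) 0 ^ 2 * wt (x, t))) * γ (x, t)
          + φ x ^ 2 * max (w (x, t) - l) 0 ^ 3 * γ' t)) I t := by
      intro t ht
      have d3 : HasDerivAt (fun y : ℝ => max (y - l) 0 ^ 3) (3 * max (w (x, t) - l) 0 ^ 2)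
          (w (x, t)) := by
        have := (hasDerivAt_max_zero_pow 1 (w (x, t) - l)).comp_sub_const (w (x, t)) l
        norm_num at this
        exact this
      have d4 := d3.comp_hasDerivWithinAt t (H.deriv_t x hx t ht)
      exact ((hasDerivWithinAt_id t I).sub_const t₁).mul ((d4.const_mul _).mul (hγ' t ht))
    -- The time derivative of `γ` is merely bounded above and need not be integrable, so the
    -- one-sided form of the fundamental theorem of calculus is used. The weight $t-t_1$ removes the
    -- contribution of the initial time.
    have key := intervalIntegral.sub_le_integral_of_hasDeriv_right_of_le h12
      (g := fun t => (t - t₁) * (φ x ^ 2 * max (w (x, t) - l) 0 ^ 3 * γ (x, t)))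
      (φ := fun t => M₀ (x, t) * γ (x, t))
      (fun t ht => ((hg t (hI ht)).continuousWithinAt).mono hI)
      (fun t ht => ((hg t (hI (Ioo_subset_Icc_self ht))).hasDerivAt (hmem t ht)).hasDerivWithinAt)
      ?_ ?_
    · rw [sub_self, zero_mul, sub_zero, intervalIntegral.integral_of_le h12] at key
      exact key
    · refine ContinuousOn.integrableOn_Icc ?_
      exact (((continuousOn_time hM₀c hx).mul hγc)).mono hI
    · intro t ht
      have htI := hI (Ioo_subset_Icc_self ht)
      have h1 := hγK t htI
      have h2 : 0 ≤ (t - t₁) * (φ x ^ 2 * max (w (x, t) - l) 0 ^ 3) :=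
        mul_nonneg (by linarith [ht.1]) (by positivity)
      have h3 := mul_le_mul_of_nonneg_left h1 h2
      simp only [hM₀]
      nlinarith [h3]
  have hint2 : IntegrableOn (fun x => ∫ t in Ioc t₁ t₂, M₀ (x, t) * γ (x, t)) V := by
    unfold IntegrableOn at hMint
    rw [restrict_prod_eq] at hMint
    exact hMint.integral_prod_left
  have hM₀γ : ∀ t x, (t - t₁) * (3 * (φ x ^ 2 * max (w (x, t) - l) 0 ^ 2 * wt (x, t) * γ (x, t))
          + K * (φ x ^ 2 * max (w (x, t) - l) 0 ^ 3 * γ (x, t)))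
          + φ x ^ 2 * max (w (x, t) - l) 0 ^ 3 * γ (x, t) = M₀ (x, t) * γ (x, t) := by
    intro t x
    simp only [hM₀]
    ring
  simp_rw [hM₀γ]
  rw [intervalIntegral.integral_of_le h12, ← integral_const_mul]
  have hswap : ∫ t in Ioc t₁ t₂, ∫ x in V, M₀ (x, t) * γ (x, t)
      = ∫ x in V, ∫ t in Ioc t₁ t₂, M₀ (x, t) * γ (x, t) := by
    unfold IntegrableOn at hMint
    rw [restrict_prod_eq] at hMint
    exact (integral_integral_swap (f := fun x t => M₀ (x, t) * γ (x, t)) hMint).symm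
  rw [hswap]
  exact setIntegral_mono_on ((integrableOn_sq_mul_cube H.isOpen_V H.isOpen_O
    (fun x hx => H.nonpos x hx t₂ ht2) (H.contDiff t₂ ht2) hl hφ hφc hφs).const_mul _)
    hint2 H.isOpen_V.measurableSet hpt

theorem integrableOn_cube_prod (H : EnergySubsolution Λ K V O I w wt γ) {l : ℝ} (hl : 0 ≤ l)
    {B : Set (Cn n)} (hB : IsCompact B) (hBs : B ⊆ V ∪ O) {t₁ t₂ : ℝ} (hI : Icc t₁ t₂ ⊆ I) :
    IntegrableOn (fun p => max (w p - l) 0 ^ 3) ((V ∩ B) ×ˢ Ioc t₁ t₂) := by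
  have hc : IsCompact (B \ O) := hB.diff H.isOpen_O
  have hs : B \ O ⊆ V ∩ B := fun x hx => ⟨(hBs hx.1).resolve_right hx.2, hx.1⟩
  have h1 : IntegrableOn (fun p => max (w p - l) 0 ^ 3) ((V ∩ B) ×ˢ Icc t₁ t₂) := by
    refine integrableOn_of_continuousOn_of_eq_zero (hc.prod isCompact_Icc) (prod_mono_left hs)
      ((H.isOpen_V.measurableSet.inter hB.measurableSet).prod measurableSet_Icc) ?_ ?_
    · have := H.cont.mono (prod_mono (hs.trans inter_subset_left) hI)
      fun_prop
    · rintro ⟨x, t⟩ ⟨⟨hx, ht⟩, hn⟩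
      have hxO : x ∈ O := by
        by_contra h
        exact hn ⟨⟨hx.2, h⟩, ht⟩
      have := H.nonpos x ⟨hx.1, hxO⟩ t (hI ht)
      rw [max_eq_right (by linarith)]
      simp
  exact h1.mono_set (prod_mono_right Ioc_subset_Icc_self)

theorem integrableOn_cube_slice (H : EnergySubsolution Λ K V O I w wt γ) {l : ℝ} (hl : 0 ≤ l)
    {B : Set (Cn n)} (hB : IsCompact B) (hBs : B ⊆ V ∪ O) {t : ℝ} (ht : t ∈ I) :
    IntegrableOn (fun x => max (w (x, t) - l) 0 ^ 3) (V ∩ B) := by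
  have hc : IsCompact (B \ O) := hB.diff H.isOpen_O
  have hs : B \ O ⊆ V ∩ B := fun x hx => ⟨(hBs hx.1).resolve_right hx.2, hx.1⟩
  refine integrableOn_of_continuousOn_of_eq_zero hc hs
    (H.isOpen_V.measurableSet.inter hB.measurableSet) ?_ ?_
  · exact (((continuousOn_slice H.cont ht).mono (hs.trans inter_subset_left)).sub
      continuousOn_const |>.sup continuousOn_const).pow 3
  · intro x hx
    have hxO : x ∈ O := by
      by_contra h
      exact hx.2 ⟨hx.1.2, h⟩
    have := H.nonpos x ⟨hx.1.1, hxO⟩ t ht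
    rw [max_eq_right (by linarith)]
    simp

/-- The Caccioppoli inequality, with the time weight `t - t₁`. -/
theorem caccioppoli (H : EnergySubsolution Λ K V O I w wt γ) (hΛ : 0 < Λ) (hK : 0 ≤ K) {l : ℝ}
    (hl : 0 ≤ l) {φ : Cn n → ℝ} (hφ : ContDiff ℝ 1 φ) {B : Set (Cn n)} (hB : IsCompact B)
    (hBs : B ⊆ V ∪ O) (hφB : tsupport φ ⊆ B) (hφ1 : ∀ x, |φ x| ≤ 1) {b : ℝ}
    (hφb : ∀ x, ‖fderiv ℝ φ x‖ ^ 2 ≤ b) {t₁ t₂ : ℝ} (h12 : t₁ ≤ t₂) (hI : Icc t₁ t₂ ⊆ I)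
    {q : ℝ}
    (hq : ∀ t ∈ Ioc t₁ t₂, q * ∫ x in V, φ x ^ 2 * max (w (x, t) - l) 0 ^ 3 ≤
      (∫ x in V, φ x ^ 2 * max (w (x, t) - l) 0 * ‖fderiv ℝ (fun y => w (y, t)) x‖ ^ 2)
        + ∫ x in V, max (w (x, t) - l) 0 ^ 3 * ‖fderiv ℝ φ x‖ ^ 2) :
    (t₂ - t₁) * Λ⁻¹ * (∫ x in V, φ x ^ 2 * max (w (x, t₂) - l) 0 ^ 3)
      + 3 * Λ⁻¹ * q * (∫ t in t₁..t₂, (t - t₁) * ∫ x in V, φ x ^ 2 * max (w (x, t) - l) 0 ^ 3)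
      ≤ ((t₂ - t₁) * (3 * (Λ + Λ⁻¹) * b + K * Λ) + Λ)
        * ∫ t in t₁..t₂, ∫ x in V ∩ B, max (w (x, t) - l) 0 ^ 3 := by
  have hφc : HasCompactSupport φ := hB.of_isClosed_subset (isClosed_tsupport φ) hφB
  have hφs : tsupport φ ⊆ V ∪ O := hφB.trans hBs
  have hb : 0 ≤ b := (sq_nonneg _).trans (hφb 0)
  have hΛi : 0 < Λ⁻¹ := inv_pos.2 hΛ
  set S := tsupport φ \ O with hSdef
  have hS := isCompact_tsupport_diff H.isOpen_O hφc
  have hSV := tsupport_diff_subset hφs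
  have hfz : ∀ x ∈ V \ S, ∀ t ∈ I, φ x = 0 ∨ max (w (x, t) - l) 0 = 0 := by
    intro x hx t ht
    rcases truncation_eq_zero (v := fun x => w (x, t)) (fun x hx => H.nonpos x hx t ht) hl hx
      with h | h
    · exact Or.inl (image_eq_zero_of_notMem_tsupport h)
    · exact Or.inr h
  have hwc := H.cont
  have hwtc := H.cont_t
  have hφcont : ContinuousOn (fun p : Cn n × ℝ => φ p.1) (V ×ˢ I) :=
    (hφ.continuous.comp continuous_fst).continuousOn
  have cf : ContinuousOn (fun p : Cn n × ℝ => max (w p - l) 0) (V ×ˢ I) :=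
    (hwc.sub continuousOn_const).sup continuousOn_const
  have c1 : ContinuousOn (fun p : Cn n × ℝ => φ p.1 ^ 2 * max (w p - l) 0 ^ 2 * wt p)
      (V ×ˢ I) := ((hφcont.pow 2).mul (cf.pow 2)).mul hwtc
  have c2 : ContinuousOn (fun p : Cn n × ℝ => φ p.1 ^ 2 * max (w p - l) 0 ^ 3)
      (V ×ˢ I) := (hφcont.pow 2).mul (cf.pow 3)
  have c3 : ContinuousOn (fun p : Cn n × ℝ => (p.2 - t₁) *
      (φ p.1 ^ 2 * max (w p - l) 0 ^ 3)) (V ×ˢ I) := by fun_prop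
  have p1 := H.integrableOn_prod_mul hΛ hS hSV hI c1 fun x hx t ht => by
    rcases hfz x hx t ht with h | h <;> simp [h]
  have p2 := H.integrableOn_prod_mul hΛ hS hSV hI c2 fun x hx t ht => by
    rcases hfz x hx t ht with h | h <;> simp [h]
  have p3 := H.integrableOn_prod hS hSV hI c3 fun x hx t ht => by
    rcases hfz x hx t ht with h | h <;> simp [h]
  have p4 := H.integrableOn_cube_prod hl hB hBs hI
  -- The density `γ` is assumed measurable only jointly in space and time, so Fubini supplies
  -- integrability of its slices for almost every time, which is enough for comparing the time
  -- integrals.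
  have s1 : ∀ᵐ t ∂(volume.restrict (Ioc t₁ t₂)), IntegrableOn
      (fun x => φ x ^ 2 * max (w (x, t) - l) 0 ^ 2 * wt (x, t) * γ (x, t)) V := by
    unfold IntegrableOn at p1
    rw [restrict_prod_eq] at p1
    exact p1.prod_left_ae
  have s2 : ∀ᵐ t ∂(volume.restrict (Ioc t₁ t₂)), IntegrableOn
      (fun x => φ x ^ 2 * max (w (x, t) - l) 0 ^ 3 * γ (x, t)) V := by
    unfold IntegrableOn at p2
    rw [restrict_prod_eq] at p2
    exact p2.prod_left_ae
  have q3 : IntegrableOn (fun t => (t - t₁) * ∫ x in V, φ x ^ 2 * max (w (x, t) - l) 0 ^ 3)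
      (Ioc t₁ t₂) := by
    have := integrableOn_slice_integral p3
    simpa only [integral_const_mul] using this
  have q4 : IntegrableOn (fun t => ∫ x in V ∩ B, max (w (x, t) - l) 0 ^ 3) (Ioc t₁ t₂) :=
    integrableOn_slice_integral p4
  have hte := H.time_energy hΛ hl hφ hφc hφs h12 hI
  set c := (t₂ - t₁) * (3 * (Λ + Λ⁻¹) * b + K * Λ) + Λ with hc
  have hle : ∫ t in t₁..t₂, ∫ x in V, ((t - t₁) * (3 *
          (φ x ^ 2 * max (w (x, t) - l) 0 ^ 2 * wt (x, t) * γ (x, t))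
          + K * (φ x ^ 2 * max (w (x, t) - l) 0 ^ 3 * γ (x, t)))
          + φ x ^ 2 * max (w (x, t) - l) 0 ^ 3 * γ (x, t))
      ≤ ∫ t in t₁..t₂, (-(3 * Λ⁻¹ * q) * ((t - t₁) *
          ∫ x in V, φ x ^ 2 * max (w (x, t) - l) 0 ^ 3)
        + c * ∫ x in V ∩ B, max (w (x, t) - l) 0 ^ 3) := by
    rw [intervalIntegral.integral_of_le h12, intervalIntegral.integral_of_le h12]
    have pM : IntegrableOn (fun t => ∫ x in V, ((t - t₁) * (3 *
          (φ x ^ 2 * max (w (x, t) - l) 0 ^ 2 * wt (x, t) * γ (x, t))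
          + K * (φ x ^ 2 * max (w (x, t) - l) 0 ^ 3 * γ (x, t)))
          + φ x ^ 2 * max (w (x, t) - l) 0 ^ 3 * γ (x, t))) (Ioc t₁ t₂) := by
      have cM : ContinuousOn (fun p : Cn n × ℝ => (p.2 - t₁) *
          (3 * (φ p.1 ^ 2 * max (w p - l) 0 ^ 2 * wt p)
          + K * (φ p.1 ^ 2 * max (w p - l) 0 ^ 3)) + φ p.1 ^ 2 * max (w p - l) 0 ^ 3)
          (V ×ˢ I) := by fun_prop
      have := integrableOn_slice_integral (H.integrableOn_prod_mul hΛ hS hSV hI cM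
        fun x hx t ht => by rcases hfz x hx t ht with h | h <;> simp [h])
      refine this.congr (Eventually.of_forall fun t => ?_)
      simp only
      congr 1
      ext x
      ring
    refine integral_mono_ae pM ((q3.const_mul _).add (q4.const_mul _)) ?_
    filter_upwards [s1, s2, ae_restrict_mem measurableSet_Ioc] with t u1 u2 ht
    have htI : t ∈ I := hI (Ioc_subset_Icc_self ht)
    have hO := fun x hx => H.nonpos x hx t htI
    have hw1 := H.contDiff t htI
    have e1 := integrableOn_sq_mul_cube H.isOpen_V H.isOpen_O hO hw1 hl hφ hφc hφs
    have e2 := integrableOn_sq_mul_fderiv H.isOpen_V H.isOpen_O hO hw1 hl hφ hφc hφs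
    have e3 := integrableOn_cube_mul_fderiv H.isOpen_V H.isOpen_O hO hw1 hl hφ hφc hφs
    have e4 := H.integrableOn_cube_slice hl hB hBs htI
    have en := H.energy t htI l hl φ hφ hφc hφs
    rw [integral_add (e2.const_mul _) (e3.const_mul _), integral_const_mul,
      integral_const_mul] at en
    have hqt := hq t ht
    have hV := H.isOpen_V.measurableSet
    have hVB : MeasurableSet (V ∩ B) := hV.inter hB.measurableSet
    -- comparison with the integral over `V ∩ B`
    have hres : ∀ F : Cn n → ℝ, (∀ x ∉ tsupport φ, F x = 0) →
        ∫ x in V, F x = ∫ x in V ∩ B, F x := by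
      intro F hF
      rw [← integral_indicator hV, ← integral_indicator hVB]
      congr 1
      ext x
      by_cases hxV : x ∈ V
      · by_cases hxB : x ∈ B
        · rw [indicator_of_mem hxV, indicator_of_mem (show x ∈ V ∩ B from ⟨hxV, hxB⟩)]
        · rw [indicator_of_mem hxV, indicator_of_notMem fun h => hxB h.2,
            hF x fun h => hxB (hφB h)]
      · rw [indicator_of_notMem hxV, indicator_of_notMem fun h => hxV h.1]
    set e := ∫ x in V, φ x ^ 2 * max (w (x, t) - l) 0 ^ 3 with he
    set h := ∫ x in V ∩ B, max (w (x, t) - l) 0 ^ 3 with hh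
    set D := ∫ x in V, max (w (x, t) - l) 0 ^ 3 * ‖fderiv ℝ φ x‖ ^ 2 with hD
    have hφsq : ∀ x, φ x ^ 2 ≤ 1 := fun x => by
      rw [← sq_abs]; exact pow_le_one₀ (abs_nonneg _) (hφ1 x)
    have he0 : 0 ≤ e := setIntegral_nonneg hV fun x _ => by positivity
    have hh0 : 0 ≤ h := setIntegral_nonneg hVB fun x _ => by positivity
    have heh : e ≤ h := by
      rw [he, hres _ fun x hx => by simp [image_eq_zero_of_notMem_tsupport hx]]
      refine setIntegral_mono_on (e1.mono_set inter_subset_left) e4 hVB fun x _ => ?_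
      have : (0 : ℝ) ≤ max (w (x, t) - l) 0 ^ 3 := by positivity
      nlinarith [hφsq x]
    have hDh : D ≤ b * h := by
      rw [hD, hres _ fun x hx => by
        have : fderiv ℝ φ x = 0 := by
          by_contra hne
          exact hx (support_fderiv_subset ℝ hne)
        simp [this], hh, ← integral_const_mul]
      refine setIntegral_mono_on (e3.mono_set inter_subset_left) (e4.const_mul _) hVB fun x _ => ?_
      have : (0 : ℝ) ≤ max (w (x, t) - l) 0 ^ 3 := by positivity
      nlinarith [hφb x]
    have hE : ∫ x in V, φ x ^ 2 * max (w (x, t) - l) 0 ^ 3 * γ (x, t) ≤ Λ * e := by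
      rw [he, ← integral_const_mul]
      refine setIntegral_mono_on u2 (e1.const_mul _) hV fun x hx => ?_
      rw [mul_comm Λ]
      exact mul_le_mul_of_nonneg_left (H.bounds x hx t htI).2 (by positivity)
    have hE0 : 0 ≤ ∫ x in V, φ x ^ 2 * max (w (x, t) - l) 0 ^ 3 * γ (x, t) :=
      setIntegral_nonneg hV fun x hx => mul_nonneg (by positivity)
        (hΛi.le.trans (H.bounds x hx t htI).1)
    have v1 : IntegrableOn (fun x => 3 *
        (φ x ^ 2 * max (w (x, t) - l) 0 ^ 2 * wt (x, t) * γ (x, t))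
        + K * (φ x ^ 2 * max (w (x, t) - l) 0 ^ 3 * γ (x, t))) V :=
      (u1.const_mul _).add (u2.const_mul _)
    rw [integral_add (v1.const_mul _) u2, integral_const_mul,
      integral_add (u1.const_mul _) (u2.const_mul _), integral_const_mul, integral_const_mul]
    set P := ∫ x in V, φ x ^ 2 * max (w (x, t) - l) 0 ^ 2 * wt (x, t) * γ (x, t)
    set E := ∫ x in V, φ x ^ 2 * max (w (x, t) - l) 0 ^ 3 * γ (x, t)
    -- The energy inequality bounds $3P$ by $-3\Lambda^{-1}$ times the gradient term plus $3\Lambda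
    -- D$. By `hq` the gradient term is at least $qe-D$, whence the coefficient
    -- $\Lambda+\Lambda^{-1}$ in front of $D\le bh$.
    have hP : 3 * P + K * E ≤ -(3 * Λ⁻¹ * q) * e + (3 * (Λ + Λ⁻¹) * b + K * Λ) * h := by
      have y1 := mul_le_mul_of_nonneg_left hqt hΛi.le
      have y2 := mul_le_mul_of_nonneg_left hDh hΛi.le
      have y3 := mul_le_mul_of_nonneg_left hDh hΛ.le
      have y4 := mul_le_mul_of_nonneg_left (hE.trans (mul_le_mul_of_nonneg_left heh hΛ.le)) hK
      linarith
    have ht0 : 0 ≤ t - t₁ := by linarith [ht.1]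
    have z1 := mul_le_mul_of_nonneg_left hP ht0
    have z2 : (t - t₁) * ((3 * (Λ + Λ⁻¹) * b + K * Λ) * h)
        ≤ (t₂ - t₁) * ((3 * (Λ + Λ⁻¹) * b + K * Λ) * h) :=
      mul_le_mul_of_nonneg_right (by linarith [ht.2]) (by positivity)
    have z3 := mul_le_mul_of_nonneg_left heh hΛ.le
    change _ ≤ -(3 * Λ⁻¹ * q) * ((t - t₁) * e) + c * h
    rw [hc]
    linarith
  have hsplit : ∫ t in t₁..t₂, (-(3 * Λ⁻¹ * q) * ((t - t₁) *
          ∫ x in V, φ x ^ 2 * max (w (x, t) - l) 0 ^ 3)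
        + c * ∫ x in V ∩ B, max (w (x, t) - l) 0 ^ 3)
      = -(3 * Λ⁻¹ * q) * (∫ t in t₁..t₂, (t - t₁) *
          ∫ x in V, φ x ^ 2 * max (w (x, t) - l) 0 ^ 3)
        + c * ∫ t in t₁..t₂, ∫ x in V ∩ B, max (w (x, t) - l) 0 ^ 3 := by
    simp only [intervalIntegral.integral_of_le h12]
    rw [integral_add (q3.const_mul _) (q4.const_mul _), integral_const_mul, integral_const_mul]
  rw [hsplit] at hle
  linarith

end EnergySubsolution


/-! ### Explicit cutoff functions. -/

/-- A polynomial cutoff function of the ball `B_ρ(x₀)`. -/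
noncomputable def ballCutoff {n : ℕ} (x₀ : Cn n) (ρ : ℝ) (x : Cn n) : ℝ :=
  max (1 - ‖x - x₀‖ ^ 2 / ρ ^ 2) 0 ^ 2

section Cutoff

variable {n : ℕ} (x₀ : Cn n) {ρ : ℝ}

theorem hasFDerivAt_ballCutoff (ρ : ℝ) (x : Cn n) : HasFDerivAt (ballCutoff x₀ ρ)
    ((2 * max (1 - ‖x - x₀‖ ^ 2 / ρ ^ 2) 0 * (-(2 / ρ ^ 2))) • innerSL ℝ (x - x₀)) x := by
  have h1 : HasFDerivAt (fun x : Cn n => ‖x - x₀‖ ^ 2) (2 • innerSL ℝ (x - x₀)) x := by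
    have := (hasStrictFDerivAt_norm_sq (F := Cn n) (x - x₀)).hasFDerivAt
    have h2 := this.comp x ((hasFDerivAt_id x).sub_const x₀)
    exact h2
  have h2 : HasDerivAt (fun y : ℝ => max (1 - y / ρ ^ 2) 0 ^ 2)
      (2 * max (1 - ‖x - x₀‖ ^ 2 / ρ ^ 2) 0 * (-(1 / ρ ^ 2))) (‖x - x₀‖ ^ 2) := by
    have a := hasDerivAt_max_zero_pow 0 (1 - ‖x - x₀‖ ^ 2 / ρ ^ 2)
    have b : HasDerivAt (fun y : ℝ => 1 - y / ρ ^ 2) (-(1 / ρ ^ 2)) (‖x - x₀‖ ^ 2) :=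
      ((hasDerivAt_id _).div_const _).const_sub 1
    have := a.comp (‖x - x₀‖ ^ 2) b
    norm_num at this ⊢
    exact this
  have e : (2 * max (1 - ‖x - x₀‖ ^ 2 / ρ ^ 2) 0 * (-(2 / ρ ^ 2))) • innerSL ℝ (x - x₀)
      = (2 * max (1 - ‖x - x₀‖ ^ 2 / ρ ^ 2) 0 * (-(1 / ρ ^ 2))) • (2 • innerSL ℝ (x - x₀)) := by
    rw [two_nsmul, ← two_smul ℝ, smul_smul]
    congr 1
    ring
  have := h2.comp_hasFDerivAt x h1
  rw [e]
  exact this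

theorem contDiff_ballCutoff (ρ : ℝ) : ContDiff ℝ 1 (ballCutoff x₀ ρ) := by
  have h : ContDiff ℝ 1 fun x : Cn n => 1 - ‖x - x₀‖ ^ 2 / ρ ^ 2 :=
    contDiff_const.sub (((contDiff_id.sub contDiff_const).norm_sq ℝ).div_const _)
  exact (contDiff_max_zero_pow 0).comp h

theorem tsupport_ballCutoff_subset (hρ : 0 < ρ) :
    tsupport (ballCutoff x₀ ρ) ⊆ Metric.closedBall x₀ ρ := by
  refine closure_minimal (fun x hx => ?_) Metric.isClosed_closedBall
  by_contra h
  rw [Metric.mem_closedBall, dist_eq_norm, not_le] at h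
  refine hx ?_
  have : 1 ≤ ‖x - x₀‖ ^ 2 / ρ ^ 2 := by
    rw [one_le_div (by positivity)]
    exact pow_le_pow_left₀ hρ.le h.le 2
  rw [ballCutoff, max_eq_right (by linarith)]
  simp

theorem abs_ballCutoff_le_one (ρ : ℝ) (x : Cn n) : |ballCutoff x₀ ρ x| ≤ 1 := by
  unfold ballCutoff
  rw [abs_of_nonneg (by positivity)]
  refine pow_le_one₀ (le_max_right _ _) (max_le ?_ zero_le_one)
  have : 0 ≤ ‖x - x₀‖ ^ 2 / ρ ^ 2 := by positivity
  linarith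

theorem norm_fderiv_ballCutoff_sq_le (hρ : 0 < ρ) (x : Cn n) :
    ‖fderiv ℝ (ballCutoff x₀ ρ) x‖ ^ 2 ≤ 16 / ρ ^ 2 := by
  rw [(hasFDerivAt_ballCutoff x₀ ρ x).fderiv, norm_smul, innerSL_apply_norm]
  by_cases h : ‖x - x₀‖ ≤ ρ
  · have h1 : max (1 - ‖x - x₀‖ ^ 2 / ρ ^ 2) 0 ≤ 1 := by
      refine max_le ?_ zero_le_one
      have : 0 ≤ ‖x - x₀‖ ^ 2 / ρ ^ 2 := by positivity
      linarith
    have h0 : 0 ≤ max (1 - ‖x - x₀‖ ^ 2 / ρ ^ 2) 0 := le_max_right _ _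
    set m := max (1 - ‖x - x₀‖ ^ 2 / ρ ^ 2) 0
    rw [mul_pow, Real.norm_eq_abs, sq_abs]
    have e : (2 * m * (-(2 / ρ ^ 2))) ^ 2 * ‖x - x₀‖ ^ 2
        = (16 / ρ ^ 2) * (m ^ 2 * (‖x - x₀‖ ^ 2 / ρ ^ 2)) := by
      field_simp
      ring
    rw [e]
    refine mul_le_of_le_one_right (by positivity) (mul_le_one₀ (pow_le_one₀ h0 h1)
      (by positivity) ?_)
    rw [div_le_one (by positivity)]
    exact pow_le_pow_left₀ (norm_nonneg _) h 2
  · have : 1 ≤ ‖x - x₀‖ ^ 2 / ρ ^ 2 := by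
      rw [one_le_div (by positivity)]
      exact pow_le_pow_left₀ hρ.le (not_le.1 h).le 2
    rw [max_eq_right (by linarith)]
    simp
    positivity

/-- The margin `κ` is measured on squared radii. The same number then controls the cutoff from below
by $\kappa^2$ and the gap between the initial times of the two cylinders by $\kappa\rho^2$; together
with the squared cutoff this explains the factor $\kappa^5\rho^2$ in the cylinder estimates. -/
theorem le_ballCutoff {ρ' κ : ℝ} (hρ : 0 < ρ) (hκ : 0 ≤ κ)
    (h : ρ' ^ 2 ≤ (1 - κ) * ρ ^ 2) {x : Cn n} (hx : x ∈ Metric.closedBall x₀ ρ') :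
    κ ^ 2 ≤ ballCutoff x₀ ρ x := by
  rw [Metric.mem_closedBall, dist_eq_norm] at hx
  refine pow_le_pow_left₀ hκ (le_max_of_le_left ?_) 2
  have h1 : ‖x - x₀‖ ^ 2 ≤ ρ' ^ 2 := pow_le_pow_left₀ (norm_nonneg _) hx 2
  have : ‖x - x₀‖ ^ 2 / ρ ^ 2 ≤ 1 - κ := by
    rw [div_le_iff₀ (by positivity)]
    linarith
  linarith

end Cutoff

/-! ### Estimates on nested parabolic cylinders. -/

/-- The space-time integral of `(w - l)₊³` over a closed parabolic cylinder. -/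
noncomputable def cubeMass {n : ℕ} (V : Set (Cn n)) (w : Cn n × ℝ → ℝ) (x₀ : Cn n) (t₀ ρ l : ℝ) :
    ℝ :=
  ∫ t in (t₀ - ρ ^ 2)..t₀, ∫ x in V ∩ Metric.closedBall x₀ ρ, max (w (x, t) - l) 0 ^ 3

namespace EnergySubsolution

variable {n : ℕ} {Λ K : ℝ} {V O : Set (Cn n)} {I : Set ℝ} {w wt γ : Cn n × ℝ → ℝ}

theorem cubeMass_nonneg (w : Cn n × ℝ → ℝ) (V : Set (Cn n)) (x₀ : Cn n) (t₀ ρ l : ℝ) :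
    0 ≤ cubeMass V w x₀ t₀ ρ l := by
  refine intervalIntegral.integral_nonneg (by nlinarith [sq_nonneg ρ]) fun t _ => ?_
  exact integral_nonneg fun x => by positivity

theorem intervalIntegrable_cube_slice (H : EnergySubsolution Λ K V O I w wt γ) {l : ℝ}
    (hl : 0 ≤ l) {B : Set (Cn n)} (hB : IsCompact B) (hBs : B ⊆ V ∪ O) {t₁ t₂ : ℝ}
    (h12 : t₁ ≤ t₂) (hI : Icc t₁ t₂ ⊆ I) :
    IntervalIntegrable (fun t => ∫ x in V ∩ B, max (w (x, t) - l) 0 ^ 3) volume t₁ t₂ := by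
  rw [intervalIntegrable_iff_integrableOn_Ioc_of_le h12]
  exact integrableOn_slice_integral (H.integrableOn_cube_prod hl hB hBs hI)

theorem cubeMass_mono (H : EnergySubsolution Λ K V O I w wt γ) {x₀ : Cn n} {t₀ ρ ρ' l l' : ℝ}
    (hl : 0 ≤ l) (hll : l ≤ l') (hρ' : 0 ≤ ρ') (hρ : ρ' ≤ ρ)
    (hB : Metric.closedBall x₀ ρ ⊆ V ∪ O) (hI : Icc (t₀ - ρ ^ 2) t₀ ⊆ I) :
    cubeMass V w x₀ t₀ ρ' l' ≤ cubeMass V w x₀ t₀ ρ l := by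
  have hsq : ρ' ^ 2 ≤ ρ ^ 2 := pow_le_pow_left₀ hρ' hρ 2
  have hBB : Metric.closedBall x₀ ρ' ⊆ Metric.closedBall x₀ ρ :=
    Metric.closedBall_subset_closedBall hρ
  have hII : Icc (t₀ - ρ' ^ 2) t₀ ⊆ Icc (t₀ - ρ ^ 2) t₀ := Icc_subset_Icc_left (by linarith)
  have h0 : t₀ - ρ' ^ 2 ≤ t₀ := by nlinarith [sq_nonneg ρ']
  have h0' : t₀ - ρ ^ 2 ≤ t₀ := by nlinarith [sq_nonneg ρ]
  have j1 := H.intervalIntegrable_cube_slice (hl.trans hll) (isCompact_closedBall x₀ ρ')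
    (hBB.trans hB) h0 (hII.trans hI)
  have j2 := H.intervalIntegrable_cube_slice hl (isCompact_closedBall x₀ ρ) hB h0' hI
  unfold cubeMass
  calc _ ≤ ∫ t in (t₀ - ρ' ^ 2)..t₀, ∫ x in V ∩ Metric.closedBall x₀ ρ,
        max (w (x, t) - l) 0 ^ 3 := by
        refine intervalIntegral.integral_mono_on h0 j1 (j2.mono_set ?_) fun t ht => ?_
        · rw [uIcc_of_le h0, uIcc_of_le h0']; exact hII
        · have htI := hI (hII ht)
          have k1 := H.integrableOn_cube_slice (hl.trans hll) (isCompact_closedBall x₀ ρ')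
            (hBB.trans hB) htI
          have k2 := H.integrableOn_cube_slice hl (isCompact_closedBall x₀ ρ) hB htI
          have hm : MeasurableSet (V ∩ Metric.closedBall x₀ ρ') :=
            H.isOpen_V.measurableSet.inter Metric.isClosed_closedBall.measurableSet
          refine (setIntegral_mono_on k1 (k2.mono_set (inter_subset_inter_right _ hBB)) hm
            fun x _ => ?_).trans (setIntegral_mono_set k2
              (Eventually.of_forall fun x => by positivity)
              (inter_subset_inter_right _ hBB).eventuallyLE)
          gcongr
    _ ≤ _ := by
        refine intervalIntegral.integral_mono_interval (by linarith) h0 le_rfl ?_ j2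
        exact Eventually.of_forall fun t => integral_nonneg fun x => by positivity

/-- The constant of the Caccioppoli inequality on cylinders of radius at most `R`. -/
noncomputable def caccioppoliConst (Λ K R : ℝ) : ℝ :=
  Λ * (R ^ 2 * (K * Λ) + 48 * (Λ + Λ⁻¹) + Λ)

theorem caccioppoliConst_pos (hΛ : 0 < Λ) (hK : 0 ≤ K) (R : ℝ) : 0 < caccioppoliConst Λ K R := by
  unfold caccioppoliConst
  positivity

theorem caccioppoli_cylinder (H : EnergySubsolution Λ K V O I w wt γ) (hΛ : 0 < Λ) (hK : 0 ≤ K)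
    {R l : ℝ} (hl : 0 ≤ l) {x₀ : Cn n} {t₀ ρ : ℝ} (hρ : 0 < ρ) (hρR : ρ ≤ R)
    (hB : Metric.closedBall x₀ ρ ⊆ V ∪ O) (hI : Icc (t₀ - ρ ^ 2) t₀ ⊆ I) {t : ℝ}
    (ht : t ∈ Icc (t₀ - ρ ^ 2) t₀) {q : ℝ}
    (hq : ∀ t ∈ Icc (t₀ - ρ ^ 2) t₀, q * ∫ x in V, ballCutoff x₀ ρ x ^ 2 * max (w (x, t) - l) 0 ^ 3
      ≤ (∫ x in V, ballCutoff x₀ ρ x ^ 2 * max (w (x, t) - l) 0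
          * ‖fderiv ℝ (fun y => w (y, t)) x‖ ^ 2)
        + ∫ x in V, max (w (x, t) - l) 0 ^ 3 * ‖fderiv ℝ (ballCutoff x₀ ρ) x‖ ^ 2) :
    (t - (t₀ - ρ ^ 2)) * (∫ x in V, ballCutoff x₀ ρ x ^ 2 * max (w (x, t) - l) 0 ^ 3)
      + 3 * q * (∫ τ in (t₀ - ρ ^ 2)..t, (τ - (t₀ - ρ ^ 2)) *
        ∫ x in V, ballCutoff x₀ ρ x ^ 2 * max (w (x, τ) - l) 0 ^ 3)
      ≤ caccioppoliConst Λ K R * cubeMass V w x₀ t₀ ρ l := by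
  have hsub : Icc (t₀ - ρ ^ 2) t ⊆ Icc (t₀ - ρ ^ 2) t₀ := Icc_subset_Icc_right ht.2
  have h := H.caccioppoli hΛ hK hl (contDiff_ballCutoff x₀ ρ) (isCompact_closedBall x₀ ρ) hB
    (tsupport_ballCutoff_subset x₀ hρ) (abs_ballCutoff_le_one x₀ ρ)
    (norm_fderiv_ballCutoff_sq_le x₀ hρ) ht.1 (hsub.trans hI)
    (fun t' ht' => hq t' (hsub (Ioc_subset_Icc_self ht')))
  have h0 : t₀ - ρ ^ 2 ≤ t₀ := by nlinarith [sq_nonneg ρ]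
  have j := H.intervalIntegrable_cube_slice hl (isCompact_closedBall x₀ ρ) hB h0 hI
  have hm : ∫ t in (t₀ - ρ ^ 2)..t, ∫ x in V ∩ Metric.closedBall x₀ ρ, max (w (x, t) - l) 0 ^ 3
      ≤ cubeMass V w x₀ t₀ ρ l := by
    refine intervalIntegral.integral_mono_interval le_rfl ht.1 ht.2 ?_ j
    exact Eventually.of_forall fun t => integral_nonneg fun x => by positivity
  have hm0 : 0 ≤ ∫ t in (t₀ - ρ ^ 2)..t, ∫ x in V ∩ Metric.closedBall x₀ ρ,
      max (w (x, t) - l) 0 ^ 3 :=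
    intervalIntegral.integral_nonneg ht.1 fun t _ => integral_nonneg fun x => by positivity
  -- The duration is at most $\rho^2$, which cancels the $16/\rho^2$ of the cutoff gradient and
  -- leaves $3\cdot16=48$. The volume growth term is not scale invariant: it costs
  -- $\rho^2K\Lambda\le R^2K\Lambda$, and this is how `R` enters the constant.
  have hc : (t - (t₀ - ρ ^ 2)) * (3 * (Λ + Λ⁻¹) * (16 / ρ ^ 2) + K * Λ) + Λ
      ≤ R ^ 2 * (K * Λ) + 48 * (Λ + Λ⁻¹) + Λ := by
    have h1 : t - (t₀ - ρ ^ 2) ≤ ρ ^ 2 := by linarith [ht.2]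
    have h2 : ρ ^ 2 ≤ R ^ 2 := pow_le_pow_left₀ hρ.le hρR 2
    have h3 := mul_le_mul_of_nonneg_right h1
      (by positivity : 0 ≤ 3 * (Λ + Λ⁻¹) * (16 / ρ ^ 2) + K * Λ)
    have h4 := mul_le_mul_of_nonneg_right h2 (by positivity : 0 ≤ K * Λ)
    have h5 : ρ ^ 2 * (3 * (Λ + Λ⁻¹) * (16 / ρ ^ 2) + K * Λ)
        = 48 * (Λ + Λ⁻¹) + ρ ^ 2 * (K * Λ) := by
      field_simp
      ring
    linarith
  have h6 := h.trans (mul_le_mul hc hm hm0 (by positivity))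
  have h7 := mul_le_mul_of_nonneg_left h6 hΛ.le
  unfold caccioppoliConst
  rw [← mul_assoc] at h7
  refine le_trans (le_of_eq ?_) h7
  field_simp

theorem pow_four_mul_integral_le (H : EnergySubsolution Λ K V O I w wt γ)
    {l : ℝ} (hl : 0 ≤ l) {x₀ : Cn n} {ρ ρ' κ : ℝ} (hρ : 0 < ρ)
    (hκ : 0 < κ) (hρκ : ρ' ^ 2 ≤ (1 - κ) * ρ ^ 2) (hρρ : ρ' ≤ ρ)
    (hB : Metric.closedBall x₀ ρ ⊆ V ∪ O) {t : ℝ} (ht : t ∈ I) :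
    κ ^ 4 * ∫ x in V ∩ Metric.closedBall x₀ ρ', max (w (x, t) - l) 0 ^ 3
      ≤ ∫ x in V, ballCutoff x₀ ρ x ^ 2 * max (w (x, t) - l) 0 ^ 3 := by
  have hc : HasCompactSupport (ballCutoff x₀ ρ) :=
    (isCompact_closedBall x₀ ρ).of_isClosed_subset (isClosed_tsupport _)
      (tsupport_ballCutoff_subset x₀ hρ)
  have i1 := integrableOn_sq_mul_cube H.isOpen_V H.isOpen_O (fun x hx => H.nonpos x hx t ht)
    (H.contDiff t ht) hl (contDiff_ballCutoff x₀ ρ) hc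
    ((tsupport_ballCutoff_subset x₀ hρ).trans hB)
  have i2 := H.integrableOn_cube_slice hl (isCompact_closedBall x₀ ρ')
    ((Metric.closedBall_subset_closedBall hρρ).trans hB) ht
  have hm : MeasurableSet (V ∩ Metric.closedBall x₀ ρ') :=
    H.isOpen_V.measurableSet.inter Metric.isClosed_closedBall.measurableSet
  rw [← integral_const_mul]
  refine (setIntegral_mono_on (i2.const_mul _) (i1.mono_set inter_subset_left) hm
    fun x hx => ?_).trans (setIntegral_mono_set i1 (Eventually.of_forall fun x => by positivity)
      inter_subset_left.eventuallyLE)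
  refine mul_le_mul_of_nonneg_right ?_ (by positivity)
  have := pow_le_pow_left₀ (by positivity) (le_ballCutoff x₀ hρ hκ.le hρκ hx.2) 2
  calc κ ^ 4 = (κ ^ 2) ^ 2 := by ring
    _ ≤ _ := this

/-- Slices of the smaller cylinder are controlled by the mass of the larger one. -/
theorem slice_le_cubeMass (H : EnergySubsolution Λ K V O I w wt γ) (hΛ : 0 < Λ) (hK : 0 ≤ K)
    {R l : ℝ} (hl : 0 ≤ l) {x₀ : Cn n} {t₀ ρ ρ' κ : ℝ} (hρ : 0 < ρ) (hρR : ρ ≤ R)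
    (hκ : 0 < κ) (hρκ : ρ' ^ 2 ≤ (1 - κ) * ρ ^ 2) (hρρ : ρ' ≤ ρ)
    (hB : Metric.closedBall x₀ ρ ⊆ V ∪ O) (hI : Icc (t₀ - ρ ^ 2) t₀ ⊆ I) {t : ℝ}
    (ht : t ∈ Icc (t₀ - ρ' ^ 2) t₀) :
    κ ^ 5 * ρ ^ 2 * ∫ x in V ∩ Metric.closedBall x₀ ρ', max (w (x, t) - l) 0 ^ 3
      ≤ caccioppoliConst Λ K R * cubeMass V w x₀ t₀ ρ l := by
  have hgap : κ * ρ ^ 2 ≤ t - (t₀ - ρ ^ 2) := by linarith [ht.1]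
  have hκρ : 0 < κ * ρ ^ 2 := by positivity
  have htt : t ∈ Icc (t₀ - ρ ^ 2) t₀ := ⟨by linarith, ht.2⟩
  -- With `q = 0` the time-integrated term disappears: only the slice at time `t` is wanted here.
  have h := H.caccioppoli_cylinder hΛ hK hl hρ hρR hB hI htt (q := 0) fun t _ => by
    rw [zero_mul]
    exact add_nonneg (integral_nonneg fun x => by positivity)
      (integral_nonneg fun x => by positivity)
  rw [mul_zero, zero_mul, add_zero] at h
  have h2 := H.pow_four_mul_integral_le hl hρ hκ hρκ hρρ hB (hI htt)
  refine le_trans ?_ h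
  have h3 := mul_le_mul hgap h2 (mul_nonneg (by positivity)
    (integral_nonneg fun x => by positivity)) (hκρ.le.trans hgap)
  refine le_trans (le_of_eq ?_) h3
  ring

/-- The mass of the smaller cylinder gains a factor if the slices have small support. -/
theorem cubeMass_le_mul (H : EnergySubsolution Λ K V O I w wt γ) (hΛ : 0 < Λ) (hK : 0 ≤ K)
    {R l : ℝ} (hl : 0 ≤ l) {x₀ : Cn n} {t₀ ρ ρ' κ : ℝ} (hρ : 0 < ρ) (hρR : ρ ≤ R)
    (hκ : 0 < κ) (hρκ : ρ' ^ 2 ≤ (1 - κ) * ρ ^ 2) (hρ' : 0 ≤ ρ') (hρρ : ρ' ≤ ρ)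
    (hB : Metric.closedBall x₀ ρ ⊆ V ∪ O) (hI : Icc (t₀ - ρ ^ 2) t₀ ⊆ I) {q : ℝ} (hq0 : 0 ≤ q)
    (hq : ∀ t ∈ Icc (t₀ - ρ ^ 2) t₀, q * ∫ x in V, ballCutoff x₀ ρ x ^ 2 * max (w (x, t) - l) 0 ^ 3
      ≤ (∫ x in V, ballCutoff x₀ ρ x ^ 2 * max (w (x, t) - l) 0
          * ‖fderiv ℝ (fun y => w (y, t)) x‖ ^ 2)
        + ∫ x in V, max (w (x, t) - l) 0 ^ 3 * ‖fderiv ℝ (ballCutoff x₀ ρ) x‖ ^ 2) :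
    κ ^ 5 * ρ ^ 2 * q * cubeMass V w x₀ t₀ ρ' l
      ≤ caccioppoliConst Λ K R * cubeMass V w x₀ t₀ ρ l := by
  have h0 : t₀ - ρ ^ 2 ≤ t₀ := by nlinarith [sq_nonneg ρ]
  have h0' : t₀ - ρ' ^ 2 ≤ t₀ := by nlinarith [sq_nonneg ρ']
  have hsq : ρ' ^ 2 ≤ ρ ^ 2 := pow_le_pow_left₀ hρ' hρρ 2
  have hκρ : 0 < κ * ρ ^ 2 := by positivity
  have h := H.caccioppoli_cylinder hΛ hK hl hρ hρR hB hI ⟨h0, le_rfl⟩ hq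
  have hfirst : 0 ≤ (t₀ - (t₀ - ρ ^ 2)) *
      (∫ x in V, ballCutoff x₀ ρ x ^ 2 * max (w (x, t₀) - l) 0 ^ 3) :=
    mul_nonneg (by linarith) (integral_nonneg fun x => by positivity)
  set F : ℝ → ℝ := fun τ => (τ - (t₀ - ρ ^ 2)) *
        ∫ x in V, ballCutoff x₀ ρ x ^ 2 * max (w (x, τ) - l) 0 ^ 3 with hF
  have hc : HasCompactSupport (ballCutoff x₀ ρ) :=
    (isCompact_closedBall x₀ ρ).of_isClosed_subset (isClosed_tsupport _)
      (tsupport_ballCutoff_subset x₀ hρ)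
  have hφs := (tsupport_ballCutoff_subset x₀ hρ).trans hB
  have hFi : IntervalIntegrable F volume (t₀ - ρ ^ 2) t₀ := by
    rw [intervalIntegrable_iff_integrableOn_Ioc_of_le h0]
    have cf : ContinuousOn (fun p : Cn n × ℝ => max (w p - l) 0) (V ×ˢ I) :=
      (H.cont.sub continuousOn_const).sup continuousOn_const
    have hφcont : ContinuousOn (fun p : Cn n × ℝ => ballCutoff x₀ ρ p.1) (V ×ˢ I) :=
      ((contDiff_ballCutoff x₀ ρ).continuous.comp continuous_fst).continuousOn
    have c3 : ContinuousOn (fun p : Cn n × ℝ => (p.2 - (t₀ - ρ ^ 2)) *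
        (ballCutoff x₀ ρ p.1 ^ 2 * max (w p - l) 0 ^ 3)) (V ×ˢ I) :=
      (continuous_snd.sub continuous_const).continuousOn.mul ((hφcont.pow 2).mul (cf.pow 3))
    have := integrableOn_slice_integral (H.integrableOn_prod
      (isCompact_tsupport_diff H.isOpen_O hc) (tsupport_diff_subset hφs) hI c3 fun x hx t ht => by
        rcases truncation_eq_zero (v := fun x => w (x, t)) (fun x hx => H.nonpos x hx t ht) hl hx
          with h | h
        · simp [image_eq_zero_of_notMem_tsupport h]
        · simp [h])
    simpa only [integral_const_mul] using this
  have hFnn : ∀ τ, t₀ - ρ ^ 2 ≤ τ → 0 ≤ F τ := fun τ hτ =>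
    mul_nonneg (by linarith) (integral_nonneg fun x => by positivity)
  -- On the time interval of the smaller cylinder the weight is at least $\kappa\rho^2$, and on its
  -- ball the squared cutoff is at least $\kappa^4$.
  have hsmall : κ ^ 5 * ρ ^ 2 * cubeMass V w x₀ t₀ ρ' l ≤ ∫ τ in (t₀ - ρ ^ 2)..t₀, F τ := by
    have hsub : Icc (t₀ - ρ' ^ 2) t₀ ⊆ Icc (t₀ - ρ ^ 2) t₀ := Icc_subset_Icc_left (by linarith)
    have j1 := H.intervalIntegrable_cube_slice hl (isCompact_closedBall x₀ ρ')
      ((Metric.closedBall_subset_closedBall hρρ).trans hB) h0' (hsub.trans hI)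
    have hFi' : IntervalIntegrable F volume (t₀ - ρ' ^ 2) t₀ := hFi.mono_set (by
      rw [uIcc_of_le h0, uIcc_of_le h0']; exact hsub)
    calc _ = ∫ t in (t₀ - ρ' ^ 2)..t₀, κ ^ 5 * ρ ^ 2 *
          ∫ x in V ∩ Metric.closedBall x₀ ρ', max (w (x, t) - l) 0 ^ 3 := by
          rw [intervalIntegral.integral_const_mul]; rfl
      _ ≤ ∫ τ in (t₀ - ρ' ^ 2)..t₀, F τ := by
          refine intervalIntegral.integral_mono_on h0' (j1.const_mul _) hFi' fun τ hτ => ?_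
          have hgap : κ * ρ ^ 2 ≤ τ - (t₀ - ρ ^ 2) := by linarith [hτ.1]
          have h2 := H.pow_four_mul_integral_le hl hρ hκ hρκ hρρ hB (hI (hsub hτ))
          have h3 := mul_le_mul hgap h2 (mul_nonneg (by positivity)
            (integral_nonneg fun x => by positivity)) (hκρ.le.trans hgap)
          refine le_trans (le_of_eq ?_) h3
          ring
      _ ≤ _ := by
          refine intervalIntegral.integral_mono_interval (by linarith) h0' le_rfl ?_ hFi
          refine (ae_restrict_iff' measurableSet_Ioc).2 (Eventually.of_forall fun τ hτ => ?_)
          exact hFnn τ hτ.1.le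
  have h4 := mul_le_mul_of_nonneg_left hsmall hq0
  have h5 : 0 ≤ q * ∫ τ in (t₀ - ρ ^ 2)..t₀, F τ :=
    mul_nonneg hq0 (intervalIntegral.integral_nonneg h0 fun τ hτ => hFnn τ hτ.1)
  nlinarith [h, hfirst, h4, h5]

end EnergySubsolution


/-! ### De Giorgi iteration. -/

namespace EnergySubsolution

theorem shrinking_radius_sq_le {ρ h : ℝ} (h0 : 0 ≤ h) (h4 : h ≤ 1 / 4) :
    (ρ * (1 / 2 + h)) ^ 2 ≤ (1 - h) * (ρ * (1 / 2 + 2 * h)) ^ 2 := by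
  have h1 : (1 - h) * (ρ * (1 / 2 + 2 * h)) ^ 2 - (ρ * (1 / 2 + h)) ^ 2
      = ρ ^ 2 * (h * (3 / 4) + h * (h * (1 - 4 * h))) := by ring
  have h2 : 0 ≤ 1 - 4 * h := by linarith
  have h3 : 0 ≤ ρ ^ 2 * (h * (3 / 4) + h * (h * (1 - 4 * h))) := by positivity
  linarith

set_option maxHeartbeats 1000000 in
-- Two radius reductions make one step. The first turns the mass bound into a bound on every slice;
-- Chebyshev's inequality across the level gap then bounds the measure of the higher superlevel
-- sets. On such small sets the Faber-Krahn inequality makes the Caccioppoli inequality gain, and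
-- the second reduction exploits this. The power $1/n$ of the mass in the result is the
-- superlinearity that drives the iteration. The growth rates are $32=2^5$ from the margins to the
-- fifth power, and $256=32\cdot2^3$ with the cubed level gap.
theorem exists_deGiorgi_step {n : ℕ} (hn : 1 ≤ n) {Λ K R : ℝ} (hΛ : 0 < Λ) (hK : 0 ≤ K) :
    ∃ C : ℝ, 1 ≤ C ∧ ∀ {V O : Set (Cn n)} {I : Set ℝ} {w wt γ : Cn n × ℝ → ℝ},
      EnergySubsolution Λ K V O I w wt γ → ∀ {x₀ : Cn n} {t₀ ρ l : ℝ}, 0 < ρ → ρ ≤ R → 0 < l →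
      Metric.closedBall x₀ ρ ⊆ V ∪ O → Icc (t₀ - ρ ^ 2) t₀ ⊆ I → ∀ (m : ℕ) (y : ℝ), 0 < y →
      cubeMass V w x₀ t₀ (ρ * (1 / 2 + (1 / 2) ^ (m + 1))) (l * (1 - (1 / 2) ^ m)) ≤ y →
      (∀ t ∈ Icc (t₀ - (ρ * (1 / 2 + (1 / 2) ^ (m + 2))) ^ 2) t₀,
        ∫ x in V ∩ Metric.closedBall x₀ (ρ * (1 / 2 + (1 / 2) ^ (m + 2))),
          max (w (x, t) - l * (1 - (1 / 2) ^ m)) 0 ^ 3 ≤ C * 32 ^ m * (ρ ^ 2)⁻¹ * y) ∧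
      cubeMass V w x₀ t₀ (ρ * (1 / 2 + (1 / 2) ^ (m + 3))) (l * (1 - (1 / 2) ^ (m + 2)))
        ≤ C * 32 ^ m * (ρ ^ 2)⁻¹ *
          (C * 256 ^ m * (l ^ 3)⁻¹ * (ρ ^ 2)⁻¹ * y) ^ ((1 : ℝ) / n) * y := by
  obtain ⟨F, hF, hFK⟩ := exists_faberKrahn_truncation (n := n) hn
  set c := caccioppoliConst Λ K R with hc
  have hc0 : 0 < c := caccioppoliConst_pos hΛ hK R
  -- The first summand ensures $C\ge1$, the second serves the slices and the superlevel sets, the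
  -- third the gain of the second reduction.
  refine ⟨1 + 32768 * c + 131072 * c * F, by nlinarith [mul_pos hc0 hF], ?_⟩
  intro V O I w wt γ H x₀ t₀ ρ l hρ hρR hl hB hI m y hy hby
  set C := 1 + 32768 * c + 131072 * c * F with hC
  have hcF := mul_pos hc0 hF
  have hC0 : 0 < C := by positivity
  -- In terms of `h` the radii are $\rho(\frac12+2h)$, $\rho(\frac12+h)$, $\rho(\frac12+\frac h2)$
  -- with margins $h$ and $h/2$, and the levels are $l(1-4h)$, $l(1-2h)$, $l(1-h)$. The last level
  -- is reached only by monotonicity, so that a step advances the index by two.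
  set h : ℝ := (1 / 2) ^ (m + 2) with hh
  have hh0 : 0 < h := by positivity
  have hh4 : h ≤ 1 / 4 := by
    have : ((1 : ℝ) / 2) ^ m ≤ 1 := pow_le_one₀ (by norm_num) (by norm_num)
    rw [hh, pow_add]; linarith
  have e0 : ((1 : ℝ) / 2) ^ m = 4 * h := by rw [hh, pow_add]; ring
  have e1 : ((1 : ℝ) / 2) ^ (m + 1) = 2 * h := by rw [hh, pow_add, pow_add]; ring
  have e3 : ((1 : ℝ) / 2) ^ (m + 3) = h / 2 := by rw [hh, pow_add, pow_add]; ring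
  have hpow : 32 ^ m * h ^ 5 = 1 / 1024 := by
    rw [hh, ← pow_mul, mul_comm (m + 2) 5, mul_add, pow_add, pow_mul, ← mul_assoc, ← mul_pow]
    norm_num
  have hpow8 : 8 ^ m * h ^ 3 = 1 / 64 := by
    rw [hh, ← pow_mul, mul_comm (m + 2) 3, mul_add, pow_add, pow_mul, ← mul_assoc, ← mul_pow]
    norm_num
  rw [e0, e1] at hby
  rw [e0, e3]
  set r₀ := ρ * (1 / 2 + 2 * h) with hr₀
  set r₁ := ρ * (1 / 2 + h) with hr₁
  set r₂ := ρ * (1 / 2 + h / 2) with hr₂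
  have hr₀0 : 0 < r₀ := by positivity
  have hr₁0 : 0 < r₁ := by positivity
  have hr₂0 : 0 < r₂ := by positivity
  have hr₀ρ : r₀ ≤ ρ := mul_le_of_le_one_right hρ.le (by linarith)
  have hr₁₀ : r₁ ≤ r₀ := mul_le_mul_of_nonneg_left (by linarith) hρ.le
  have hr₂₁ : r₂ ≤ r₁ := mul_le_mul_of_nonneg_left (by linarith) hρ.le
  have hr₁4 : ρ ^ 2 / 4 ≤ r₁ ^ 2 := by
    have : ρ * (1 / 2) ≤ r₁ := mul_le_mul_of_nonneg_left (by linarith) hρ.le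
    have := pow_le_pow_left₀ (by positivity) this 2
    linarith
  have hκ₀ : r₁ ^ 2 ≤ (1 - h) * r₀ ^ 2 := shrinking_radius_sq_le hh0.le hh4
  have hκ₁ : r₂ ^ 2 ≤ (1 - h / 2) * r₁ ^ 2 := by
    have := shrinking_radius_sq_le (ρ := ρ) (half_pos hh0).le (by linarith : h / 2 ≤ 1 / 4)
    rwa [mul_div_cancel₀ h two_ne_zero] at this
  have hB₀ : Metric.closedBall x₀ r₀ ⊆ V ∪ O := (Metric.closedBall_subset_closedBall hr₀ρ).trans hB
  have hB₁ : Metric.closedBall x₀ r₁ ⊆ V ∪ O := (Metric.closedBall_subset_closedBall hr₁₀).trans hB₀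
  have hI₀ : Icc (t₀ - r₀ ^ 2) t₀ ⊆ I := (Icc_subset_Icc_left
    (sub_le_sub_left (pow_le_pow_left₀ hr₀0.le hr₀ρ 2) _)).trans hI
  have hI₁ : Icc (t₀ - r₁ ^ 2) t₀ ⊆ I := (Icc_subset_Icc_left
    (sub_le_sub_left (pow_le_pow_left₀ hr₁0.le hr₁₀ 2) _)).trans hI₀
  set l₀ := l * (1 - 4 * h) with hl₀
  have el₁ : l * (1 - ((1 : ℝ) / 2) ^ (m + 2)) = l * (1 - h) := by rw [hh]
  set l₁ := l * (1 - 2 * h) with hl₁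
  have hl₀0 : 0 ≤ l₀ := mul_nonneg hl.le (by linarith)
  have hl₁0 : 0 ≤ l₁ := mul_nonneg hl.le (by linarith)
  have hl01 : l₀ ≤ l₁ := mul_le_mul_of_nonneg_left (by linarith) hl.le
  have hρ2 : 0 < ρ ^ 2 := by positivity
  -- slices
  have hslice : ∀ t ∈ Icc (t₀ - r₁ ^ 2) t₀, ∫ x in V ∩ Metric.closedBall x₀ r₁,
      max (w (x, t) - l₀) 0 ^ 3 ≤ 4096 * c * 32 ^ m * (ρ ^ 2)⁻¹ * y := by
    intro t ht
    have h1 := H.slice_le_cubeMass hΛ hK hl₀0 hr₀0 (hr₀ρ.trans hρR) hh0 hκ₀ hr₁₀ hB₀ hI₀ ht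
    have h2 := h1.trans (mul_le_mul_of_nonneg_left hby hc0.le)
    set X := ∫ x in V ∩ Metric.closedBall x₀ r₁, max (w (x, t) - l₀) 0 ^ 3 with hX
    have hX0 : 0 ≤ X := integral_nonneg fun x => by positivity
    have h3 : ρ ^ 2 / 4 ≤ r₀ ^ 2 := hr₁4.trans (pow_le_pow_left₀ hr₁0.le hr₁₀ 2)
    have h4 : h ^ 5 * (ρ ^ 2 / 4) * X ≤ c * y :=
      (mul_le_mul_of_nonneg_right (mul_le_mul_of_nonneg_left h3 (by positivity)) hX0).trans h2
    have h5 := mul_le_mul_of_nonneg_left h4 (by positivity : 0 ≤ 4096 * 32 ^ m * (ρ ^ 2)⁻¹)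
    have h6 : 4096 * 32 ^ m * (ρ ^ 2)⁻¹ * (h ^ 5 * (ρ ^ 2 / 4) * X) = X := by
      have : 4096 * 32 ^ m * (ρ ^ 2)⁻¹ * (h ^ 5 * (ρ ^ 2 / 4) * X)
        = 1024 * (32 ^ m * h ^ 5) * ((ρ ^ 2)⁻¹ * ρ ^ 2) * X := by ring
      rw [this, hpow, inv_mul_cancel₀ hρ2.ne']; ring
    rw [h6] at h5
    linarith
  have hcC : 4096 * c ≤ C := by rw [hC]; linarith
  refine ⟨fun t ht => ?_, ?_⟩
  · refine (hslice t ht).trans ?_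
    gcongr
  -- measure of the superlevel sets
  set ω := 32768 * c * 256 ^ m * (l ^ 3)⁻¹ * (ρ ^ 2)⁻¹ * y with hω
  have hω0 : 0 < ω := by positivity
  have hvol : ∀ t ∈ Icc (t₀ - r₁ ^ 2) t₀,
      volume {x ∈ V | ballCutoff x₀ r₁ x ≠ 0 ∧ l₁ < w (x, t)} ≤ ENNReal.ofReal ω := by
    intro t ht
    have htI := hI₁ ht
    have k := H.integrableOn_cube_slice hl₀0 (isCompact_closedBall x₀ r₁) hB₁ htI
    have hm : MeasurableSet (V ∩ Metric.closedBall x₀ r₁) :=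
      H.isOpen_V.measurableSet.inter Metric.isClosed_closedBall.measurableSet
    -- Chebyshev's inequality for the cubed truncation at $l_0$: a point above level $l_1$
    -- contributes at least $(l_1-l_0)^3=(2lh)^3$.
    have hch := mul_meas_ge_le_integral_of_nonneg (μ := volume.restrict
      (V ∩ Metric.closedBall x₀ r₁)) (f := fun x => max (w (x, t) - l₀) 0 ^ 3)
      (Eventually.of_forall fun x => by positivity) k ((l * (2 * h)) ^ 3)
    have hch2 := hch.trans (hslice t ht)
    have hfin : (volume.restrict (V ∩ Metric.closedBall x₀ r₁))
        {x | (l * (2 * h)) ^ 3 ≤ max (w (x, t) - l₀) 0 ^ 3} ≠ ∞ := by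
      refine (lt_of_le_of_lt (measure_mono (subset_univ _)) ?_).ne
      rw [Measure.restrict_apply_univ]
      exact lt_of_le_of_lt (measure_mono inter_subset_right)
        (isCompact_closedBall x₀ r₁).measure_lt_top
    have hsub : {x ∈ V | ballCutoff x₀ r₁ x ≠ 0 ∧ l₁ < w (x, t)} ⊆
        {x | (l * (2 * h)) ^ 3 ≤ max (w (x, t) - l₀) 0 ^ 3}
          ∩ (V ∩ Metric.closedBall x₀ r₁) := by
      rintro x ⟨hxV, hx1, hx2⟩
      refine ⟨?_, hxV, tsupport_ballCutoff_subset x₀ hr₁0 (subset_tsupport _ hx1)⟩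
      refine pow_le_pow_left₀ (show 0 ≤ l * (2 * h) by positivity) (le_max_of_le_left ?_) 3
      have : l₁ - l₀ = l * (2 * h) := by rw [hl₁, hl₀]; ring
      linarith
    refine (measure_mono hsub).trans ?_
    refine (Measure.le_restrict_apply _ _).trans ?_
    rw [← ENNReal.ofReal_toReal hfin]
    refine ENNReal.ofReal_le_ofReal ?_
    have hp : 0 < (l * (2 * h)) ^ 3 := by positivity
    change (volume.restrict (V ∩ Metric.closedBall x₀ r₁)).real
        {x | (l * (2 * h)) ^ 3 ≤ max (w (x, t) - l₀) 0 ^ 3} ≤ ω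
    rw [← mul_le_mul_iff_right₀ hp]
    refine hch2.trans (le_of_eq ?_)
    have e256 : (256 : ℝ) ^ m = 32 ^ m * 8 ^ m := by rw [← mul_pow]; norm_num
    have : (l * (2 * h)) ^ 3 * ω = 32768 * 8 * c * 32 ^ m * (8 ^ m * h ^ 3)
        * (l ^ 3 * (l ^ 3)⁻¹) * (ρ ^ 2)⁻¹ * y := by
      rw [hω, e256]; ring
    rw [this, hpow8, mul_inv_cancel₀ (by positivity : l ^ 3 ≠ 0)]
    ring
  set q := (F * ω ^ ((1 : ℝ) / n))⁻¹ with hq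
  have hFω : 0 < F * ω ^ ((1 : ℝ) / n) := mul_pos hF (Real.rpow_pos_of_pos hω0 _)
  have hq0 : 0 < q := inv_pos.2 hFω
  have hcs : HasCompactSupport (ballCutoff x₀ r₁) :=
    (isCompact_closedBall x₀ r₁).of_isClosed_subset (isClosed_tsupport _)
      (tsupport_ballCutoff_subset x₀ hr₁0)
  have hfk : ∀ t ∈ Icc (t₀ - r₁ ^ 2) t₀,
      q * ∫ x in V, ballCutoff x₀ r₁ x ^ 2 * max (w (x, t) - l₁) 0 ^ 3
      ≤ (∫ x in V, ballCutoff x₀ r₁ x ^ 2 * max (w (x, t) - l₁) 0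
          * ‖fderiv ℝ (fun y => w (y, t)) x‖ ^ 2)
        + ∫ x in V, max (w (x, t) - l₁) 0 ^ 3 * ‖fderiv ℝ (ballCutoff x₀ r₁) x‖ ^ 2 := by
    intro t ht
    have := hFK V O (fun x => w (x, t)) (ballCutoff x₀ r₁) l₁ ω H.isOpen_V H.isOpen_O
      (fun x hx => H.nonpos x hx t (hI₁ ht)) (H.contDiff t (hI₁ ht)) hl₁0
      (contDiff_ballCutoff x₀ r₁) hcs ((tsupport_ballCutoff_subset x₀ hr₁0).trans hB₁) hω0
      (hvol t ht)
    rw [hq, inv_mul_le_iff₀ hFω]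
    exact this
  have hstep := H.cubeMass_le_mul hΛ hK hl₁0 hr₁0 (hr₁₀.trans (hr₀ρ.trans hρR))
    (half_pos hh0) hκ₁ hr₂0.le hr₂₁ hB₁ hI₁ hq0.le hfk
  have hm1 : cubeMass V w x₀ t₀ r₁ l₁ ≤ y :=
    (H.cubeMass_mono hl₀0 hl01 hr₁0.le hr₁₀ hB₀ hI₀).trans hby
  have hm2 : cubeMass V w x₀ t₀ r₂ (l * (1 - h)) ≤ cubeMass V w x₀ t₀ r₂ l₁ :=
    H.cubeMass_mono hl₁0 (mul_le_mul_of_nonneg_left (by linarith) hl.le) hr₂0.le le_rfl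
      ((Metric.closedBall_subset_closedBall hr₂₁).trans hB₁)
      ((Icc_subset_Icc_left (sub_le_sub_left (pow_le_pow_left₀ hr₂0.le hr₂₁ 2) _)).trans hI₁)
  refine hm2.trans ?_
  have hst := hstep.trans (mul_le_mul_of_nonneg_left hm1 hc0.le)
  set X := cubeMass V w x₀ t₀ r₂ l₁ with hX
  have hX0 : 0 ≤ X := cubeMass_nonneg _ _ _ _ _ _
  have h3 : ρ ^ 2 / 4 ≤ r₁ ^ 2 := hr₁4
  have h4 : (h / 2) ^ 5 * (ρ ^ 2 / 4) * q * X ≤ c * y :=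
    (mul_le_mul_of_nonneg_right (mul_le_mul_of_nonneg_right
      (mul_le_mul_of_nonneg_left h3 (by positivity)) hq0.le) hX0).trans hst
  have h5 := mul_le_mul_of_nonneg_left h4 (by positivity :
    0 ≤ 131072 * 32 ^ m * (ρ ^ 2)⁻¹ * (F * ω ^ ((1 : ℝ) / n)))
  have h6 : 131072 * 32 ^ m * (ρ ^ 2)⁻¹ * (F * ω ^ ((1 : ℝ) / n))
      * ((h / 2) ^ 5 * (ρ ^ 2 / 4) * q * X) = X := by
    have : 131072 * 32 ^ m * (ρ ^ 2)⁻¹ * (F * ω ^ ((1 : ℝ) / n))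
      * ((h / 2) ^ 5 * (ρ ^ 2 / 4) * q * X)
      = 1024 * (32 ^ m * h ^ 5) * ((ρ ^ 2)⁻¹ * ρ ^ 2) * ((F * ω ^ ((1 : ℝ) / n)) * q) * X := by
      ring
    rw [this, hpow, inv_mul_cancel₀ hρ2.ne', hq, mul_inv_cancel₀ hFω.ne']; ring
  rw [h6] at h5
  refine h5.trans ?_
  have h7 : ω ^ ((1 : ℝ) / n) ≤ (C * 256 ^ m * (l ^ 3)⁻¹ * (ρ ^ 2)⁻¹ * y) ^ ((1 : ℝ) / n) := by
    refine Real.rpow_le_rpow hω0.le ?_ (by positivity)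
    rw [hω]
    have : 32768 * c ≤ C := by rw [hC]; linarith
    gcongr
  have h8 : 131072 * c * F ≤ C := by rw [hC]; linarith
  calc 131072 * 32 ^ m * (ρ ^ 2)⁻¹ * (F * ω ^ ((1 : ℝ) / n)) * (c * y)
      = (131072 * c * F) * 32 ^ m * (ρ ^ 2)⁻¹ * ω ^ ((1 : ℝ) / n) * y := by ring
    _ ≤ _ := by gcongr

end EnergySubsolution


namespace EnergySubsolution

/-- The ratio $2^{-26n}$ is chosen so that its $n$-th root $2^{-26}$ cancels the growth
$32^2\cdot256^2=2^{26}$ of one step. The constants contribute at most $C\cdot C$, since $C\le C^n$,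
and are cancelled by the initial smallness $(q/C^2)^n$, leaving `q`. -/
theorem deGiorgi_gain_le {n : ℕ} (hn : 1 ≤ n) {C q ρ : ℝ} (hC : 1 ≤ C) (hq : 0 < q)
    (hρ : 0 < ρ) (i : ℕ) :
    C * 32 ^ (2 * i) * (ρ ^ 2)⁻¹ *
      (C * 256 ^ (2 * i) * (ρ ^ (2 * n) * ((q / C ^ 2) ^ n * (((1 / 2) ^ (26 * n)) ^ i))))
        ^ ((1 : ℝ) / n) ≤ q := by
  have hC0 : 0 < C := by linarith
  set Z : ℝ := C * 65536 ^ i * (ρ ^ 2 * ((q / C ^ 2) * ((1 / 2) ^ 26) ^ i)) with hZ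
  have hZ0 : 0 ≤ Z := by positivity
  have h1 : C * 256 ^ (2 * i) * (ρ ^ (2 * n) * ((q / C ^ 2) ^ n * (((1 / 2) ^ (26 * n)) ^ i)))
      ≤ Z ^ n := by
    have e1 : Z ^ n = C ^ n * (65536 ^ i) ^ n *
        (ρ ^ (2 * n) * ((q / C ^ 2) ^ n * (((1 / 2) ^ (26 * n)) ^ i))) := by
      rw [hZ]
      simp only [mul_pow, ← pow_mul]
      rw [show 26 * n * i = 26 * i * n by ring]
    rw [e1]
    have e2 : (256 : ℝ) ^ (2 * i) = 65536 ^ i := by rw [pow_mul]; norm_num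
    rw [e2]
    have h2 : C ≤ C ^ n := le_self_pow₀ hC (by omega)
    have h3 : (65536 : ℝ) ^ i ≤ (65536 ^ i) ^ n :=
      le_self_pow₀ (one_le_pow₀ (by norm_num)) (by omega)
    gcongr
  have h4 := Real.rpow_le_rpow (by positivity) h1 (by positivity : (0 : ℝ) ≤ 1 / n)
  rw [one_div (n : ℝ), Real.pow_rpow_inv_natCast hZ0 (by omega)] at h4
  rw [one_div (n : ℝ)]
  refine (mul_le_mul_of_nonneg_left h4 (by positivity)).trans (le_of_eq ?_)
  have e3 : (32 : ℝ) ^ (2 * i) = 1024 ^ i := by rw [pow_mul]; norm_num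
  have e4 : (1024 : ℝ) ^ i * 65536 ^ i * ((1 / 2) ^ 26) ^ i = 1 := by
    rw [← mul_pow, ← mul_pow]; norm_num
  rw [e3, hZ]
  calc C * 1024 ^ i * (ρ ^ 2)⁻¹ * (C * 65536 ^ i * (ρ ^ 2 * (q / C ^ 2 * ((1 / 2) ^ 26) ^ i)))
      = (1024 ^ i * 65536 ^ i * ((1 / 2) ^ 26) ^ i) * ((ρ ^ 2)⁻¹ * ρ ^ 2) * (C ^ 2 / C ^ 2) * q := by
        ring
    _ = q := by
        rw [e4, inv_mul_cancel₀ (by positivity), div_self (by positivity)]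
        ring

/-- De Giorgi's local boundedness: a small `L³` norm on a cylinder bounds the value at the
centre of its top. -/
theorem exists_deGiorgi_bound {n : ℕ} (hn : 1 ≤ n) {Λ K R : ℝ} (hΛ : 0 < Λ) (hK : 0 ≤ K) :
    ∃ δ : ℝ, 0 < δ ∧ ∀ {V O : Set (Cn n)} {I : Set ℝ} {w wt γ : Cn n × ℝ → ℝ},
      EnergySubsolution Λ K V O I w wt γ → ∀ {x₀ : Cn n} {t₀ ρ l : ℝ}, 0 < ρ → ρ ≤ R → 0 < l →
      Metric.closedBall x₀ ρ ⊆ V ∪ O → Icc (t₀ - ρ ^ 2) t₀ ⊆ I → x₀ ∈ V →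
      cubeMass V w x₀ t₀ ρ 0 ≤ δ * (l ^ 3 * ρ ^ (2 * n + 2)) → w (x₀, t₀) ≤ l := by
  obtain ⟨C, hC, hstep⟩ := exists_deGiorgi_step (n := n) hn (R := R) hΛ hK
  have hC0 : 0 < C := by linarith
  set q : ℝ := (1 / 2) ^ (26 * n) with hq
  have hq0 : 0 < q := by positivity
  set δ : ℝ := (q / C ^ 2) ^ n with hδ
  have hδ0 : 0 < δ := by positivity
  refine ⟨δ, hδ0, ?_⟩
  intro V O I w wt γ H x₀ t₀ ρ l hρ hρR hl hB hI hx₀ h0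
  set y : ℕ → ℝ := fun i => l ^ 3 * ρ ^ (2 * n + 2) * (δ * q ^ i) with hy
  have hy0 : ∀ i, 0 < y i := fun i => by positivity
  have hind : ∀ i : ℕ, cubeMass V w x₀ t₀ (ρ * (1 / 2 + (1 / 2) ^ (2 * i + 1)))
      (l * (1 - (1 / 2) ^ (2 * i))) ≤ y i := by
    intro i
    induction i with
    | zero =>
      have e1 : ρ * (1 / 2 + (1 / 2) ^ (2 * 0 + 1)) = ρ := by norm_num
      have e2 : l * (1 - (1 / 2) ^ (2 * 0)) = 0 := by norm_num
      rw [e1, e2]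
      refine h0.trans (le_of_eq ?_)
      simp only [hy, pow_zero]
      ring
    | succ i ih =>
      have h1 := (hstep H hρ hρR hl hB hI (2 * i) (y i) (hy0 i) ih).2
      have e1 : 2 * (i + 1) + 1 = 2 * i + 3 := by ring
      have e2 : 2 * (i + 1) = 2 * i + 2 := by ring
      rw [e1, e2]
      refine h1.trans ?_
      have e3 : C * 256 ^ (2 * i) * (l ^ 3)⁻¹ * (ρ ^ 2)⁻¹ * y i
          = C * 256 ^ (2 * i) * (ρ ^ (2 * n) * ((q / C ^ 2) ^ n * (((1 / 2) ^ (26 * n)) ^ i))) := by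
        simp only [hy, hδ, hq]
        rw [pow_add ρ]
        have hl3 : l ^ 3 * (l ^ 3)⁻¹ = 1 := mul_inv_cancel₀ (by positivity)
        have hρ3 : ρ ^ 2 * (ρ ^ 2)⁻¹ = 1 := mul_inv_cancel₀ (by positivity)
        calc _ = C * 256 ^ (2 * i) * (ρ ^ (2 * n) * (((1 / 2) ^ (26 * n) / C ^ 2) ^ n
              * (((1 / 2) ^ (26 * n)) ^ i))) * (l ^ 3 * (l ^ 3)⁻¹) * (ρ ^ 2 * (ρ ^ 2)⁻¹) := by ring
          _ = _ := by rw [hl3, hρ3]; ring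
      rw [e3]
      refine (mul_le_mul_of_nonneg_right (deGiorgi_gain_le hn hC hq0 hρ i) (hy0 i).le).trans
        (le_of_eq ?_)
      simp only [hy, pow_succ]
      ring
  -- the top slice of the limit cylinder
  have hI0 : t₀ ∈ I := hI ⟨by nlinarith [sq_nonneg ρ], le_rfl⟩
  have hball : Metric.closedBall x₀ (ρ * (1 / 2)) ⊆ V ∪ O :=
    (Metric.closedBall_subset_closedBall (by linarith)).trans hB
  set X := ∫ x in V ∩ Metric.closedBall x₀ (ρ * (1 / 2)), max (w (x, t₀) - l) 0 ^ 3 with hX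
  have hX0 : 0 ≤ X := integral_nonneg fun x => by positivity
  have hk := H.integrableOn_cube_slice hl.le (isCompact_closedBall x₀ (ρ * (1 / 2))) hball hI0
  -- Every iterate has a larger ball and a lower level than the limit, so its top slice dominates
  -- `X`. The slice bound grows like $32^{2i}$ while the masses decay like $2^{-26ni}$, so `X` must
  -- be zero.
  have hXle : ∀ i : ℕ, X ≤ C * (ρ ^ 2)⁻¹ * (l ^ 3 * ρ ^ (2 * n + 2) * δ) * (1 / 2) ^ i := by
    intro i
    have h1 := (hstep H hρ hρR hl hB hI (2 * i) (y i) (hy0 i) (hind i)).1 t₀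
      ⟨by nlinarith [sq_nonneg (ρ * (1 / 2 + (1 / 2) ^ (2 * i + 2)))], le_rfl⟩
    have hp : ((1 : ℝ) / 2) ^ (2 * i) ≤ 1 := pow_le_one₀ (by norm_num) (by norm_num)
    have hp0 : (0 : ℝ) < (1 / 2) ^ (2 * i) := by positivity
    have hll : 0 ≤ l * (1 - (1 / 2) ^ (2 * i)) := mul_nonneg hl.le (by linarith)
    have hbb : Metric.closedBall x₀ (ρ * (1 / 2))
        ⊆ Metric.closedBall x₀ (ρ * (1 / 2 + (1 / 2) ^ (2 * i + 2))) :=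
      Metric.closedBall_subset_closedBall (mul_le_mul_of_nonneg_left (by
        have : (0 : ℝ) < (1 / 2) ^ (2 * i + 2) := by positivity
        linarith) hρ.le)
    have hbs : Metric.closedBall x₀ (ρ * (1 / 2 + (1 / 2) ^ (2 * i + 2))) ⊆ V ∪ O :=
      (Metric.closedBall_subset_closedBall (mul_le_of_le_one_right hρ.le (by
        rw [pow_add]; linarith))).trans hB
    have hk2 := H.integrableOn_cube_slice hll (isCompact_closedBall x₀ _) hbs hI0
    have hm : MeasurableSet (V ∩ Metric.closedBall x₀ (ρ * (1 / 2))) :=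
      H.isOpen_V.measurableSet.inter Metric.isClosed_closedBall.measurableSet
    have h2 : X ≤ ∫ x in V ∩ Metric.closedBall x₀ (ρ * (1 / 2 + (1 / 2) ^ (2 * i + 2))),
        max (w (x, t₀) - l * (1 - (1 / 2) ^ (2 * i))) 0 ^ 3 := by
      refine (setIntegral_mono_on hk (hk2.mono_set (inter_subset_inter_right _ hbb)) hm
        fun x _ => ?_).trans (setIntegral_mono_set hk2
          (Eventually.of_forall fun x => by positivity) (inter_subset_inter_right _ hbb).eventuallyLE)
      have : l * (1 - (1 / 2) ^ (2 * i)) ≤ l := mul_le_of_le_one_right hl.le (by linarith)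
      gcongr
    refine h2.trans (h1.trans ?_)
    have hqi : (32 : ℝ) ^ (2 * i) * q ^ i ≤ (1 / 2) ^ i := by
      rw [pow_mul, ← mul_pow]
      refine pow_le_pow_left₀ (by positivity) ?_ i
      have : q ≤ (1 / 2) ^ 26 :=
        pow_le_pow_of_le_one (by norm_num) (by norm_num) (by omega)
      calc (32 : ℝ) ^ 2 * q ≤ 32 ^ 2 * (1 / 2) ^ 26 := by gcongr
        _ ≤ 1 / 2 := by norm_num
    calc C * 32 ^ (2 * i) * (ρ ^ 2)⁻¹ * y i
        = C * (ρ ^ 2)⁻¹ * (l ^ 3 * ρ ^ (2 * n + 2) * δ) * (32 ^ (2 * i) * q ^ i) := by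
          simp only [hy]; ring
      _ ≤ _ := by gcongr
  have hXz : X = 0 := by
    refine le_antisymm ?_ hX0
    have h1 : Tendsto (fun i : ℕ => C * (ρ ^ 2)⁻¹ * (l ^ 3 * ρ ^ (2 * n + 2) * δ) * (1 / 2) ^ i)
        atTop (𝓝 (C * (ρ ^ 2)⁻¹ * (l ^ 3 * ρ ^ (2 * n + 2) * δ) * 0)) :=
      (tendsto_pow_atTop_nhds_zero_of_lt_one (by norm_num) (by norm_num)).const_mul _
    rw [mul_zero] at h1
    exact ge_of_tendsto' h1 hXle
  -- positivity on an open set would contradict the vanishing of the slice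
  by_contra hlt
  rw [not_le] at hlt
  have hc : ContinuousAt (fun x => w (x, t₀)) x₀ :=
    (continuousOn_slice H.cont hI0).continuousAt (H.isOpen_V.mem_nhds hx₀)
  have hev : ∀ᶠ x in 𝓝 x₀, x ∈ V ∩ Metric.ball x₀ (ρ * (1 / 2)) ∧ l < w (x, t₀) :=
    (Filter.Eventually.and ((H.isOpen_V.inter Metric.isOpen_ball).mem_nhds
      ⟨hx₀, Metric.mem_ball_self (by positivity)⟩) (hc.eventually (lt_mem_nhds hlt)))
  obtain ⟨U, hU, hUo, hxU⟩ := eventually_nhds_iff.1 hev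
  have hae := (setIntegral_eq_zero_iff_of_nonneg_ae
    (Eventually.of_forall fun x => by positivity) hk).1 hXz
  have hUpos : 0 < volume U := hUo.measure_pos volume ⟨x₀, hxU⟩
  have hU0 : volume U = 0 := by
    have h1 : (volume.restrict (V ∩ Metric.closedBall x₀ (ρ * (1 / 2)))) U = 0 := by
      refine measure_mono_null (fun x hx => ?_) (ae_iff.1 hae)
      have := (hU x hx).2
      change ¬ (max (w (x, t₀) - l) 0 ^ 3 = 0)
      rw [max_eq_left (by linarith)]
      have : 0 < w (x, t₀) - l := by linarith
      positivity
    have h2 : U ⊆ V ∩ Metric.closedBall x₀ (ρ * (1 / 2)) := fun x hx =>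
      ⟨(hU x hx).1.1, Metric.ball_subset_closedBall (hU x hx).1.2⟩
    rwa [Measure.restrict_eq_self _ h2] at h1
  exact hUpos.ne' hU0

end EnergySubsolution


/-! ### From the cubic estimate to the mean value inequality. -/

namespace EnergySubsolution

/-- Parabolic distance to the parabolic boundary of the cylinder `C_r(y, s)`. -/
noncomputable def boundaryDist {n : ℕ} (y : Cn n) (s r : ℝ) (p : Cn n × ℝ) : ℝ :=
  min (r - dist p.1 y) (√(p.2 - (s - r ^ 2)))

/-- In space this is the triangle inequality; in time the elapsed time is at least
$d^2-d^2/4\ge(d/2)^2$. -/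
theorem half_boundaryDist_le {n : ℕ} {y : Cn n} {s r d : ℝ} {p p' : Cn n × ℝ} (hd : 0 < d)
    (hp : d = boundaryDist y s r p) (h1 : dist p'.1 p.1 ≤ d / 2)
    (h2 : p.2 - (d / 2) ^ 2 ≤ p'.2) : d / 2 ≤ boundaryDist y s r p' := by
  have e1 : d ≤ r - dist p.1 y := hp ▸ min_le_left _ _
  have e2 : d ≤ √(p.2 - (s - r ^ 2)) := hp ▸ min_le_right _ _
  refine le_min ?_ ?_
  · have := dist_triangle p'.1 p.1 y
    linarith
  · refine Real.le_sqrt_of_sq_le ?_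
    have : d ^ 2 ≤ p.2 - (s - r ^ 2) := by
      by_contra hcon
      have h3 : √(p.2 - (s - r ^ 2)) < d := (Real.sqrt_lt' hd).2 (not_le.1 hcon)
      linarith
    nlinarith

theorem cubeMass_eq_setIntegral {n : ℕ} {Λ K : ℝ} {V O : Set (Cn n)} {I : Set ℝ}
    {w wt γ : Cn n × ℝ → ℝ}
    (H : EnergySubsolution Λ K V O I w wt γ) {x₀ : Cn n} {t₀ ρ l : ℝ} (hl : 0 ≤ l)
    (hB : Metric.closedBall x₀ ρ ⊆ V ∪ O) (hI : Icc (t₀ - ρ ^ 2) t₀ ⊆ I) :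
    cubeMass V w x₀ t₀ ρ l = ∫ p in (V ∩ Metric.closedBall x₀ ρ) ×ˢ Ioc (t₀ - ρ ^ 2) t₀,
      max (w p - l) 0 ^ 3 := by
  have hk := H.integrableOn_cube_prod hl (isCompact_closedBall x₀ ρ) hB hI
  unfold IntegrableOn at hk
  rw [restrict_prod_eq] at hk ⊢
  rw [integral_prod_symm _ hk]
  unfold cubeMass
  rw [intervalIntegral.integral_of_le (by nlinarith [sq_nonneg ρ])]

/-- The `L¹` mean value inequality for energy subsolutions. -/
theorem exists_mean_value {n : ℕ} (hn : 1 ≤ n) {Λ K R : ℝ} (hΛ : 0 < Λ) (hK : 0 ≤ K) :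
    ∃ N : ℝ, 0 < N ∧ ∀ {V O : Set (Cn n)} {w wt γ : Cn n × ℝ → ℝ} {y : Cn n} {s r : ℝ},
      EnergySubsolution Λ K V O (Ioc (s - r ^ 2) s) w wt γ → 0 < r → r ≤ R →
      Metric.ball y r ⊆ V ∪ O → V ⊆ Metric.ball y r → y ∈ V →
      (∃ M : ℝ, ∀ x ∈ V, ∀ t ∈ Ioc (s - r ^ 2) s, w (x, t) ≤ M) →
      w (y, s) * r ^ (2 * n + 2) ≤ N * ∫ p in V ×ˢ Ioc (s - r ^ 2) s, max (w p) 0 := by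
  obtain ⟨δ, hδ, hdg⟩ := exists_deGiorgi_bound (n := n) hn (R := R) hΛ hK
  set m := 2 * n + 2 with hm
  -- A factor $2^m$ because the boundary distance may halve on the cylinder around `P`, and a factor
  -- $2$ because `P` is only within a factor two of the supremum.
  set A : ℝ := 2 ^ (m + 1) with hA
  refine ⟨A * (8 * A ^ 2 / δ), by positivity, ?_⟩
  intro V O w wt γ y s r H hr hrR hball hV hyV hbdd
  obtain ⟨M₀, hM₀⟩ := hbdd
  set I := Ioc (s - r ^ 2) s with hI
  set J := ∫ p in V ×ˢ I, max (w p) 0 with hJ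
  have hVm : MeasurableSet V := H.isOpen_V.measurableSet
  have hQm : MeasurableSet (V ×ˢ I) := hVm.prod measurableSet_Ioc
  have hJ0 : 0 ≤ J := integral_nonneg fun p => le_max_right _ _
  have hint : IntegrableOn (fun p => max (w p) 0) (V ×ˢ I) := by
    have hfin : volume (V ×ˢ I) < ∞ := by
      refine lt_of_le_of_lt (measure_mono (prod_mono hV Subset.rfl)) ?_
      rw [Measure.volume_eq_prod, Measure.prod_prod]
      exact ENNReal.mul_lt_top measure_ball_lt_top measure_Ioc_lt_top
    refine IntegrableOn.of_bound hfin ((H.cont.sup continuousOn_const).aestronglyMeasurable hQm)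
      (max M₀ 0) ?_
    refine (ae_restrict_iff' hQm).2 (Eventually.of_forall fun p hp => ?_)
    rw [Real.norm_eq_abs, abs_of_nonneg (le_max_right _ _)]
    exact max_le_max (hM₀ p.1 hp.1 p.2 hp.2) le_rfl
  by_cases hpos : w (y, s) ≤ 0
  · exact (mul_nonpos_of_nonpos_of_nonneg hpos (by positivity)).trans (by positivity)
  rw [not_le] at hpos
  have hsI : s ∈ I := ⟨by nlinarith [sq_pos_of_pos hr], le_rfl⟩
  set d := boundaryDist y s r with hd
  set F : Cn n × ℝ → ℝ := fun p => d p ^ m * max (w p) 0 with hF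
  have hdr : ∀ p, d p ≤ r := fun p => (min_le_left _ _).trans (by linarith [dist_nonneg (x := p.1) (y := y)])
  have hdpos : ∀ p ∈ V ×ˢ I, 0 < d p := by
    rintro p ⟨hp1, hp2⟩
    refine lt_min ?_ (Real.sqrt_pos.2 (by linarith [hp2.1]))
    have := Metric.mem_ball.1 (hV hp1)
    linarith
  have hdY : d (y, s) = r := by
    simp only [hd, boundaryDist, dist_self, sub_zero, sub_sub_cancel, Real.sqrt_sq hr.le, min_self]
  have hbA : BddAbove (F '' (V ×ˢ I)) := by
    refine ⟨r ^ m * max M₀ 0, ?_⟩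
    rintro _ ⟨p, hp, rfl⟩
    exact mul_le_mul (pow_le_pow_left₀ (hdpos p hp).le (hdr p) m)
      (max_le_max (hM₀ p.1 hp.1 p.2 hp.2) le_rfl) (le_max_right _ _) (by positivity)
  set S := sSup (F '' (V ×ˢ I)) with hS
  have hYmem : (y, s) ∈ V ×ˢ I := ⟨hyV, hsI⟩
  have hFY : F (y, s) = r ^ m * w (y, s) := by
    simp only [hF, hdY, max_eq_left hpos.le]
  have hFS : F (y, s) ≤ S := le_csSup hbA ⟨_, hYmem, rfl⟩
  have hS0 : 0 < S := lt_of_lt_of_le (by rw [hFY]; positivity) hFS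
  -- The supremum need not be attained on the noncompact set `V ×ˢ I`; a point above half of it
  -- suffices. Boundedness of `w` makes the supremum finite.
  obtain ⟨_, ⟨P, hP, rfl⟩, hPS⟩ := exists_lt_of_lt_csSup
    (show (F '' (V ×ˢ I)).Nonempty from ⟨_, ⟨_, hYmem, rfl⟩⟩)
    (show S / 2 < sSup (F '' (V ×ˢ I)) by linarith)
  have hdP := hdpos P hP
  have hwP : 0 < w P := by
    by_contra hcon
    have : F P = 0 := by simp only [hF, max_eq_right (not_lt.1 hcon), mul_zero]
    linarith
  have hFP : F P = d P ^ m * w P := by simp only [hF, max_eq_left hwP.le]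
  set ρ := d P / 2 with hρ
  have hρ0 : 0 < ρ := by positivity
  have hnear : ∀ p ∈ V ×ˢ I, dist p.1 P.1 ≤ ρ → P.2 - ρ ^ 2 ≤ p.2 → max (w p) 0 ≤ A * w P := by
    intro p hp h1 h2
    have hdp := half_boundaryDist_le hdP rfl h1 h2
    have h3 : F p ≤ S := le_csSup hbA ⟨p, hp, rfl⟩
    have h4 : ρ ^ m * max (w p) 0 ≤ F p :=
      mul_le_mul_of_nonneg_right (pow_le_pow_left₀ hρ0.le hdp m) (le_max_right _ _)
    have h5 : ρ ^ m * max (w p) 0 ≤ ρ ^ m * (A * w P) := by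
      have e : ρ ^ m * (A * w P) = 2 * F P := by
        rw [hFP, hρ, hA, div_pow, pow_succ]; field_simp; ring
      rw [e]; linarith
    exact le_of_mul_le_mul_left h5 (by positivity)
  have hballP : Metric.closedBall P.1 ρ ⊆ Metric.ball y r := by
    intro x hx
    have h1 : d P ≤ r - dist P.1 y := min_le_left _ _
    have h2 := dist_triangle x P.1 y
    rw [Metric.mem_closedBall] at hx
    rw [Metric.mem_ball]
    linarith
  have hIP : Icc (P.2 - ρ ^ 2) P.2 ⊆ I := by
    intro t ht
    have h1 := half_boundaryDist_le (p' := (P.1, t)) hdP rfl (by simp; positivity) ht.1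
    have h2 : 0 < √(t - (s - r ^ 2)) := lt_of_lt_of_le hρ0 (h1.trans (min_le_right _ _))
    exact ⟨by linarith [Real.sqrt_pos.1 h2], ht.2.trans hP.2.2⟩
  -- Two of the three powers of $w_+$ are replaced by the local bound $A\,w(P)$; the remaining one
  -- is integrated, which is how $L^1$ appears.
  have hcube : cubeMass V w P.1 P.2 ρ 0 ≤ (A * w P) ^ 2 * J := by
    rw [H.cubeMass_eq_setIntegral le_rfl (hballP.trans hball) hIP]
    have hsub : (V ∩ Metric.closedBall P.1 ρ) ×ˢ Ioc (P.2 - ρ ^ 2) P.2 ⊆ V ×ˢ I :=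
      prod_mono inter_subset_left (Ioc_subset_Icc_self.trans hIP)
    have hk := H.integrableOn_cube_prod le_rfl (isCompact_closedBall P.1 ρ)
      (hballP.trans hball) hIP
    have hmeas : MeasurableSet ((V ∩ Metric.closedBall P.1 ρ) ×ˢ Ioc (P.2 - ρ ^ 2) P.2) :=
      (hVm.inter Metric.isClosed_closedBall.measurableSet).prod measurableSet_Ioc
    calc _ ≤ ∫ p in (V ∩ Metric.closedBall P.1 ρ) ×ˢ Ioc (P.2 - ρ ^ 2) P.2,
          (A * w P) ^ 2 * max (w p) 0 := by
          refine setIntegral_mono_on hk ((hint.mono_set hsub).const_mul _) hmeas fun p hp => ?_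
          have h1 := hnear p (hsub hp) hp.1.2 hp.2.1.le
          have h0 : 0 ≤ max (w p) 0 := le_max_right _ _
          rw [sub_zero, pow_succ]
          exact mul_le_mul_of_nonneg_right (pow_le_pow_left₀ h0 h1 2) h0
      _ ≤ ∫ p in V ×ˢ I, (A * w P) ^ 2 * max (w p) 0 :=
          setIntegral_mono_set (hint.const_mul _)
            (Eventually.of_forall fun p => by positivity) hsub.eventuallyLE
      _ = _ := by rw [integral_const_mul]
  -- The De Giorgi bound at level $w(P)/2$, in contrapositive form: if the mass were smaller, then
  -- $w(P)\le w(P)/2$, although $w(P)>0$.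
  have hlow : δ * ((w P / 2) ^ 3 * ρ ^ m) ≤ cubeMass V w P.1 P.2 ρ 0 := by
    by_contra hcon
    have := hdg H hρ0 (by linarith [hdr P]) (half_pos hwP) (hballP.trans hball) hIP hP.1
      (not_le.1 hcon).le
    change w P ≤ w P / 2 at this
    linarith
  have h1 : δ * ((w P / 2) ^ 3 * ρ ^ m) ≤ (A * w P) ^ 2 * J := hlow.trans hcube
  have h2 : w P * ρ ^ m ≤ 8 * A ^ 2 / δ * J := by
    have h3 : 0 < w P ^ 2 * δ / 8 := by positivity
    refine le_of_mul_le_mul_left ?_ h3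
    have e1 : w P ^ 2 * δ / 8 * (w P * ρ ^ m) = δ * ((w P / 2) ^ 3 * ρ ^ m) := by ring
    have e2 : w P ^ 2 * δ / 8 * (8 * A ^ 2 / δ * J) = (A * w P) ^ 2 * J := by
      field_simp
    rw [e1, e2]
    exact h1
  calc w (y, s) * r ^ m = F (y, s) := by rw [hFY]; ring
    _ ≤ 2 * F P := by linarith
    _ = A * (w P * ρ ^ m) := by
        rw [hFP, hρ, hA, div_pow, pow_succ]; field_simp; ring
    _ ≤ A * (8 * A ^ 2 / δ * J) := by gcongr
    _ = A * (8 * A ^ 2 / δ) * J := by ring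

end EnergySubsolution


/-! ### The polar radius -/

/-- The derivative of the polar radius. -/
noncomputable def polarDensity (β ε τ : ℝ) : ℝ := β / (τ ^ 2 + ε ^ 2) ^ ((1 - β) / 2)

theorem polarDensity_pos {β ε τ : ℝ} (hβ : 0 < β) (hτ : 0 < τ) : 0 < polarDensity β ε τ := by
  unfold polarDensity
  have : 0 < τ ^ 2 + ε ^ 2 := by positivity
  positivity

theorem polarDensity_sq {β ε τ : ℝ} :
    polarDensity β ε τ ^ 2 = β ^ 2 / (τ ^ 2 + ε ^ 2) ^ (1 - β) := by
  unfold polarDensity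
  rw [div_pow, ← Real.rpow_natCast ((τ ^ 2 + ε ^ 2) ^ ((1 - β) / 2)), ← Real.rpow_mul (by positivity)]
  congr 2
  push_cast
  ring

theorem polarDensity_antitone {β ε τ ρ : ℝ} (hβ : 0 < β) (hβ1 : β ≤ 1) (hτ : 0 < τ)
    (hρ : τ ≤ ρ) : polarDensity β ε ρ ≤ polarDensity β ε τ := by
  unfold polarDensity
  have : 0 < τ ^ 2 + ε ^ 2 := by positivity
  refine div_le_div_of_nonneg_left hβ.le (by positivity) ?_
  exact Real.rpow_le_rpow this.le (by gcongr) (by linarith)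

/-- The product $\tau^{1-\beta}$ times the density is
$\beta\,(\tau^2/(\tau^2+\epsilon^2))^{(1-\beta)/2}$, which is nondecreasing in $\tau$. The bound is
uniform in $\epsilon$ and has an integrable singularity at $0$. -/
theorem polarDensity_le {β ε τ ρ : ℝ} (hβ : 0 < β) (hβ1 : β ≤ 1) (hτ : 0 < τ)
    (hρ : τ ≤ ρ) : polarDensity β ε τ ≤ polarDensity β ε ρ * ρ ^ (1 - β) * τ ^ (β - 1) := by
  have hρ0 : 0 < ρ := hτ.trans_le hρ
  have h1 : 0 < τ ^ 2 + ε ^ 2 := by positivity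
  have h2 : 0 < ρ ^ 2 + ε ^ 2 := by positivity
  have key : (ρ ^ 2 + ε ^ 2) ^ ((1 - β) / 2) * τ ^ (1 - β) ≤
      (τ ^ 2 + ε ^ 2) ^ ((1 - β) / 2) * ρ ^ (1 - β) := by
    have e : ∀ x : ℝ, 0 < x → x ^ (1 - β) = (x ^ 2) ^ ((1 - β) / 2) := fun x hx => by
      rw [← Real.rpow_natCast, ← Real.rpow_mul hx.le]
      congr 1
      push_cast
      ring
    rw [e τ hτ, e ρ hρ0, ← Real.mul_rpow h2.le (by positivity),
      ← Real.mul_rpow h1.le (by positivity)]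
    refine Real.rpow_le_rpow (by positivity) ?_ (by linarith)
    have : τ ^ 2 ≤ ρ ^ 2 := by gcongr
    nlinarith [sq_nonneg ε]
  unfold polarDensity
  have e2 : τ ^ (β - 1) = (τ ^ (1 - β))⁻¹ := by
    rw [← Real.rpow_neg hτ.le]
    congr 1
    ring
  rw [e2, div_mul_eq_mul_div, ← div_eq_mul_inv, div_div, div_le_div_iff₀ (by positivity)
    (by positivity)]
  nlinarith [mul_le_mul_of_nonneg_left key hβ.le]

theorem contDiffAt_polarDensity {β ε τ : ℝ} {m : WithTop ℕ∞} (hτ : 0 < τ) :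
    ContDiffAt ℝ m (polarDensity β ε) τ := by
  unfold polarDensity
  have h1 : 0 < τ ^ 2 + ε ^ 2 := by positivity
  refine contDiffAt_const.div (ContDiffAt.rpow_const_of_ne ?_ h1.ne') (by positivity)
  fun_prop

theorem measurable_polarDensity {β ε : ℝ} : Measurable (polarDensity β ε) := by
  unfold polarDensity
  fun_prop

theorem intervalIntegrable_polarDensity {β ε ρ : ℝ} (hβ : 0 < β) (hβ1 : β ≤ 1) (hρ : 0 < ρ) :
    IntervalIntegrable (polarDensity β ε) volume 0 ρ := by
  have h := ((intervalIntegral.intervalIntegrable_rpow' (a := 0) (b := ρ) (r := β - 1)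
    (by linarith)).const_mul (polarDensity β ε ρ * ρ ^ (1 - β)))
  refine h.mono_fun measurable_polarDensity.aestronglyMeasurable ?_
  rw [uIoc_of_le hρ.le]
  refine (ae_restrict_iff' measurableSet_Ioc).2 (ae_of_all _ fun τ hτ => ?_)
  change ‖polarDensity β ε τ‖ ≤ ‖polarDensity β ε ρ * ρ ^ (1 - β) * τ ^ (β - 1)‖
  rw [Real.norm_of_nonneg (polarDensity_pos hβ hτ.1).le, Real.norm_of_nonneg]
  · exact polarDensity_le hβ hβ1 hτ.1 hτ.2
  · have := polarDensity_pos (ε := ε) hβ hρ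
    have := hτ.1
    positivity

theorem hasDerivAt_polarRadius {β ε ρ : ℝ} (hβ : 0 < β) (hβ1 : β ≤ 1) (hρ : 0 < ρ) :
    HasDerivAt (polarRadius β ε) (polarDensity β ε ρ) ρ :=
  intervalIntegral.integral_hasDerivAt_right (intervalIntegrable_polarDensity hβ hβ1 hρ)
    (measurable_polarDensity.stronglyMeasurable.stronglyMeasurableAtFilter)
    (contDiffAt_polarDensity (m := 0) hρ).continuousAt

theorem contDiffAt_polarRadius {β ε ρ : ℝ} (hβ : 0 < β) (hβ1 : β ≤ 1) (hρ : 0 < ρ) :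
    ContDiffAt ℝ 2 (polarRadius β ε) ρ := by
  have h : ContDiffOn ℝ (1 + 1) (polarRadius β ε) (Ioi 0) := by
    rw [contDiffOn_succ_iff_deriv_of_isOpen isOpen_Ioi]
    refine ⟨fun x hx => (hasDerivAt_polarRadius hβ hβ1 hx).differentiableAt.differentiableWithinAt,
      by simp, ?_⟩
    refine ContDiffOn.congr (f := polarDensity β ε)
      (fun x hx => (contDiffAt_polarDensity hx).contDiffWithinAt) ?_
    exact fun x hx => (hasDerivAt_polarRadius hβ hβ1 hx).deriv
  have := h.contDiffAt (Ioi_mem_nhds hρ)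
  rwa [one_add_one_eq_two] at this

theorem mul_polarDensity_le_polarRadius {β ε ρ : ℝ} (hβ : 0 < β) (hβ1 : β ≤ 1) (hρ : 0 < ρ) :
    ρ * polarDensity β ε ρ ≤ polarRadius β ε ρ := by
  have h := intervalIntegral.integral_mono_on_of_le_Ioo (μ := volume) hρ.le
    (intervalIntegrable_const (c := polarDensity β ε ρ))
    (intervalIntegrable_polarDensity (ε := ε) hβ hβ1 hρ)
    (fun x hx => polarDensity_antitone hβ hβ1 hx.1 hx.2.le)
  rw [intervalIntegral.integral_const, sub_zero, smul_eq_mul] at h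
  exact h

/-- Integrating $\tau^{\beta-1}$ in `polarDensity_le` costs exactly $1/\beta$. Together with
`mul_polarDensity_le_polarRadius`, which uses that the density is nonincreasing, this makes radial
and tangential stretching comparable for every $\epsilon$. -/
theorem polarRadius_le {β ε ρ : ℝ} (hβ : 0 < β) (hβ1 : β ≤ 1) (hρ : 0 < ρ) :
    polarRadius β ε ρ ≤ ρ * (polarDensity β ε ρ / β) := by
  have h := intervalIntegral.integral_mono_on_of_le_Ioo (μ := volume) hρ.le
    (intervalIntegrable_polarDensity (ε := ε) hβ hβ1 hρ)
    ((intervalIntegral.intervalIntegrable_rpow' (a := 0) (b := ρ) (r := β - 1)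
    (by linarith)).const_mul (polarDensity β ε ρ * ρ ^ (1 - β)))
    (fun x hx => polarDensity_le hβ hβ1 hx.1 hx.2.le)
  rw [intervalIntegral.integral_const_mul, integral_rpow (Or.inl (by linarith)), sub_add_cancel,
    Real.zero_rpow hβ.ne', sub_zero] at h
  refine (show polarRadius β ε ρ ≤ _ from h).trans_eq ?_
  have e : ρ ^ (1 - β) * ρ ^ β = ρ := by
    rw [← Real.rpow_add hρ, sub_add_cancel, Real.rpow_one]
  calc _ = polarDensity β ε ρ * (ρ ^ (1 - β) * ρ ^ β) / β := by ring
    _ = _ := by rw [e]; ring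

theorem polarRadius_pos {β ε ρ : ℝ} (hβ : 0 < β) (hβ1 : β ≤ 1) (hρ : 0 < ρ) :
    0 < polarRadius β ε ρ :=
  (mul_pos hρ (polarDensity_pos hβ hρ)).trans_le (mul_polarDensity_le_polarRadius hβ hβ1 hρ)

theorem strictMonoOn_polarRadius {β ε : ℝ} (hβ : 0 < β) (hβ1 : β ≤ 1) :
    StrictMonoOn (polarRadius β ε) (Ioi 0) := by
  refine strictMonoOn_of_deriv_pos (convex_Ioi 0)
    (fun x hx => (hasDerivAt_polarRadius hβ hβ1 hx).continuousAt.continuousWithinAt) ?_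
  intro x hx
  rw [interior_Ioi] at hx
  rw [(hasDerivAt_polarRadius hβ hβ1 hx).deriv]
  exact polarDensity_pos hβ hx

/-- The intermediate value theorem on $(0,\infty)$: the radius is at most $\rho^\beta$, and for
$\rho\ge1$ it is at least $\frac\beta2\rho^\beta$, where $\epsilon\le1$ is used. -/
theorem exists_polarRadius_eq {β ε a : ℝ} (hβ : 0 < β) (hβ1 : β ≤ 1) (hε : 0 ≤ ε) (hε1 : ε ≤ 1)
    (ha : 0 < a) : ∃ ρ, 0 < ρ ∧ polarRadius β ε ρ = a := by
  have hcont : ContinuousOn (polarRadius β ε) (Ioi 0) :=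
    fun x hx => (hasDerivAt_polarRadius hβ hβ1 hx).continuousAt.continuousWithinAt
  have e : ∀ x : ℝ, 0 < x → (x ^ 2) ^ ((1 - β) / 2) = x ^ (1 - β) := fun x hx => by
    rw [← Real.rpow_natCast, ← Real.rpow_mul hx.le]
    congr 1
    push_cast
    ring
  have e' : ∀ x : ℝ, 0 < x → x / x ^ (1 - β) = x ^ β := fun x hx => by
    rw [div_eq_iff (by positivity), ← Real.rpow_add hx, add_sub_cancel, Real.rpow_one]
  have hlow : Tendsto (polarRadius β ε) (𝓝[>] 0) (𝓝 0) := by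
    have h1 : Tendsto (fun x : ℝ => x ^ β) (𝓝[>] 0) (𝓝 0) := by
      have := (Real.continuousAt_rpow_const 0 β (Or.inr hβ.le)).tendsto
      rw [Real.zero_rpow hβ.ne'] at this
      exact this.mono_left nhdsWithin_le_nhds
    refine squeeze_zero' ?_ ?_ h1
    · filter_upwards [self_mem_nhdsWithin] with x hx using (polarRadius_pos hβ hβ1 hx).le
    · filter_upwards [self_mem_nhdsWithin] with x hx
      have hx : 0 < x := hx
      refine (polarRadius_le hβ hβ1 hx).trans ?_
      have h2 : polarDensity β ε x / β ≤ 1 / x ^ (1 - β) := by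
        unfold polarDensity
        rw [div_right_comm, div_self hβ.ne', ← e x hx]
        refine div_le_div_of_nonneg_left zero_le_one (by positivity) ?_
        exact Real.rpow_le_rpow (by positivity) (by nlinarith [sq_nonneg ε]) (by linarith)
      calc _ ≤ x * (1 / x ^ (1 - β)) := by gcongr
        _ = x ^ β := by rw [mul_one_div, e' x hx]
  have hhigh : Tendsto (polarRadius β ε) atTop atTop := by
    have h1 : Tendsto (fun x : ℝ => β / 2 * x ^ β) atTop atTop :=
      (tendsto_rpow_atTop hβ).const_mul_atTop (by positivity)
    refine tendsto_atTop_mono' _ ?_ h1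
    filter_upwards [eventually_ge_atTop 1] with x hx
    have hx0 : 0 < x := by linarith
    refine le_trans ?_ (mul_polarDensity_le_polarRadius hβ hβ1 hx0)
    have h3 : (x ^ 2 + ε ^ 2) ^ ((1 - β) / 2) ≤ 2 * x ^ (1 - β) := by
      calc (x ^ 2 + ε ^ 2) ^ ((1 - β) / 2) ≤ (2 * x ^ 2) ^ ((1 - β) / 2) :=
            Real.rpow_le_rpow (by positivity) (by nlinarith) (by linarith)
        _ = 2 ^ ((1 - β) / 2) * x ^ (1 - β) := by
            rw [Real.mul_rpow (by positivity) (by positivity), e x hx0]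
        _ ≤ 2 * x ^ (1 - β) := by
            gcongr
            exact (Real.rpow_le_rpow_of_exponent_le one_le_two (by linarith)).trans_eq
              (Real.rpow_one 2)
    calc β / 2 * x ^ β = x * (β / (2 * x ^ (1 - β))) := by
          rw [← e' x hx0]
          field_simp
      _ ≤ x * polarDensity β ε x := by
          unfold polarDensity
          gcongr
  obtain ⟨ρ, hρ, h⟩ := isPreconnected_Ioi.intermediate_value_Ioi (l₁ := 𝓝[>] (0 : ℝ))
    (l₂ := atTop) (inf_le_right) (le_principal_iff.2 (Ioi_mem_atTop 0)) hcont hlow hhigh ha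
  exact ⟨ρ, hρ, h⟩

theorem polarRadius_one {ε ρ : ℝ} : polarRadius 1 ε ρ = ρ := by
  simp [polarRadius]

/-! ### The polar coordinate on `ℂ` -/

/-- The map `z ↦ s(|z|) z / |z|`. -/
noncomputable def polarCoord (β ε : ℝ) (z : ℂ) : ℂ :=
  ((polarRadius β ε ‖z‖ / ‖z‖ : ℝ) : ℂ) * z

/-- Coordinates outside the conic range are treated as having cone angle `1`, for which the polar
coordinate is the identity, also at $0$. The alternative `z ≠ 0 ∨ β = 1` below therefore covers all
coordinates of a point off the divisor. -/
theorem polarCoord_one {ε : ℝ} : polarCoord 1 ε = id := by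
  funext z
  rcases eq_or_ne z 0 with rfl | hz
  · simp [polarCoord]
  · simp [polarCoord, polarRadius_one, div_self (norm_ne_zero_iff.2 hz)]

theorem norm_polarCoord {β ε : ℝ} {z : ℂ} (hβ : 0 < β) (hβ1 : β ≤ 1) (hz : z ≠ 0) :
    ‖polarCoord β ε z‖ = polarRadius β ε ‖z‖ := by
  have h0 := norm_pos_iff.2 hz
  have h1 := polarRadius_pos (ε := ε) hβ hβ1 h0
  rw [polarCoord, norm_mul, Complex.norm_real, Real.norm_of_nonneg (by positivity),
    div_mul_cancel₀ _ h0.ne']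

theorem injOn_polarCoord {β ε : ℝ} (hβ : 0 < β) (hβ1 : β ≤ 1) :
    InjOn (polarCoord β ε) {z | z ≠ 0 ∨ β = 1} := by
  rcases eq_or_ne β 1 with rfl | hne
  · rw [polarCoord_one]
    exact Function.injective_id.injOn
  intro z hz w hw h
  have hz : z ≠ 0 := hz.resolve_right hne
  have hw : w ≠ 0 := hw.resolve_right hne
  have h1 : ‖z‖ = ‖w‖ := by
    refine (strictMonoOn_polarRadius (ε := ε) hβ hβ1).injOn (norm_pos_iff.2 hz)
      (norm_pos_iff.2 hw) ?_
    rw [← norm_polarCoord hβ hβ1 hz, h, norm_polarCoord hβ hβ1 hw]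
  unfold polarCoord at h
  rw [h1] at h
  refine mul_left_cancel₀ ?_ h
  have := polarRadius_pos (ε := ε) hβ hβ1 (norm_pos_iff.2 hw)
  have := norm_pos_iff.2 hw
  exact Complex.ofReal_ne_zero.2 (by positivity)

theorem exists_polarCoord_eq {β ε : ℝ} (hβ : 0 < β) (hβ1 : β ≤ 1) (hε : 0 ≤ ε) (hε1 : ε ≤ 1)
    {ξ : ℂ} (hξ : ξ ≠ 0 ∨ β = 1) : ∃ z, polarCoord β ε z = ξ := by
  rcases eq_or_ne β 1 with rfl | hne
  · exact ⟨ξ, by rw [polarCoord_one, id]⟩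
  have hξ : ξ ≠ 0 := hξ.resolve_right hne
  have h0 := norm_pos_iff.2 hξ
  obtain ⟨ρ, hρ, h⟩ := exists_polarRadius_eq hβ hβ1 hε hε1 h0
  have hn : ‖((ρ / ‖ξ‖ : ℝ) : ℂ) * ξ‖ = ρ := by
    rw [norm_mul, Complex.norm_real, Real.norm_of_nonneg (by positivity), div_mul_cancel₀ _ h0.ne']
  refine ⟨((ρ / ‖ξ‖ : ℝ) : ℂ) * ξ, ?_⟩
  rw [polarCoord, hn, h, ← mul_assoc, ← Complex.ofReal_mul, div_mul_div_cancel₀ hρ.ne',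
    div_self h0.ne', Complex.ofReal_one, one_mul]

theorem contDiffAt_polarCoord {β ε : ℝ} (hβ : 0 < β) (hβ1 : β ≤ 1) {z : ℂ} (hz : z ≠ 0 ∨ β = 1) :
    ContDiffAt ℝ 2 (polarCoord β ε) z := by
  rcases eq_or_ne β 1 with rfl | hne
  · rw [polarCoord_one]
    exact contDiffAt_id
  have hz : z ≠ 0 := hz.resolve_right hne
  have h0 := norm_pos_iff.2 hz
  have hnorm : ContDiffAt ℝ 2 (fun z : ℂ => ‖z‖) z := contDiffAt_norm ℝ hz
  have h1 : ContDiffAt ℝ 2 (fun z : ℂ => polarRadius β ε ‖z‖ / ‖z‖) z :=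
    ((contDiffAt_polarRadius hβ hβ1 h0).comp z hnorm).div hnorm h0.ne'
  exact (Complex.ofRealCLM.contDiff.contDiffAt.comp z h1).mul contDiffAt_id

theorem hasFDerivAt_norm_complex {z : ℂ} (hz : z ≠ 0) :
    HasFDerivAt (fun z : ℂ => ‖z‖)
      ((z.re / ‖z‖) • Complex.reCLM + (z.im / ‖z‖) • Complex.imCLM) z := by
  have h0 := norm_pos_iff.2 hz
  have h1 : HasFDerivAt (fun z : ℂ => z.re ^ 2 + z.im ^ 2)
      ((2 * z.re) • Complex.reCLM + (2 * z.im) • Complex.imCLM) z := by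
    have a := (Complex.reCLM.hasFDerivAt (x := z)).pow 2
    have b := (Complex.imCLM.hasFDerivAt (x := z)).pow 2
    refine (a.add b).congr_fderiv ?_
    ext <;> simp
  have e : ∀ z : ℂ, ‖z‖ = √(z.re ^ 2 + z.im ^ 2) := fun z => by
    rw [Complex.norm_def, Complex.normSq_apply]; ring_nf
  have hne : z.re ^ 2 + z.im ^ 2 ≠ 0 := by
    intro h
    rw [e z, h, Real.sqrt_zero] at h0
    exact h0.false
  have h2 := h1.sqrt hne
  rw [← e z] at h2
  simp only [← e] at h2
  refine h2.congr_fderiv ?_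
  ext <;> simp <;> field_simp

theorem fderiv_polarCoord_apply {β ε : ℝ} (hβ : 0 < β) (hβ1 : β ≤ 1) {z : ℂ} (hz : z ≠ 0) (v : ℂ) :
    fderiv ℝ (polarCoord β ε) z v = ((polarRadius β ε ‖z‖ / ‖z‖ : ℝ) : ℂ) * v
      + (((polarDensity β ε ‖z‖ - polarRadius β ε ‖z‖ / ‖z‖)
        * (z.re / ‖z‖ * v.re + z.im / ‖z‖ * v.im) / ‖z‖ : ℝ) : ℂ) * z := by
  have h0 := norm_pos_iff.2 hz
  have h1 := ((hasDerivAt_polarRadius (ε := ε) hβ hβ1 h0).div (hasDerivAt_id _) h0.ne').comp_hasFDerivAt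
    z (hasFDerivAt_norm_complex hz)
  have h2 := (Complex.ofRealCLM.hasFDerivAt.comp z h1).mul (hasFDerivAt_id (𝕜 := ℝ) z)
  have h3 : HasFDerivAt (polarCoord β ε) _ z := h2
  rw [h3.fderiv]
  simp only [add_apply, smul_apply,
    ContinuousLinearMap.comp_apply, Function.comp, Pi.div_apply, id, smul_eq_mul,
    Complex.ofRealCLM_apply, ContinuousLinearMap.id_apply, Complex.reCLM_apply, Complex.imCLM_apply]
  congr 1
  rw [mul_comm z]
  congr 2
  field_simp

/-- A radial map stretches radial directions by $b$ and tangential ones by $q=s/\rho$, and $b\le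
q\le b/\beta$. -/
theorem norm_fderiv_polarCoord {β ε : ℝ} (hβ : 0 < β) (hβ1 : β ≤ 1) {z : ℂ} (hz : z ≠ 0 ∨ β = 1)
    (v : ℂ) :
    polarDensity β ε ‖z‖ * ‖v‖ ≤ ‖fderiv ℝ (polarCoord β ε) z v‖ ∧
      ‖fderiv ℝ (polarCoord β ε) z v‖ ≤ polarDensity β ε ‖z‖ / β * ‖v‖ := by
  rcases eq_or_ne β 1 with rfl | hne
  · simp [polarCoord_one, polarDensity]
  have hz : z ≠ 0 := hz.resolve_right hne
  have h0 := norm_pos_iff.2 hz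
  set b := polarDensity β ε ‖z‖ with hb
  set q := polarRadius β ε ‖z‖ / ‖z‖ with hq
  have hb0 : 0 < b := polarDensity_pos hβ h0
  have hbq : b ≤ q := by
    rw [hq, le_div_iff₀ h0, mul_comm]
    exact mul_polarDensity_le_polarRadius hβ hβ1 h0
  have hqb : q ≤ b / β := by
    rw [hq, div_le_iff₀ h0, mul_comm]
    exact polarRadius_le hβ hβ1 h0
  set c := z.re / ‖z‖ with hc
  set d := z.im / ‖z‖ with hd
  have hcd : c ^ 2 + d ^ 2 = 1 := by
    rw [hc, hd, div_pow, div_pow, ← add_div, Complex.sq_norm, Complex.normSq_apply, ← sq, ← sq,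
      div_self]
    have := pow_ne_zero 2 h0.ne'
    rwa [Complex.sq_norm, Complex.normSq_apply, ← sq, ← sq] at this
  -- The radial component of `v` is $c\,v_1+d\,v_2$; it is stretched by `b` and its orthogonal
  -- complement by `q`.
  have hsq : ‖fderiv ℝ (polarCoord β ε) z v‖ ^ 2
      = q ^ 2 * ‖v‖ ^ 2 - (q ^ 2 - b ^ 2) * (c * v.re + d * v.im) ^ 2 := by
    rw [fderiv_polarCoord_apply hβ hβ1 hz, ← hb, ← hq, ← hc, ← hd, Complex.sq_norm,
      Complex.sq_norm, Complex.normSq_apply, Complex.normSq_apply]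
    simp only [Complex.add_re, Complex.add_im, Complex.re_ofReal_mul, Complex.im_ofReal_mul]
    have e1 : (b - q) * (c * v.re + d * v.im) / ‖z‖ * z.re
      = (b - q) * (c * v.re + d * v.im) * c := by rw [hc]; ring
    have e2 : (b - q) * (c * v.re + d * v.im) / ‖z‖ * z.im
      = (b - q) * (c * v.re + d * v.im) * d := by rw [hd]; ring
    rw [e1, e2]
    linear_combination (b - q) ^ 2 * (c * v.re + d * v.im) ^ 2 * hcd
  have hcs : (c * v.re + d * v.im) ^ 2 ≤ ‖v‖ ^ 2 := by
    rw [Complex.sq_norm, Complex.normSq_apply]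
    nlinarith [sq_nonneg (c * v.im - d * v.re)]
  have hqq : 0 ≤ q ^ 2 - b ^ 2 := by nlinarith
  constructor
  · refine le_of_pow_le_pow_left₀ two_ne_zero (norm_nonneg _) ?_
    rw [hsq]
    nlinarith [mul_le_mul_of_nonneg_left hcs hqq]
  · refine le_trans ?_ (mul_le_mul_of_nonneg_right hqb (norm_nonneg v))
    refine le_of_pow_le_pow_left₀ two_ne_zero (mul_nonneg (hb0.le.trans hbq) (norm_nonneg _)) ?_
    rw [hsq]
    nlinarith [mul_nonneg hqq (sq_nonneg (c * v.re + d * v.im))]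

theorem det_complex (A : ℂ →L[ℝ] ℂ) : A.det = (A 1).re * (A Complex.I).im
    - (A Complex.I).re * (A 1).im := by
  rw [ContinuousLinearMap.det, ← LinearMap.det_toMatrix Complex.basisOneI, Matrix.det_fin_two]
  simp [LinearMap.toMatrix_apply]

theorem det_fderiv_polarCoord {β ε : ℝ} (hβ : 0 < β) (hβ1 : β ≤ 1) {z : ℂ} (hz : z ≠ 0 ∨ β = 1) :
    polarDensity β ε ‖z‖ ^ 2 ≤ (fderiv ℝ (polarCoord β ε) z).det ∧
      (fderiv ℝ (polarCoord β ε) z).det ≤ polarDensity β ε ‖z‖ ^ 2 / β := by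
  rcases eq_or_ne β 1 with rfl | hne
  · simp [polarCoord_one, polarDensity, ContinuousLinearMap.det]
  have hz : z ≠ 0 := hz.resolve_right hne
  have h0 := norm_pos_iff.2 hz
  have hdet : (fderiv ℝ (polarCoord β ε) z).det
      = polarDensity β ε ‖z‖ * (polarRadius β ε ‖z‖ / ‖z‖) := by
    rw [det_complex, fderiv_polarCoord_apply hβ hβ1 hz, fderiv_polarCoord_apply hβ hβ1 hz]
    simp only [Complex.add_re, Complex.add_im, Complex.re_ofReal_mul, Complex.im_ofReal_mul,
      Complex.one_re, Complex.one_im, Complex.I_re, Complex.I_im]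
    have hcd : z.re ^ 2 + z.im ^ 2 = ‖z‖ ^ 2 := by
      rw [Complex.sq_norm, Complex.normSq_apply]; ring
    field_simp
    linear_combination (polarRadius β ε ‖z‖ * ‖z‖ ^ 3 * polarDensity β ε ‖z‖
      - polarRadius β ε ‖z‖ ^ 2 * ‖z‖ ^ 2) * hcd
  have hb0 : 0 < polarDensity β ε ‖z‖ := polarDensity_pos hβ h0
  rw [hdet, sq, mul_div_assoc]
  constructor
  · refine mul_le_mul_of_nonneg_left ?_ hb0.le
    rw [le_div_iff₀ h0, mul_comm]
    exact mul_polarDensity_le_polarRadius hβ hβ1 h0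
  · refine mul_le_mul_of_nonneg_left ?_ hb0.le
    rw [div_le_iff₀ h0, mul_comm]
    exact polarRadius_le hβ hβ1 h0


/-! ### The polar map in several variables and its inverse. -/

/-- The cone angles in all coordinate directions, extended by `1`. -/
noncomputable def coneAngle {n : ℕ} (k : ℕ) (β : Fin n → ℝ) (j : Fin n) : ℝ :=
  if (j : ℕ) < k then β j else 1

theorem polarMap_apply {n k : ℕ} {β : Fin n → ℝ} {ε : ℝ} (z : Cn n) (j : Fin n) :
    polarMap k β ε z j = polarCoord (coneAngle k β j) ε (z j) := by
  unfold polarMap coneAngle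
  split_ifs with h
  · simp [h, polarCoord]
  · simp [h, polarCoord_one]

/-- The key identity for uniformity: the model coefficient is the square of the radial stretching,
so polar coordinates normalise the model metric up to factors of the cone angles. -/
theorem modelWeight_eq {n k : ℕ} {β : Fin n → ℝ} {ε : ℝ} (z : Cn n) (j : Fin n) :
    modelWeight k β ε z j = polarDensity (coneAngle k β j) ε ‖z j‖ ^ 2 := by
  rw [polarDensity_sq]
  unfold modelWeight coneAngle
  split_ifs <;> simp

theorem isOpen_compl_divisor (n k : ℕ) : IsOpen (divisor n k)ᶜ := by
  have : (divisor n k)ᶜ = ⋂ j : Fin n, {z : Cn n | (j : ℕ) < k → z j ≠ 0} := by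
    ext z; simp [divisor]
  rw [this]
  refine isOpen_iInter_of_finite fun j => ?_
  by_cases h : (j : ℕ) < k
  · simp only [h, true_imp_iff]
    exact isOpen_ne_fun (by fun_prop) continuous_const
  · simp [h]

theorem ne_zero_or_coneAngle {n k : ℕ} {β : Fin n → ℝ} {z : Cn n} (hz : z ∉ divisor n k)
    (j : Fin n) : z j ≠ 0 ∨ coneAngle k β j = 1 := by
  by_cases h : (j : ℕ) < k
  · exact Or.inl fun h0 => hz ⟨j, h, h0⟩
  · exact Or.inr (by simp [coneAngle, h])

theorem polarDensity_norm_pos {β ε : ℝ} {z : ℂ} (hβ : 0 < β) (hz : z ≠ 0 ∨ β = 1) :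
    0 < polarDensity β ε ‖z‖ := by
  rcases eq_or_ne β 1 with rfl | hne
  · simp [polarDensity]
  · exact polarDensity_pos hβ (norm_pos_iff.2 (hz.resolve_right hne))

/-- The inverse of the polar map away from the divisor. -/
noncomputable def polarInv {n : ℕ} (k : ℕ) (β : Fin n → ℝ) (ε : ℝ) : Cn n → Cn n :=
  Function.invFunOn (polarMap k β ε) (divisor n k)ᶜ

section

variable {n k : ℕ} {β : Fin n → ℝ} {ε : ℝ}

theorem coneAngle_mem (hβ : ∀ j : Fin n, (j : ℕ) < k → 0 < β j ∧ β j ≤ 1) (j : Fin n) :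
    0 < coneAngle k β j ∧ coneAngle k β j ≤ 1 := by
  unfold coneAngle
  split_ifs with h
  · exact hβ j h
  · simp

theorem modelWeight_pos (hβ : ∀ j : Fin n, (j : ℕ) < k → 0 < β j ∧ β j ≤ 1) {z : Cn n}
    (hz : z ∉ divisor n k) (j : Fin n) : 0 < modelWeight k β ε z j := by
  rw [modelWeight_eq]
  exact pow_pos (polarDensity_norm_pos (coneAngle_mem hβ j).1 (ne_zero_or_coneAngle hz j)) 2

theorem injOn_polarMap (hβ : ∀ j : Fin n, (j : ℕ) < k → 0 < β j ∧ β j ≤ 1) :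
    InjOn (polarMap k β ε) (divisor n k)ᶜ := by
  intro z hz w hw h
  ext j
  refine injOn_polarCoord (ε := ε) (coneAngle_mem hβ j).1 (coneAngle_mem hβ j).2
    (ne_zero_or_coneAngle hz j) (ne_zero_or_coneAngle hw j) ?_
  rw [← polarMap_apply, h, polarMap_apply]

theorem polarMap_mem_divisor {z : Cn n} (hz : z ∈ divisor n k) :
    polarMap k β ε z ∈ divisor n k := by
  obtain ⟨j, hj, h⟩ := hz
  exact ⟨j, hj, by rw [polarMap_apply, h, polarCoord, mul_zero]⟩

theorem surjOn_polarMap (hβ : ∀ j : Fin n, (j : ℕ) < k → 0 < β j ∧ β j ≤ 1) (hε : 0 ≤ ε)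
    (hε1 : ε ≤ 1) : SurjOn (polarMap k β ε) (divisor n k)ᶜ (divisor n k)ᶜ := by
  intro ξ hξ
  have h : ∀ j, ∃ z, polarCoord (coneAngle k β j) ε z = ξ j := fun j =>
    exists_polarCoord_eq (coneAngle_mem hβ j).1 (coneAngle_mem hβ j).2 hε hε1
      (ne_zero_or_coneAngle hξ j)
  choose z hz using h
  have e : polarMap k β ε (WithLp.toLp 2 z) = ξ := by
    ext j
    rw [polarMap_apply, hz]
  refine ⟨WithLp.toLp 2 z, fun hd => hξ ?_, e⟩
  rw [← e]
  exact polarMap_mem_divisor hd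

theorem polarInv_notMem_divisor (hβ : ∀ j : Fin n, (j : ℕ) < k → 0 < β j ∧ β j ≤ 1) (hε : 0 ≤ ε)
    (hε1 : ε ≤ 1) {ξ : Cn n} (hξ : ξ ∉ divisor n k) : polarInv k β ε ξ ∉ divisor n k :=
  Function.invFunOn_mem (surjOn_polarMap hβ hε hε1 hξ)

theorem polarMap_polarInv (hβ : ∀ j : Fin n, (j : ℕ) < k → 0 < β j ∧ β j ≤ 1) (hε : 0 ≤ ε)
    (hε1 : ε ≤ 1) {ξ : Cn n} (hξ : ξ ∉ divisor n k) : polarMap k β ε (polarInv k β ε ξ) = ξ :=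
  Function.invFunOn_eq (surjOn_polarMap hβ hε hε1 hξ)

theorem polarInv_polarMap (hβ : ∀ j : Fin n, (j : ℕ) < k → 0 < β j ∧ β j ≤ 1) {z : Cn n}
    (hz : z ∉ divisor n k) : polarInv k β ε (polarMap k β ε z) = z :=
  (injOn_polarMap hβ).leftInvOn_invFunOn hz

theorem contDiffAt_polarMap (hβ : ∀ j : Fin n, (j : ℕ) < k → 0 < β j ∧ β j ≤ 1) {z : Cn n}
    (hz : z ∉ divisor n k) : ContDiffAt ℝ 2 (polarMap k β ε) z := by
  rw [contDiffAt_piLp]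
  intro j
  simp only [polarMap_apply]
  have h := contDiffAt_polarCoord (ε := ε) (coneAngle_mem hβ j).1 (coneAngle_mem hβ j).2
    (ne_zero_or_coneAngle hz j)
  have hp : ContDiffAt ℝ 2 (fun z : Cn n => z j) z := by fun_prop
  exact h.comp z hp

theorem fderiv_polarMap_apply (hβ : ∀ j : Fin n, (j : ℕ) < k → 0 < β j ∧ β j ≤ 1) {z : Cn n}
    (hz : z ∉ divisor n k) (v : Cn n) (j : Fin n) :
    fderiv ℝ (polarMap k β ε) z v j
      = fderiv ℝ (polarCoord (coneAngle k β j) ε) (z j) (v j) := by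
  set P : Cn n →L[ℝ] ℂ := PiLp.proj (𝕜 := ℝ) 2 (fun _ => ℂ) j with hP
  have h1 := ((contDiffAt_polarMap (ε := ε) hβ hz).differentiableAt two_ne_zero).hasFDerivAt
  have h2 := P.hasFDerivAt.comp z h1
  have h3 := (((contDiffAt_polarCoord (ε := ε) (coneAngle_mem hβ j).1 (coneAngle_mem hβ j).2
    (ne_zero_or_coneAngle hz j)).differentiableAt two_ne_zero).hasFDerivAt).comp z
    (P.hasFDerivAt (x := z))
  have h4 : (P ∘ polarMap k β ε) = polarCoord (coneAngle k β j) ε ∘ P := by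
    funext z
    exact polarMap_apply z j
  rw [h4] at h2
  have h5 := h2.unique h3
  exact congrArg (fun L : Cn n →L[ℝ] ℂ => L v) h5

theorem det_fderiv_polarMap (hβ : ∀ j : Fin n, (j : ℕ) < k → 0 < β j ∧ β j ≤ 1) {z : Cn n}
    (hz : z ∉ divisor n k) : (fderiv ℝ (polarMap k β ε) z).det
      = ∏ j, (fderiv ℝ (polarCoord (coneAngle k β j) ε) (z j)).det := by
  rw [← ContinuousLinearMap.det_pi, ContinuousLinearMap.det, ContinuousLinearMap.det,
    ← LinearMap.det_conj _ (WithLp.linearEquiv 2 ℝ (Fin n → ℂ))]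
  congr 1
  refine LinearMap.ext fun v => funext fun j => ?_
  exact fderiv_polarMap_apply hβ hz (WithLp.toLp 2 v) j

theorem det_fderiv_polarMap_bounds (hβ : ∀ j : Fin n, (j : ℕ) < k → 0 < β j ∧ β j ≤ 1) {z : Cn n}
    (hz : z ∉ divisor n k) :
    ∏ j, modelWeight k β ε z j ≤ (fderiv ℝ (polarMap k β ε) z).det ∧
      (fderiv ℝ (polarMap k β ε) z).det
        ≤ (∏ j, (coneAngle k β j)⁻¹) * ∏ j, modelWeight k β ε z j := by
  have h := fun j => det_fderiv_polarCoord (ε := ε) (coneAngle_mem hβ j).1 (coneAngle_mem hβ j).2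
    (ne_zero_or_coneAngle hz j)
  rw [det_fderiv_polarMap hβ hz, ← Finset.prod_mul_distrib]
  constructor
  · refine Finset.prod_le_prod (fun j _ => (modelWeight_pos hβ hz j).le) fun j _ => ?_
    rw [modelWeight_eq]
    exact (h j).1
  · refine Finset.prod_le_prod (fun j _ => (sq_nonneg _).trans (h j).1) fun j _ => ?_
    rw [modelWeight_eq, ← div_eq_inv_mul]
    exact (h j).2

theorem det_fderiv_polarMap_pos (hβ : ∀ j : Fin n, (j : ℕ) < k → 0 < β j ∧ β j ≤ 1) {z : Cn n}
    (hz : z ∉ divisor n k) : 0 < (fderiv ℝ (polarMap k β ε) z).det :=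
  (Finset.prod_pos fun j _ => modelWeight_pos hβ hz j).trans_le (det_fderiv_polarMap_bounds hβ hz).1

/-- The inverse function theorem gives a $C^2$ local inverse with values off the divisor near the
point, and injectivity there identifies it with the globally defined inverse. -/
theorem contDiffAt_polarInv (hβ : ∀ j : Fin n, (j : ℕ) < k → 0 < β j ∧ β j ≤ 1) (hε : 0 ≤ ε)
    (hε1 : ε ≤ 1) {ξ : Cn n} (hξ : ξ ∉ divisor n k) : ContDiffAt ℝ 2 (polarInv k β ε) ξ := by
  obtain ⟨z, hz, rfl⟩ := surjOn_polarMap hβ hε hε1 hξ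
  have hC := contDiffAt_polarMap (ε := ε) hβ hz
  set A := ContinuousLinearMap.toContinuousLinearEquivOfDetNeZero
    (fderiv ℝ (polarMap k β ε) z) (det_fderiv_polarMap_pos hβ hz).ne' with hA
  have hf : HasFDerivAt (polarMap k β ε) (A : Cn n →L[ℝ] Cn n) z := by
    have : (A : Cn n →L[ℝ] Cn n) = fderiv ℝ (polarMap k β ε) z := rfl
    rw [this]
    exact (hC.differentiableAt two_ne_zero).hasFDerivAt
  have hs := hC.hasStrictFDerivAt' hf two_ne_zero
  have h1 := hC.to_localInverse hf two_ne_zero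
  refine h1.congr_of_eventuallyEq ?_
  have hc : ContinuousAt (hC.localInverse hf two_ne_zero) (polarMap k β ε z) := h1.continuousAt
  have hval : hC.localInverse hf two_ne_zero (polarMap k β ε z) = z := hs.localInverse_apply_image
  have h2 : ∀ᶠ η in 𝓝 (polarMap k β ε z), hC.localInverse hf two_ne_zero η ∈ (divisor n k)ᶜ := by
    refine hc ?_
    rw [hval]
    exact (isOpen_compl_divisor n k).mem_nhds hz
  filter_upwards [h2, hs.eventually_right_inverse] with η h3 h4
  have h5 : polarMap k β ε (hC.localInverse hf two_ne_zero η) = η := h4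
  conv_lhs => rw [← h5]
  exact polarInv_polarMap hβ h3

/-! ### Gradients in the two coordinate systems -/

theorem norm_dz_sq (W : Cn n → ℝ) (z : Cn n) (j : Fin n) :
    ‖dz W z j‖ ^ 2 = (1 / 4) * (fderiv ℝ W z (EuclideanSpace.single j 1) ^ 2
      + fderiv ℝ W z (EuclideanSpace.single j Complex.I) ^ 2) := by
  unfold dz
  rw [norm_mul, mul_pow, Complex.sq_norm, Complex.sq_norm, Complex.normSq_apply,
    Complex.normSq_apply]
  simp
  ring

theorem fderiv_comp_polarMap_single (hβ : ∀ j : Fin n, (j : ℕ) < k → 0 < β j ∧ β j ≤ 1)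
    {z : Cn n} (hz : z ∉ divisor n k) {w : Cn n → ℝ}
    (hw : DifferentiableAt ℝ w (polarMap k β ε z)) (j : Fin n) (x : ℂ) :
    fderiv ℝ (fun z => w (polarMap k β ε z)) z (EuclideanSpace.single j x)
      = fderiv ℝ w (polarMap k β ε z) (EuclideanSpace.single j
        (fderiv ℝ (polarCoord (coneAngle k β j) ε) (z j) x)) := by
  have h1 := (contDiffAt_polarMap (ε := ε) hβ hz).differentiableAt two_ne_zero
  have h2 : fderiv ℝ (fun z => w (polarMap k β ε z)) z
    = (fderiv ℝ w (polarMap k β ε z)).comp (fderiv ℝ (polarMap k β ε) z) := fderiv_comp z hw h1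
  rw [h2, ContinuousLinearMap.comp_apply]
  congr 1
  ext i
  rw [fderiv_polarMap_apply hβ hz]
  by_cases h : i = j
  · subst h
    simp
  · simp [h]

/-- Each holomorphic direction picks up a stretching of at most the density over the cone angle; the
inverse model weight cancels the squared density. -/
theorem sum_norm_dz_comp_polarMap_le (hβ : ∀ j : Fin n, (j : ℕ) < k → 0 < β j ∧ β j ≤ 1)
    {z : Cn n} (hz : z ∉ divisor n k) {w : Cn n → ℝ}
    (hw : DifferentiableAt ℝ w (polarMap k β ε z)) :
    ∑ j, (modelWeight k β ε z j)⁻¹ * ‖dz (fun z => w (polarMap k β ε z)) z j‖ ^ 2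
      ≤ (∑ j, (coneAngle k β j)⁻¹ ^ 2) * ‖fderiv ℝ w (polarMap k β ε z)‖ ^ 2 := by
  rw [Finset.sum_mul]
  refine Finset.sum_le_sum fun j _ => ?_
  obtain ⟨hb, hb1⟩ := coneAngle_mem hβ j
  have hd := polarDensity_norm_pos (ε := ε) hb (ne_zero_or_coneAngle hz j)
  set b := coneAngle k β j
  set d := polarDensity b ε ‖z j‖ with hd'
  set L := fderiv ℝ w (polarMap k β ε z)
  have h : ∀ x : ℂ, ‖x‖ = 1 → (fderiv ℝ (fun z => w (polarMap k β ε z)) z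
      (EuclideanSpace.single j x)) ^ 2 ≤ (‖L‖ * (d / b)) ^ 2 := by
    intro x hx
    rw [fderiv_comp_polarMap_single hβ hz hw]
    have h1 := L.le_opNorm (EuclideanSpace.single j (fderiv ℝ (polarCoord b ε) (z j) x))
    rw [PiLp.norm_single] at h1
    have h2 := (norm_fderiv_polarCoord (ε := ε) hb hb1 (ne_zero_or_coneAngle hz j) x).2
    rw [hx, mul_one] at h2
    rw [← sq_abs]
    refine pow_le_pow_left₀ (abs_nonneg _) (h1.trans ?_) 2
    exact mul_le_mul_of_nonneg_left h2 (norm_nonneg _)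
  rw [norm_dz_sq, modelWeight_eq]
  have h1 := h 1 (by simp)
  have h2 := h Complex.I (by simp)
  calc _ ≤ (d ^ 2)⁻¹ * ((1 / 4) * ((‖L‖ * (d / b)) ^ 2 + (‖L‖ * (d / b)) ^ 2)) := by gcongr
    _ = 1 / 2 * (b⁻¹ ^ 2 * ‖L‖ ^ 2) := by field_simp; ring
    _ ≤ b⁻¹ ^ 2 * ‖L‖ ^ 2 := by
      have : 0 ≤ b⁻¹ ^ 2 * ‖L‖ ^ 2 := by positivity
      linarith

/-- The converse comparison: the derivative of a coordinate map is injective, hence surjective by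
dimension, so every polar direction is the image of a holomorphic one with controlled norm. Summing
over the coordinates with Cauchy-Schwarz costs $4n$. -/
theorem norm_fderiv_sq_le_sum_norm_dz (hβ : ∀ j : Fin n, (j : ℕ) < k → 0 < β j ∧ β j ≤ 1)
    {z : Cn n} (hz : z ∉ divisor n k) {w : Cn n → ℝ}
    (hw : DifferentiableAt ℝ w (polarMap k β ε z)) :
    ‖fderiv ℝ w (polarMap k β ε z)‖ ^ 2 ≤ 4 * n *
      ∑ j, (modelWeight k β ε z j)⁻¹ * ‖dz (fun z => w (polarMap k β ε z)) z j‖ ^ 2 := by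
  set L := fderiv ℝ w (polarMap k β ε z) with hL
  set a : Fin n → ℝ := fun j => (polarDensity (coneAngle k β j) ε ‖z j‖)⁻¹ *
    ‖dz (fun z => w (polarMap k β ε z)) z j‖ with ha
  have ha0 : ∀ j, 0 ≤ a j := fun j => mul_nonneg (inv_nonneg.2
    (polarDensity_norm_pos (coneAngle_mem hβ j).1 (ne_zero_or_coneAngle hz j)).le) (norm_nonneg _)
  have hsingle : ∀ (j : Fin n) (y : ℂ), |L (EuclideanSpace.single j y)| ≤ 2 * a j * ‖y‖ := by
    intro j y
    obtain ⟨hb, hb1⟩ := coneAngle_mem hβ j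
    have hd := polarDensity_norm_pos (ε := ε) hb (ne_zero_or_coneAngle hz j)
    have hA := norm_fderiv_polarCoord (ε := ε) hb hb1 (ne_zero_or_coneAngle hz j)
    set A := fderiv ℝ (polarCoord (coneAngle k β j) ε) (z j) with hA'
    have hinj : Function.Injective (A : ℂ →ₗ[ℝ] ℂ) := by
      rw [injective_iff_map_eq_zero]
      intro x hx
      have h1 := (hA x).1
      rw [show A x = 0 from hx, norm_zero] at h1
      exact norm_le_zero_iff.1 (nonpos_of_mul_nonpos_right h1 hd)
    obtain ⟨x, hx⟩ := LinearMap.injective_iff_surjective.1 hinj y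
    have hx : A x = y := hx
    have hxn : ‖x‖ ≤ (polarDensity (coneAngle k β j) ε ‖z j‖)⁻¹ * ‖y‖ := by
      rw [← div_eq_inv_mul, le_div_iff₀ hd, mul_comm, ← hx]
      exact (hA x).1
    have e : L (EuclideanSpace.single j y)
        = x.re * fderiv ℝ (fun z => w (polarMap k β ε z)) z (EuclideanSpace.single j 1)
        + x.im * fderiv ℝ (fun z => w (polarMap k β ε z)) z
          (EuclideanSpace.single j Complex.I) := by
      rw [← hx, hA', ← fderiv_comp_polarMap_single hβ hz hw]
      rw [← smul_eq_mul, ← smul_eq_mul, ← map_smul, ← map_smul, ← map_add]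
      congr 1
      ext i
      by_cases h : i = j
      · subst h
        simp [Complex.re_add_im]
      · simp [h]
    have h2 : (L (EuclideanSpace.single j y)) ^ 2 ≤
        (2 * (‖x‖ * ‖dz (fun z => w (polarMap k β ε z)) z j‖)) ^ 2 := by
      rw [mul_pow, mul_pow, norm_dz_sq, Complex.sq_norm, Complex.normSq_apply, e]
      set p := fderiv ℝ (fun z => w (polarMap k β ε z)) z (EuclideanSpace.single j 1)
      set q := fderiv ℝ (fun z => w (polarMap k β ε z)) z (EuclideanSpace.single j Complex.I)
      nlinarith [sq_nonneg (x.re * q - x.im * p)]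
    refine (abs_le_of_sq_le_sq h2 (by positivity)).trans ?_
    calc _ ≤ 2 * ((polarDensity (coneAngle k β j) ε ‖z j‖)⁻¹ * ‖y‖ *
        ‖dz (fun z => w (polarMap k β ε z)) z j‖) := by gcongr
      _ = _ := by rw [ha]; ring
  have hbound : ‖L‖ ≤ ∑ j, 2 * a j := by
    refine L.opNorm_le_bound (Finset.sum_nonneg fun j _ => by have := ha0 j; positivity) fun v => ?_
    have e : v = ∑ j, EuclideanSpace.single j (v j) := by
      ext i
      simp [Finset.sum_apply]
    conv_lhs => rw [e, map_sum]
    rw [Finset.sum_mul]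
    refine (norm_sum_le _ _).trans (Finset.sum_le_sum fun j _ => (hsingle j (v j)).trans ?_)
    have := ha0 j
    have := PiLp.norm_apply_le v j
    gcongr
  calc ‖L‖ ^ 2 ≤ (∑ j, 2 * a j) ^ 2 := pow_le_pow_left₀ (norm_nonneg _) hbound 2
    _ ≤ (Finset.univ : Finset (Fin n)).card * ∑ j, (2 * a j) ^ 2 := sq_sum_le_card_mul_sum_sq
    _ = _ := by
      rw [Finset.card_univ, Fintype.card_fin, Finset.mul_sum, Finset.mul_sum]
      refine Finset.sum_congr rfl fun j _ => ?_
      rw [modelWeight_eq, ha]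
      ring

end


/-! ### Uniform ellipticity in polar coordinates. -/

/-- The ellipticity constant, in polar coordinates, of the metrics with constant `K`. -/
noncomputable def ellipticityConst {n : ℕ} (k : ℕ) (β : Fin n → ℝ) (K : ℝ) : ℝ :=
  -- One summand for each bound needed: cometric from above, cometric from below, volume density
  -- from below, volume density from above.
  4 * K ^ (n + 1) * ∑ j, (coneAngle k β j)⁻¹ ^ 2 + n * K ^ (n + 1) * ∏ j, (coneAngle k β j)⁻¹
    + K ^ n * ∏ j, (coneAngle k β j)⁻¹ + K ^ n

/-- The density of the volume form of `G` in polar coordinates. -/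
noncomputable def polarVolume {n : ℕ} (k : ℕ) (β : Fin n → ℝ) (ε : ℝ)
    (G : Cn n → Matrix (Fin n) (Fin n) ℂ) (ξ : Cn n) : ℝ :=
  (G (polarInv k β ε ξ)).det.re / (fderiv ℝ (polarMap k β ε) (polarInv k β ε ξ)).det

section

variable {n k : ℕ} {β : Fin n → ℝ} {ε K : ℝ}

theorem prod_inv_coneAngle_pos (hβ : ∀ j : Fin n, (j : ℕ) < k → 0 < β j ∧ β j ≤ 1) :
    0 < ∏ j, (coneAngle k β j)⁻¹ :=
  Finset.prod_pos fun j _ => inv_pos.2 (coneAngle_mem hβ j).1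

theorem ellipticityConst_pos (hβ : ∀ j : Fin n, (j : ℕ) < k → 0 < β j ∧ β j ≤ 1) (hK : 0 < K) :
    0 < ellipticityConst k β K := by
  have := prod_inv_coneAngle_pos hβ
  unfold ellipticityConst
  positivity

theorem det_bounds_polar (hβ : ∀ j : Fin n, (j : ℕ) < k → 0 < β j ∧ β j ≤ 1) (hK : 0 < K)
    {z : Cn n} (hz : z ∉ divisor n k) {G : Matrix (Fin n) (Fin n) ℂ}
    (hG : QuasiIsometric K (modelWeight k β ε z) G) :
    (fderiv ℝ (polarMap k β ε) z).det ≤ K ^ n * (∏ j, (coneAngle k β j)⁻¹) * G.det.re ∧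
      G.det.re ≤ K ^ n * (fderiv ℝ (polarMap k β ε) z).det := by
  obtain ⟨-, h1, h2⟩ := det_bounds_of_quasiIsometric hK (fun j => modelWeight_pos hβ hz j) hG
  obtain ⟨h3, h4⟩ := det_fderiv_polarMap_bounds (ε := ε) hβ hz
  have hP := prod_inv_coneAngle_pos hβ
  have hKn : 0 < K ^ n := by positivity
  constructor
  · refine h4.trans ?_
    rw [inv_pow, ← div_eq_inv_mul, div_le_iff₀ hKn] at h1
    calc _ ≤ (∏ j, (coneAngle k β j)⁻¹) * (G.det.re * K ^ n) := by gcongr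
      _ = _ := by ring
  · exact h2.trans (by gcongr)

theorem polarVolume_bounds (hβ : ∀ j : Fin n, (j : ℕ) < k → 0 < β j ∧ β j ≤ 1) (hK : 0 < K)
    {ξ : Cn n} (hz : polarInv k β ε ξ ∉ divisor n k) {G : Cn n → Matrix (Fin n) (Fin n) ℂ}
    (hG : QuasiIsometric K (modelWeight k β ε (polarInv k β ε ξ)) (G (polarInv k β ε ξ))) :
    (ellipticityConst k β K)⁻¹ ≤ polarVolume k β ε G ξ ∧
      polarVolume k β ε G ξ ≤ ellipticityConst k β K := by
  obtain ⟨h1, h2⟩ := det_bounds_polar hβ hK hz hG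
  have hJ := det_fderiv_polarMap_pos (ε := ε) hβ hz
  have hP := prod_inv_coneAngle_pos hβ
  have hKn : 0 < K ^ n := by positivity
  have hd : 0 < (G (polarInv k β ε ξ)).det.re := by
    by_contra hcon
    have : K ^ n * (∏ j, (coneAngle k β j)⁻¹) * (G (polarInv k β ε ξ)).det.re ≤ 0 :=
      mul_nonpos_of_nonneg_of_nonpos (by positivity) (not_lt.1 hcon)
    linarith
  unfold polarVolume
  constructor
  · have h3 : K ^ n * (∏ j, (coneAngle k β j)⁻¹) ≤ ellipticityConst k β K := by
      unfold ellipticityConst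
      have : 0 ≤ 4 * K ^ (n + 1) * ∑ j, (coneAngle k β j)⁻¹ ^ 2 := by positivity
      have : 0 ≤ n * K ^ (n + 1) * ∏ j, (coneAngle k β j)⁻¹ := by positivity
      linarith
    rw [le_div_iff₀ hJ, ← div_eq_inv_mul, div_le_iff₀ (ellipticityConst_pos hβ hK)]
    exact h1.trans (by rw [mul_comm _ (ellipticityConst k β K)]; gcongr)
  · have h3 : K ^ n ≤ ellipticityConst k β K := by
      unfold ellipticityConst
      have : 0 ≤ 4 * K ^ (n + 1) * ∑ j, (coneAngle k β j)⁻¹ ^ 2 := by positivity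
      have : 0 ≤ n * K ^ (n + 1) * ∏ j, (coneAngle k β j)⁻¹ := by positivity
      have : 0 ≤ K ^ n * ∏ j, (coneAngle k β j)⁻¹ := by positivity
      linarith
    rw [div_le_iff₀ hJ]
    exact h2.trans (by gcongr)

/-- Uniform ellipticity: the energy density of the metric, taken with respect to Lebesgue measure in
`z`, is comparable to the Jacobian times the squared Euclidean gradient in `ξ`. The bounds combine
`coform_bounds`, `det_bounds_polar` and the two gradient comparisons. -/
theorem coform_comp_polarMap_bounds (hβ : ∀ j : Fin n, (j : ℕ) < k → 0 < β j ∧ β j ≤ 1)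
    (hK : 0 < K) {z : Cn n} (hz : z ∉ divisor n k) {G : Matrix (Fin n) (Fin n) ℂ}
    (hG : QuasiIsometric K (modelWeight k β ε z) G) {w : Cn n → ℝ}
    (hw : DifferentiableAt ℝ w (polarMap k β ε z)) :
    (fderiv ℝ (polarMap k β ε) z).det * ((ellipticityConst k β K)⁻¹
        * ‖fderiv ℝ w (polarMap k β ε z)‖ ^ 2)
      ≤ 4 * coform G (dz (fun z => w (polarMap k β ε z)) z) (dz (fun z => w (polarMap k β ε z)) z)
    ∧ 4 * coform G (dz (fun z => w (polarMap k β ε z)) z) (dz (fun z => w (polarMap k β ε z)) z)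
      ≤ (fderiv ℝ (polarMap k β ε) z).det * (ellipticityConst k β K
        * ‖fderiv ℝ w (polarMap k β ε z)‖ ^ 2) := by
  obtain ⟨h1, h2⟩ := coform_bounds hK (fun j => modelWeight_pos hβ hz j) hG
    (dz (fun z => w (polarMap k β ε z)) z)
  obtain ⟨h3, h4⟩ := det_bounds_polar hβ hK hz hG
  have h5 := sum_norm_dz_comp_polarMap_le hβ hz hw
  have h6 := norm_fderiv_sq_le_sum_norm_dz hβ hz hw
  have hJ := det_fderiv_polarMap_pos (ε := ε) hβ hz
  have hP := prod_inv_coneAngle_pos hβ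
  have hΛ := ellipticityConst_pos hβ hK
  have hS0 : 0 ≤ ∑ j, (modelWeight k β ε z j)⁻¹ * ‖dz (fun z => w (polarMap k β ε z)) z j‖ ^ 2 :=
    Finset.sum_nonneg fun j _ => mul_nonneg (inv_nonneg.2 (modelWeight_pos hβ hz j).le)
      (sq_nonneg _)
  set S := ∑ j, (modelWeight k β ε z j)⁻¹ * ‖dz (fun z => w (polarMap k β ε z)) z j‖ ^ 2
  set J := (fderiv ℝ (polarMap k β ε) z).det
  set Q := coform G (dz (fun z => w (polarMap k β ε z)) z) (dz (fun z => w (polarMap k β ε z)) z)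
  set L := ‖fderiv ℝ w (polarMap k β ε z)‖ ^ 2
  set P := ∏ j, (coneAngle k β j)⁻¹
  set B := ∑ j, (coneAngle k β j)⁻¹ ^ 2
  have hKn : 0 < K ^ n := by positivity
  have hd : 0 < G.det.re := by
    by_contra hcon
    have : K ^ n * P * G.det.re ≤ 0 :=
      mul_nonpos_of_nonneg_of_nonpos (by positivity) (not_lt.1 hcon)
    linarith
  have hL0 : 0 ≤ L := sq_nonneg _
  have hB0 : 0 ≤ B := Finset.sum_nonneg fun j _ => sq_nonneg _
  constructor
  · have hΛ1 : n * K ^ (n + 1) * P ≤ ellipticityConst k β K := by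
      unfold ellipticityConst
      have : 0 ≤ 4 * K ^ (n + 1) * B := by positivity
      have : 0 ≤ K ^ n * P := by positivity
      linarith
    have h7 : J * L ≤ 4 * (n * K ^ (n + 1) * P) * Q := by
      calc J * L ≤ (K ^ n * P * G.det.re) * (4 * n * S) := by gcongr
        _ = 4 * n * K ^ n * P * K * (G.det.re * (K⁻¹ * S)) := by field_simp
        _ ≤ 4 * n * K ^ n * P * K * Q := by gcongr
        _ = _ := by ring
    have hQ0 : 0 ≤ Q := le_trans (by positivity) h1
    calc J * ((ellipticityConst k β K)⁻¹ * L) = (J * L) / ellipticityConst k β K := by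
          rw [div_eq_inv_mul]; ring
      _ ≤ 4 * Q := by
          rw [div_le_iff₀ hΛ]
          calc J * L ≤ 4 * (n * K ^ (n + 1) * P) * Q := h7
            _ ≤ 4 * ellipticityConst k β K * Q := by gcongr
            _ = _ := by ring
  · have hΛ1 : 4 * K ^ (n + 1) * B ≤ ellipticityConst k β K := by
      unfold ellipticityConst
      have : 0 ≤ n * K ^ (n + 1) * P := by positivity
      have : 0 ≤ K ^ n * P := by positivity
      linarith
    calc 4 * Q ≤ 4 * (G.det.re * (K * S)) := by gcongr
      _ ≤ 4 * (K ^ n * J * (K * (B * L))) := by gcongr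
      _ = J * (4 * K ^ (n + 1) * B * L) := by ring
      _ ≤ _ := by gcongr

/-! ### Change of variables -/

theorem preimage_polarMap_subset {V : Set (Cn n)} (hV : V ⊆ (divisor n k)ᶜ) :
    polarMap k β ε ⁻¹' V ⊆ (divisor n k)ᶜ := fun _ hz hd => hV hz (polarMap_mem_divisor hd)

theorem isOpen_preimage_polarMap (hβ : ∀ j : Fin n, (j : ℕ) < k → 0 < β j ∧ β j ≤ 1)
    {V : Set (Cn n)} (hV : V ⊆ (divisor n k)ᶜ) (hVo : IsOpen V) :
    IsOpen (polarMap k β ε ⁻¹' V) := by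
  have h : ContinuousOn (polarMap k β ε) (divisor n k)ᶜ := fun z hz =>
    (contDiffAt_polarMap hβ hz).continuousAt.continuousWithinAt
  rw [← inter_eq_self_of_subset_right (preimage_polarMap_subset (β := β) (ε := ε) hV)]
  exact h.isOpen_inter_preimage (isOpen_compl_divisor n k) hVo

theorem image_preimage_polarMap (hβ : ∀ j : Fin n, (j : ℕ) < k → 0 < β j ∧ β j ≤ 1) (hε : 0 ≤ ε)
    (hε1 : ε ≤ 1) {V : Set (Cn n)} (hV : V ⊆ (divisor n k)ᶜ) :
    polarMap k β ε '' (polarMap k β ε ⁻¹' V) = V :=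
  image_preimage_eq_of_subset fun ξ hξ =>
    ⟨polarInv k β ε ξ, polarMap_polarInv hβ hε hε1 (hV hξ)⟩

theorem hasFDerivWithinAt_polarMap (hβ : ∀ j : Fin n, (j : ℕ) < k → 0 < β j ∧ β j ≤ 1)
    {V : Set (Cn n)} (hV : V ⊆ (divisor n k)ᶜ) :
    ∀ z ∈ polarMap k β ε ⁻¹' V, HasFDerivWithinAt (polarMap k β ε)
      (fderiv ℝ (polarMap k β ε) z) (polarMap k β ε ⁻¹' V) z := fun _ hz =>
  ((contDiffAt_polarMap hβ (preimage_polarMap_subset hV hz)).differentiableAt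
    two_ne_zero).hasFDerivAt.hasFDerivWithinAt

theorem setIntegral_polarMap (hβ : ∀ j : Fin n, (j : ℕ) < k → 0 < β j ∧ β j ≤ 1) (hε : 0 ≤ ε)
    (hε1 : ε ≤ 1) {V : Set (Cn n)} (hV : V ⊆ (divisor n k)ᶜ) (hVo : IsOpen V) (F : Cn n → ℝ) :
    ∫ ξ in V, F ξ = ∫ z in polarMap k β ε ⁻¹' V,
      (fderiv ℝ (polarMap k β ε) z).det * F (polarMap k β ε z) := by
  have hm := (isOpen_preimage_polarMap (ε := ε) hβ hV hVo).measurableSet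
  have h := integral_image_eq_integral_abs_det_fderiv_smul volume hm
    (hasFDerivWithinAt_polarMap (ε := ε) hβ hV)
    ((injOn_polarMap hβ).mono (preimage_polarMap_subset hV)) F
  rw [image_preimage_polarMap hβ hε hε1 hV] at h
  rw [h]
  refine setIntegral_congr_fun hm fun z hz => ?_
  change |_| * _ = _
  rw [abs_of_pos (det_fderiv_polarMap_pos hβ (preimage_polarMap_subset hV hz))]

theorem integrableOn_polarMap (hβ : ∀ j : Fin n, (j : ℕ) < k → 0 < β j ∧ β j ≤ 1) (hε : 0 ≤ ε)
    (hε1 : ε ≤ 1) {V : Set (Cn n)} (hV : V ⊆ (divisor n k)ᶜ) (hVo : IsOpen V) {F : Cn n → ℝ}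
    (hF : IntegrableOn F V) : IntegrableOn (fun z => (fderiv ℝ (polarMap k β ε) z).det
      * F (polarMap k β ε z)) (polarMap k β ε ⁻¹' V) := by
  have hm := (isOpen_preimage_polarMap (ε := ε) hβ hV hVo).measurableSet
  rw [← image_preimage_polarMap (β := β) hβ hε hε1 hV,
    integrableOn_image_iff_integrableOn_abs_det_fderiv_smul volume hm
    (hasFDerivWithinAt_polarMap (ε := ε) hβ hV)
    ((injOn_polarMap hβ).mono (preimage_polarMap_subset hV)) F] at hF
  refine hF.congr_fun (fun z hz => ?_) hm
  change |_| * _ = _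
  rw [abs_of_pos (det_fderiv_polarMap_pos hβ (preimage_polarMap_subset hV hz))]

/-- The holomorphic energy inequality for the pulled back functions, rewritten by the change of
variables. The Jacobian times `polarVolume` is $\det g$ on the left; on the right the ellipticity
bounds absorb the cometric. -/
theorem slice_energy_polar (hβ : ∀ j : Fin n, (j : ℕ) < k → 0 < β j ∧ β j ≤ 1) (hε : 0 ≤ ε)
    (hε1 : ε ≤ 1) (hK : 0 < K) {V O : Set (Cn n)} (hV : V ⊆ (divisor n k)ᶜ) (hVo : IsOpen V)
    (hOo : IsOpen O) {G : Cn n → Matrix (Fin n) (Fin n) ℂ}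
    (hcont : ∀ i j, ContinuousOn (fun z => G z i j) (polarMap k β ε ⁻¹' V))
    (hG : KahlerClosedOn (polarMap k β ε ⁻¹' V) G)
    (hqi : ∀ z ∈ polarMap k β ε ⁻¹' V, QuasiIsometric K (modelWeight k β ε z) (G z))
    {w wt φ : Cn n → ℝ} {l : ℝ} (hw : ContDiffOn ℝ 2 w V) (hwt : ContinuousOn wt V)
    (hsub : ∀ z ∈ polarMap k β ε ⁻¹' V,
      wt (polarMap k β ε z) ≤ laplacian (G z) (fun z => w (polarMap k β ε z)) z)
    (hO : ∀ x ∈ V ∩ O, w x ≤ 0) (hl : 0 ≤ l) (hφ : ContDiff ℝ 1 φ) (hφc : HasCompactSupport φ)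
    (hφs : tsupport φ ⊆ V ∪ O) :
    ∫ x in V, φ x ^ 2 * max (w x - l) 0 ^ 2 * wt x * polarVolume k β ε G x
      ≤ ∫ x in V, (-(ellipticityConst k β K)⁻¹
          * (φ x ^ 2 * max (w x - l) 0 * ‖fderiv ℝ w x‖ ^ 2)
        + ellipticityConst k β K * (max (w x - l) 0 ^ 3 * ‖fderiv ℝ φ x‖ ^ 2)) := by
  set T := polarMap k β ε with hT
  set U := T ⁻¹' V with hU
  have hUd : U ⊆ (divisor n k)ᶜ := preimage_polarMap_subset hV
  have hUo : IsOpen U := isOpen_preimage_polarMap hβ hV hVo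
  have hTC : ContDiffOn ℝ 2 T U := fun z hz => (contDiffAt_polarMap hβ (hUd hz)).contDiffWithinAt
  have hSC : ContinuousOn (polarInv k β ε) V := fun x hx =>
    (contDiffAt_polarInv hβ hε hε1 (hV hx)).continuousAt.continuousWithinAt
  -- The pulled back cutoff need not be smooth at the divisor. Compactness is taken from `tsupport φ
  -- \ O`, which avoids it, and transported by the continuous inverse.
  have hA := (isCompact_tsupport_diff hOo hφc).image_of_continuousOn
    (hSC.mono (tsupport_diff_subset hφs))
  have hAU : polarInv k β ε '' (tsupport φ \ O) ⊆ U := by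
    rintro _ ⟨x, hx, rfl⟩
    have := tsupport_diff_subset hφs hx
    change T (polarInv k β ε x) ∈ V
    rwa [hT, polarMap_polarInv hβ hε hε1 (hV this)]
  have hdet := fun z hz => det_bounds_of_quasiIsometric hK
    (fun j => modelWeight_pos hβ (hUd hz) j) (hqi z hz)
  have hdpos : ∀ z ∈ U, 0 < (G z).det.re := fun z hz => lt_of_lt_of_le
    (mul_pos (by positivity) (Finset.prod_pos fun j _ => modelWeight_pos hβ (hUd hz) j))
    (hdet z hz).2.1
  obtain ⟨-, i2, h⟩ := slice_energy_holomorphic hUo hA hAU hcont hG (fun z hz => (hqi z hz).1)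
    (fun z hz => ⟨(hdet z hz).1, hdpos z hz⟩) (fun z hz a => by
      refine le_trans ?_ (coform_bounds hK (fun j => modelWeight_pos hβ (hUd hz) j) (hqi z hz) a).1
      refine mul_nonneg (hdpos z hz).le (mul_nonneg (inv_nonneg.2 hK.le)
        (Finset.sum_nonneg fun j _ => mul_nonneg (inv_nonneg.2 (modelWeight_pos hβ (hUd hz) j).le)
          (sq_nonneg _))))
    (W := fun z => w (T z)) (φ := fun z => φ (T z)) (wt := fun z => wt (T z))
    (hw.comp hTC fun _ hz => hz) (hφ.comp_contDiffOn (hTC.of_le one_le_two))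
    (hwt.comp hTC.continuousOn fun _ hz => hz) hsub l (by
      intro z hz
      have hTz : T z ∈ V \ (tsupport φ \ O) := by
        refine ⟨hz.1, fun hcon => hz.2 ⟨T z, hcon, ?_⟩⟩
        exact polarInv_polarMap hβ (hUd hz.1)
      by_cases hs : T z ∈ tsupport φ
      · right
        have hzO : T z ∈ O := by
          by_contra hcon
          exact hTz.2 ⟨hs, hcon⟩
        exact (hO _ ⟨hTz.1, hzO⟩).trans hl
      · left
        have hc : ContinuousAt T z := (hTC.contDiffAt (hUo.mem_nhds hz.1)).continuousAt
        exact hc.eventually (notMem_tsupport_iff_eventuallyEq.1 hs))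
  have hw1 : ContDiffOn ℝ 1 w V := hw.of_le one_le_two
  have hint : IntegrableOn (fun x => -(ellipticityConst k β K)⁻¹
          * (φ x ^ 2 * max (w x - l) 0 * ‖fderiv ℝ w x‖ ^ 2)
        + ellipticityConst k β K * (max (w x - l) 0 ^ 3 * ‖fderiv ℝ φ x‖ ^ 2)) V :=
    ((integrableOn_sq_mul_fderiv hVo hOo hO hw1 hl hφ hφc hφs).const_mul _).add
      ((integrableOn_cube_mul_fderiv hVo hOo hO hw1 hl hφ hφc hφs).const_mul _)
  rw [setIntegral_polarMap hβ hε hε1 hV hVo, setIntegral_polarMap hβ hε hε1 hV hVo]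
  have e1 : ∫ z in U, (fderiv ℝ T z).det * (φ (T z) ^ 2 * max (w (T z) - l) 0 ^ 2 * wt (T z)
      * polarVolume k β ε G (T z))
      = ∫ z in U, φ (T z) ^ 2 * max (w (T z) - l) 0 ^ 2 * wt (T z) * (G z).det.re := by
    refine setIntegral_congr_fun hUo.measurableSet fun z hz => ?_
    have hJ := det_fderiv_polarMap_pos (ε := ε) hβ (hUd hz)
    rw [← hT] at hJ
    simp only [polarVolume]
    rw [hT, polarInv_polarMap hβ (hUd hz), ← hT]
    field_simp
  rw [← hT, ← hU, e1]
  refine h.trans (setIntegral_mono_on i2 (integrableOn_polarMap hβ hε hε1 hV hVo hint)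
    hUo.measurableSet fun z hz => ?_)
  have hzV : T z ∈ V := hz
  have b1 := (coform_comp_polarMap_bounds hβ hK (hUd hz) (hqi z hz) (w := w)
    ((hw.contDiffAt (hVo.mem_nhds hzV)).differentiableAt two_ne_zero)).1
  have b2 := (coform_comp_polarMap_bounds hβ hK (hUd hz) (hqi z hz) (w := φ)
    (hφ.differentiable one_ne_zero _)).2
  rw [← hT] at b1 b2
  have f0 : 0 ≤ max (w (T z) - l) 0 := le_max_right _ _
  have c1 := mul_le_mul_of_nonneg_left b1 (mul_nonneg (sq_nonneg (φ (T z))) f0)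
  have c2 := mul_le_mul_of_nonneg_left b2 (pow_nonneg f0 3)
  change _ ≤ (fderiv ℝ T z).det * _
  nlinarith [c1, c2]

end


/-! ### The Laplacian and pluriharmonic functions -/

theorem laplacian_congr {n : ℕ} {f g : Cn n → ℝ} {z : Cn n} (h : f =ᶠ[𝓝 z] g)
    (G : Matrix (Fin n) (Fin n) ℂ) : laplacian G f z = laplacian G g z := by
  unfold laplacian complexHessian
  rw [(h.fderiv (𝕜 := ℝ)).fderiv_eq]

/-- The Laplacian of a Kähler metric sees only the complex Hessian, so pluriharmonic terms can be
added freely, whatever the metric. -/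
theorem laplacian_add_const_mul {n : ℕ} {f g : Cn n → ℝ} {z : Cn n} (hf : ContDiffAt ℝ 2 f z)
    (hg : ContDiffAt ℝ 2 g z) (hg0 : ∀ i j, complexHessian g z i j = 0) (τ : ℝ)
    (G : Matrix (Fin n) (Fin n) ℂ) :
    laplacian G (fun z => f z + τ * g z) z = laplacian G f z := by
  have hfe : ∀ᶠ x in 𝓝 z, ContDiffAt ℝ 2 f x := hf.eventually (by simp)
  have hge : ∀ᶠ x in 𝓝 z, ContDiffAt ℝ 2 g x := hg.eventually (by simp)
  have h1 : fderiv ℝ (fun z => f z + τ * g z) =ᶠ[𝓝 z] fun x => fderiv ℝ f x + τ • fderiv ℝ g x := by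
    filter_upwards [hfe, hge] with x hx hx'
    rw [fderiv_fun_add (hx.differentiableAt two_ne_zero)
      ((hx'.differentiableAt two_ne_zero).const_mul τ),
      fderiv_const_mul (hx'.differentiableAt two_ne_zero)]
  have hf1 : DifferentiableAt ℝ (fderiv ℝ f) z :=
    (hf.fderiv_right (m := 1) (by norm_num)).differentiableAt one_ne_zero
  have hg1 : DifferentiableAt ℝ (fderiv ℝ g) z :=
    (hg.fderiv_right (m := 1) (by norm_num)).differentiableAt one_ne_zero
  have h2 : fderiv ℝ (fderiv ℝ (fun z => f z + τ * g z)) z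
      = fderiv ℝ (fderiv ℝ f) z + τ • fderiv ℝ (fderiv ℝ g) z := by
    rw [h1.fderiv_eq]
    exact (hf1.hasFDerivAt.add (hg1.hasFDerivAt.const_smul τ)).fderiv
  have h3 : ∀ i j, complexHessian (fun z => f z + τ * g z) z i j
      = complexHessian f z i j + τ * complexHessian g z i j := by
    intro i j
    unfold complexHessian
    rw [h2]
    simp only [add_apply, smul_apply, smul_eq_mul]
    push_cast
    ring
  unfold laplacian
  simp only [h3, hg0, mul_zero, add_zero]

/-- The pluriharmonic function `∑_{j < k} (log |z_j| - c)`. -/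
noncomputable def logBarrier {n : ℕ} (k : ℕ) (c : ℝ) (z : Cn n) : ℝ :=
  ∑ j ∈ Finset.univ.filter (fun j : Fin n => (j : ℕ) < k), (Real.log ‖z j‖ - c)

theorem hasFDerivAt_log_norm {z : ℂ} (hz : z ≠ 0) :
    HasFDerivAt (fun z : ℂ => Real.log ‖z‖)
      (Complex.reCLM.comp ((ContinuousLinearMap.mul ℝ ℂ) z⁻¹)) z := by
  have h0 := norm_pos_iff.2 hz
  refine ((hasFDerivAt_norm_complex hz).log h0.ne').congr_fderiv ?_
  refine ContinuousLinearMap.ext fun v => ?_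
  have e : z.re ^ 2 + z.im ^ 2 = ‖z‖ ^ 2 := by rw [Complex.sq_norm, Complex.normSq_apply]; ring
  simp only [add_apply, smul_apply, smul_eq_mul, Complex.reCLM_apply, Complex.imCLM_apply,
    ContinuousLinearMap.comp_apply, ContinuousLinearMap.mul_apply', Complex.mul_re, Complex.inv_re,
    Complex.inv_im, Complex.normSq_eq_norm_sq]
  field_simp
  ring

theorem contDiffAt_logBarrier {n k : ℕ} {c : ℝ} {z : Cn n} (hz : z ∉ divisor n k) :
    ContDiffAt ℝ 2 (logBarrier k c) z := by
  unfold logBarrier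
  refine ContDiffAt.sum fun j hj => ContDiffAt.sub ?_ contDiffAt_const
  have hzj : z j ≠ 0 := fun h => hz ⟨j, (Finset.mem_filter.1 hj).2, h⟩
  have h1 : ContDiffAt ℝ 2 (fun z : Cn n => z j) z := by fun_prop
  exact (h1.norm ℝ hzj).log (norm_ne_zero_iff.2 hzj)

theorem fderiv_logBarrier_apply {n k : ℕ} {c : ℝ} {z : Cn n} (hz : z ∉ divisor n k) (v : Cn n) :
    fderiv ℝ (logBarrier k c) z v = ∑ j ∈ Finset.univ.filter (fun j : Fin n => (j : ℕ) < k), ((z j)⁻¹ * v j).re := by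
  have h : HasFDerivAt (logBarrier k c) (∑ j ∈ Finset.univ.filter (fun j : Fin n => (j : ℕ) < k),
      (Complex.reCLM.comp ((ContinuousLinearMap.mul ℝ ℂ) (z j)⁻¹)).comp
        (PiLp.proj (𝕜 := ℝ) 2 (fun _ : Fin n => ℂ) j)) z := by
    unfold logBarrier
    refine HasFDerivAt.fun_sum fun j hj => HasFDerivAt.sub_const _ ?_
    have hzj : z j ≠ 0 := fun h => hz ⟨j, (Finset.mem_filter.1 hj).2, h⟩
    exact (hasFDerivAt_log_norm hzj).comp z
      ((PiLp.proj (𝕜 := ℝ) 2 (fun _ : Fin n => ℂ) j).hasFDerivAt (x := z))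
  rw [h.fderiv]
  simp

/-- Each $\log|z_j|$ is locally the real part of a holomorphic logarithm, so its real Hessian is
$\mathrm{Re}(-z_j^{-2}u_jv_j)$. This bilinear expression is complex linear in each argument, and the
contributions of $1$ and $\sqrt{-1}$ cancel in the complex Hessian. -/
theorem complexHessian_logBarrier {n k : ℕ} {c : ℝ} {z : Cn n} (hz : z ∉ divisor n k)
    (i l : Fin n) : complexHessian (logBarrier k c) z i l = 0 := by
  have hd : DifferentiableAt ℝ (fderiv ℝ (logBarrier k c)) z :=
    ((contDiffAt_logBarrier hz).fderiv_right (m := 1) (by norm_num)).differentiableAt one_ne_zero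
  have key : ∀ u v : Cn n, fderiv ℝ (fderiv ℝ (logBarrier k c)) z u v
      = ∑ j ∈ Finset.univ.filter (fun j : Fin n => (j : ℕ) < k), (-((z j) ^ 2)⁻¹ * u j * v j).re := by
    intro u v
    have h1 : fderiv ℝ (fderiv ℝ (logBarrier k c)) z u v
        = fderiv ℝ (fun x => fderiv ℝ (logBarrier k c) x v) z u := by
      rw [fderiv_clm_apply hd (differentiableAt_const v)]
      simp
    have h2 : (fun x => fderiv ℝ (logBarrier k c) x v) =ᶠ[𝓝 z]
        fun x => ∑ j ∈ Finset.univ.filter (fun j : Fin n => (j : ℕ) < k), ((x j)⁻¹ * v j).re := by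
      filter_upwards [(isOpen_compl_divisor n k).mem_nhds hz] with x hx
      exact fderiv_logBarrier_apply hx v
    have h3 : HasFDerivAt (fun x : Cn n => ∑ j ∈ Finset.univ.filter (fun j : Fin n => (j : ℕ) < k), ((x j)⁻¹ * v j).re)
        (∑ j ∈ Finset.univ.filter (fun j : Fin n => (j : ℕ) < k), (Complex.reCLM.comp
          ((ContinuousLinearMap.mul ℝ ℂ) (-((z j) ^ 2)⁻¹ * v j))).comp
          (PiLp.proj (𝕜 := ℝ) 2 (fun _ : Fin n => ℂ) j)) z := by
      refine HasFDerivAt.fun_sum fun j hj => ?_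
      have hzj : z j ≠ 0 := fun h => hz ⟨j, (Finset.mem_filter.1 hj).2, h⟩
      have h4 : HasFDerivAt (fun x : ℂ => (x⁻¹ * v j).re)
          (Complex.reCLM.comp ((ContinuousLinearMap.mul ℝ ℂ) (-((z j) ^ 2)⁻¹ * v j))) (z j) := by
        have h5 := ((hasDerivAt_inv hzj).mul_const (v j)).hasFDerivAt.restrictScalars ℝ
        refine (Complex.reCLM.hasFDerivAt.comp (z j) h5).congr_fderiv ?_
        refine ContinuousLinearMap.ext fun x => ?_
        simp
        ring
      exact HasFDerivAt.comp (g := fun x : ℂ => (x⁻¹ * v j).re) z h4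
        ((PiLp.proj (𝕜 := ℝ) 2 (fun _ : Fin n => ℂ) j).hasFDerivAt (x := z))
    rw [h1, h2.fderiv_eq, h3.fderiv]
    simp only [sum_apply, ContinuousLinearMap.comp_apply,
      Complex.reCLM_apply, ContinuousLinearMap.mul_apply', PiLp.proj_apply]
    exact Finset.sum_congr rfl fun j _ => congrArg Complex.re (by ring)
  unfold complexHessian
  simp only [key]
  rw [← Finset.sum_add_distrib, ← Finset.sum_sub_distrib]
  have e1 : ∀ j : Fin n, (-((z j) ^ 2)⁻¹ * (EuclideanSpace.single i (1 : ℂ) : Cn n) j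
      * (EuclideanSpace.single l (1 : ℂ) : Cn n) j).re
      + (-((z j) ^ 2)⁻¹ * (EuclideanSpace.single i Complex.I : Cn n) j
      * (EuclideanSpace.single l Complex.I : Cn n) j).re = 0 := by
    intro j
    rw [← Complex.add_re]
    simp only [PiLp.single_apply]
    split_ifs <;> simp [mul_assoc]
  have e2 : ∀ j : Fin n, (-((z j) ^ 2)⁻¹ * (EuclideanSpace.single i (1 : ℂ) : Cn n) j
      * (EuclideanSpace.single l Complex.I : Cn n) j).re
      - (-((z j) ^ 2)⁻¹ * (EuclideanSpace.single i Complex.I : Cn n) j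
      * (EuclideanSpace.single l (1 : ℂ) : Cn n) j).re = 0 := by
    intro j
    rw [← Complex.sub_re]
    simp only [PiLp.single_apply]
    split_ifs <;> simp
  simp only [e1, e2]
  simp

/-! ### Continuity and measurability -/

theorem HolderMetricOn.continuousOn {n : ℕ} {U : Set (Cn n)}
    {G : Cn n → Matrix (Fin n) (Fin n) ℂ} (h : HolderMetricOn U G) (hU : IsOpen U) (i j : Fin n) :
    ContinuousOn (fun z => G z i j) U := by
  obtain ⟨α, hα, -, h⟩ := h
  intro z hz
  obtain ⟨ρ, hρ, hρU⟩ := Metric.nhds_basis_closedBall.mem_iff.1 (hU.mem_nhds hz)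
  obtain ⟨C, hC⟩ := h _ (isCompact_closedBall z ρ) hρU
  refine ContinuousAt.continuousWithinAt ?_
  refine tendsto_iff_norm_sub_tendsto_zero.2 ?_
  have hlim : Tendsto (fun w => C * dist w z ^ α) (𝓝 z) (𝓝 0) := by
    have h1 : Tendsto (fun w => dist w z) (𝓝 z) (𝓝 0) := by
      have : Continuous fun w => dist w z := by fun_prop
      simpa using this.tendsto z
    have h2 := (h1.rpow_const (Or.inr hα.le)).const_mul C
    rwa [Real.zero_rpow hα.ne', mul_zero] at h2
  refine squeeze_zero' (Eventually.of_forall fun _ => norm_nonneg _) ?_ hlim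
  filter_upwards [Metric.closedBall_mem_nhds z hρ] with w hw
  exact hC w hw z (Metric.mem_closedBall_self hρ.le) i j

theorem LocallyParabolicHolder.continuousOn {n : ℕ} {F : Type*} [NormedAddCommGroup F] {α : ℝ}
    (hα : 0 < α) {V : Set (Cn n)} (hV : IsOpen V) {a b : ℝ} {f : Cn n × ℝ → F}
    (h : LocallyParabolicHolder α (V ×ˢ Ioc a b) f) : ContinuousOn f (V ×ˢ Ioc a b) := by
  rintro ⟨x, t⟩ ⟨hx, ht⟩
  have hx : x ∈ V := hx
  have ht : t ∈ Ioc a b := ht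
  obtain ⟨ρ, hρ, hρV⟩ := Metric.nhds_basis_closedBall.mem_iff.1 (hV.mem_nhds hx)
  have ht1 : (a + t) / 2 < t := by linarith [ht.1]
  obtain ⟨C, hC⟩ := h (Metric.closedBall x ρ ×ˢ Icc ((a + t) / 2) b)
    ((isCompact_closedBall x ρ).prod isCompact_Icc)
    (prod_mono hρV fun τ hτ => ⟨by linarith [ht.1, hτ.1], hτ.2⟩)
  refine tendsto_iff_norm_sub_tendsto_zero.2 ?_
  have hlim : Tendsto (fun q : Cn n × ℝ => C * (dist q.1 x + √|q.2 - t|) ^ α)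
      (𝓝[V ×ˢ Ioc a b] (x, t)) (𝓝 0) := by
    refine Tendsto.mono_left ?_ nhdsWithin_le_nhds
    have h1 : Tendsto (fun q : Cn n × ℝ => dist q.1 x + √|q.2 - t|) (𝓝 (x, t)) (𝓝 0) := by
      have : Continuous fun q : Cn n × ℝ => dist q.1 x + √|q.2 - t| := by fun_prop
      simpa using this.tendsto (x, t)
    have h2 := (h1.rpow_const (Or.inr hα.le)).const_mul C
    rwa [Real.zero_rpow hα.ne', mul_zero] at h2
  refine squeeze_zero' (Eventually.of_forall fun _ => norm_nonneg _) ?_ hlim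
  have h1 : ∀ᶠ q in 𝓝 (x, t), q.1 ∈ Metric.closedBall x ρ :=
    continuousAt_fst.eventually (Metric.closedBall_mem_nhds x hρ)
  have h2 : ∀ᶠ q : Cn n × ℝ in 𝓝 (x, t), (a + t) / 2 < q.2 :=
    continuousAt_snd.eventually (lt_mem_nhds ht1)
  filter_upwards [mem_nhdsWithin_of_mem_nhds h1, mem_nhdsWithin_of_mem_nhds h2,
    self_mem_nhdsWithin] with q hq1 hq2 hq3
  exact hC q ⟨hq1, hq2.le, hq3.2.2⟩ (x, t) ⟨Metric.mem_closedBall_self hρ.le, ht1.le, ht.2⟩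

/-- A Carathéodory function is measurable. It is applied to the volume density, which is continuous
in space and in time separately. -/
theorem aestronglyMeasurable_of_continuousOn_sections {n : ℕ} {V : Set (Cn n)} {I : Set ℝ}
    (hV : MeasurableSet V) (hI : MeasurableSet I) {γ : Cn n × ℝ → ℝ}
    (hx : ∀ t ∈ I, ContinuousOn (fun x => γ (x, t)) V)
    (ht : ∀ x ∈ V, ContinuousOn (fun t => γ (x, t)) I) :
    AEStronglyMeasurable γ (volume.restrict (V ×ˢ I)) := by
  have h1 : Measurable (Function.uncurry fun (t : I) (x : V) => γ (x, t)) := by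
    refine measurable_uncurry_of_continuous_of_measurable (fun x => ?_) fun t => ?_
    · exact (ht x x.2).domRestrict
    · exact (hx t t.2).domRestrict.measurable
  have he : MeasurableEmbedding (Prod.map (Subtype.val : V → Cn n) (Subtype.val : I → ℝ)) :=
    (MeasurableEmbedding.subtype_coe hV).prodMap (MeasurableEmbedding.subtype_coe hI)
  obtain ⟨g, hg, hgγ⟩ := he.exists_measurable_extend (h1.comp measurable_swap) fun _ => ⟨0⟩
  refine (hg.aestronglyMeasurable).congr ?_
  refine (ae_restrict_iff' (hV.prod hI)).2 (Eventually.of_forall ?_)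
  rintro ⟨x, t⟩ ⟨hx, ht⟩
  exact congrFun hgγ (⟨x, hx⟩, ⟨t, ht⟩)

theorem volume_divisor (n k : ℕ) : volume (divisor n k) = 0 := by
  have e : divisor n k = ⋃ j : Fin n, {z : Cn n | (j : ℕ) < k ∧ z j = 0} := by
    ext z; simp [divisor]
  rw [e, measure_iUnion_null_iff]
  intro j
  set S : Submodule ℝ (Cn n) :=
    LinearMap.ker ((PiLp.proj (𝕜 := ℝ) 2 (fun _ : Fin n => ℂ) j : Cn n →L[ℝ] ℂ) : Cn n →ₗ[ℝ] ℂ)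
  refine measure_mono_null (t := S) (fun z hz => hz.2) (Measure.addHaar_submodule volume S ?_)
  intro h
  have h1 : EuclideanSpace.single j (1 : ℂ) ∈ S := by rw [h]; trivial
  have h2 : (EuclideanSpace.single j (1 : ℂ) : Cn n) j = 0 := h1
  simp at h2

theorem volume_cylinder {n : ℕ} (Y : Cn n × ℝ) {r : ℝ} (hr : 0 < r) :
    (volume (cylinder Y r)).toReal
      = (volume (Metric.ball (0 : Cn n) 1)).toReal * r ^ (2 * n + 2) := by
  rw [cylinder, timeInterval, Measure.volume_eq_prod, Measure.prod_prod, Real.volume_Ioc,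
    Measure.addHaar_ball_of_pos _ _ hr, finrank_real_Cn, ENNReal.toReal_mul, ENNReal.toReal_mul,
    ENNReal.toReal_ofReal (by positivity), ENNReal.toReal_ofReal (by nlinarith [sq_nonneg r])]
  ring


/-! ### The barrier and the reduction to energy subsolutions. -/

section

variable {n k : ℕ} {β : Fin n → ℝ} {ε K : ℝ}

theorem norm_polarInv (hβ : ∀ j : Fin n, (j : ℕ) < k → 0 < β j ∧ β j ≤ 1) (hε : 0 ≤ ε)
    (hε1 : ε ≤ 1) {ξ : Cn n} (hξ : ξ ∉ divisor n k) {j : Fin n} (hj : (j : ℕ) < k) :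
    0 < ‖polarInv k β ε ξ j‖ ∧ polarRadius (β j) ε ‖polarInv k β ε ξ j‖ = ‖ξ j‖ := by
  have h0 : polarInv k β ε ξ j ≠ 0 := fun h => polarInv_notMem_divisor hβ hε hε1 hξ ⟨j, hj, h⟩
  refine ⟨norm_pos_iff.2 h0, ?_⟩
  have h1 : polarMap k β ε (polarInv k β ε ξ) j = ξ j := by rw [polarMap_polarInv hβ hε hε1 hξ]
  rw [polarMap_apply, coneAngle, if_pos hj] at h1
  rw [← h1, norm_polarCoord (hβ j hj).1 (hβ j hj).2 h0]

/-- An upper bound for the logarithms of the holomorphic coordinates on a ball. -/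
theorem exists_log_norm_polarInv_le (hβ : ∀ j : Fin n, (j : ℕ) < k → 0 < β j ∧ β j ≤ 1)
    (hε : 0 ≤ ε) (hε1 : ε ≤ 1) (y : Cn n) {r : ℝ} (hr : 0 < r) :
    ∃ c : ℝ, ∀ ξ ∈ Metric.ball y r \ divisor n k, ∀ j : Fin n, (j : ℕ) < k →
      Real.log ‖polarInv k β ε ξ j‖ ≤ c := by
  have hB : 0 < ‖y‖ + r := by positivity
  have h : ∀ j : Fin n, ∃ ρ : ℝ, (j : ℕ) < k → 0 < ρ ∧ polarRadius (β j) ε ρ = ‖y‖ + r := by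
    intro j
    by_cases hj : (j : ℕ) < k
    · obtain ⟨ρ, h⟩ := exists_polarRadius_eq (hβ j hj).1 (hβ j hj).2 hε hε1 hB
      exact ⟨ρ, fun _ => h⟩
    · exact ⟨0, fun h => absurd h hj⟩
  choose ρ hρ using h
  refine ⟨∑ j, |Real.log (ρ j)|, fun ξ hξ j hj => ?_⟩
  obtain ⟨h1, h2⟩ := norm_polarInv hβ hε hε1 hξ.2 hj
  have h3 : ‖ξ j‖ ≤ ‖y‖ + r := by
    refine (PiLp.norm_apply_le ξ j).trans ?_
    have := norm_le_norm_add_norm_sub' ξ y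
    have h4 : ‖ξ - y‖ < r := by rw [← dist_eq_norm]; exact hξ.1
    linarith
  have h4 : ‖polarInv k β ε ξ j‖ ≤ ρ j := by
    rw [← (strictMonoOn_polarRadius (ε := ε) (hβ j hj).1 (hβ j hj).2).le_iff_le h1 (hρ j hj).1, h2,
      (hρ j hj).2]
    exact h3
  calc Real.log ‖polarInv k β ε ξ j‖ ≤ Real.log (ρ j) := Real.log_le_log h1 h4
    _ ≤ |Real.log (ρ j)| := le_abs_self _
    _ ≤ _ := Finset.single_le_sum (f := fun j => |Real.log (ρ j)|) (fun i _ => abs_nonneg _)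
      (Finset.mem_univ j)

/-- The barrier `u + τ ∑_{j < k} (log |z_j| - c)`, in polar coordinates. -/
noncomputable def withBarrier {n : ℕ} (k : ℕ) (β : Fin n → ℝ) (ε c τ : ℝ) (u : Cn n × ℝ → ℝ)
    (p : Cn n × ℝ) : ℝ :=
  u p + τ * logBarrier k c (polarInv k β ε p.1)

theorem logBarrier_nonpos {c : ℝ} {z : Cn n}
    (hc : ∀ j : Fin n, (j : ℕ) < k → Real.log ‖z j‖ ≤ c) : logBarrier k c z ≤ 0 :=
  Finset.sum_nonpos fun j hj => sub_nonpos.2 (hc j (Finset.mem_filter.1 hj).2)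

theorem logBarrier_le {c : ℝ} {z : Cn n} (hc : ∀ j : Fin n, (j : ℕ) < k → Real.log ‖z j‖ ≤ c)
    {j : Fin n} (hj : (j : ℕ) < k) : logBarrier k c z ≤ Real.log ‖z j‖ - c := by
  unfold logBarrier
  rw [← Finset.add_sum_erase _ _ (Finset.mem_filter.2 ⟨Finset.mem_univ j, hj⟩)]
  refine add_le_of_nonpos_right (Finset.sum_nonpos fun i hi => ?_)
  exact sub_nonpos.2 (hc i (Finset.mem_filter.1 (Finset.mem_of_mem_erase hi)).2)

/-- A neighbourhood of the divisor on which a bounded function plus the barrier is nonpositive. -/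
theorem exists_isOpen_withBarrier_nonpos (hβ : ∀ j : Fin n, (j : ℕ) < k → 0 < β j ∧ β j ≤ 1)
    (hε : 0 ≤ ε) (hε1 : ε ≤ 1) {V : Set (Cn n)} (hV : V ⊆ (divisor n k)ᶜ) {c τ M : ℝ} (hτ : 0 < τ)
    (hc : ∀ ξ ∈ V, ∀ j : Fin n, (j : ℕ) < k → Real.log ‖polarInv k β ε ξ j‖ ≤ c)
    {I : Set ℝ} {u : Cn n × ℝ → ℝ} (hM : ∀ x ∈ V, ∀ t ∈ I, u (x, t) ≤ M) :
    ∃ O : Set (Cn n), IsOpen O ∧ divisor n k ⊆ O ∧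
      ∀ x ∈ V ∩ O, ∀ t ∈ I, withBarrier k β ε c τ u (x, t) ≤ 0 := by
  -- If $|z_j|<\delta$ for some conic `j`, then $\log|z_j|-c<-M/\tau$; the other summands are
  -- nonpositive, so the barrier lies below $-M$ and outweighs `u`.
  set δ : ℝ := Real.exp (c - M / τ) with hδ
  have hδ0 : 0 < δ := Real.exp_pos _
  refine ⟨⋃ j : Fin n, ⋃ _ : (j : ℕ) < k, {ξ | ‖ξ j‖ < polarRadius (β j) ε δ}, ?_, ?_, ?_⟩
  · exact isOpen_iUnion fun j => isOpen_iUnion fun _ => isOpen_lt (by fun_prop) continuous_const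
  · rintro ξ ⟨j, hj, h⟩
    simp only [mem_iUnion]
    refine ⟨j, hj, ?_⟩
    change ‖ξ j‖ < _
    rw [h, norm_zero]
    exact polarRadius_pos (hβ j hj).1 (hβ j hj).2 hδ0
  · rintro x ⟨hx, hxO⟩ t ht
    simp only [mem_iUnion] at hxO
    obtain ⟨j, hj, hxj⟩ := hxO
    have hxj : ‖x j‖ < polarRadius (β j) ε δ := hxj
    obtain ⟨h1, h2⟩ := norm_polarInv hβ hε hε1 (hV hx) hj
    rw [← h2, (strictMonoOn_polarRadius (ε := ε) (hβ j hj).1 (hβ j hj).2).lt_iff_lt h1 hδ0] at hxj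
    have h3 : Real.log ‖polarInv k β ε x j‖ ≤ c - M / τ := by
      rw [← Real.log_exp (c - M / τ)]
      exact Real.log_le_log h1 hxj.le
    have h4 := logBarrier_le (hc x hx) hj
    have h5 : τ * logBarrier k c (polarInv k β ε x) ≤ τ * (-(M / τ)) :=
      mul_le_mul_of_nonneg_left (by linarith) hτ.le
    have h6 : τ * (-(M / τ)) = -M := by field_simp
    have := hM x hx t ht
    change u (x, t) + τ * logBarrier k c (polarInv k β ε x) ≤ 0
    linarith

theorem IsWeakConic.mono {n k : ℕ} {β : Fin n → ℝ} {K : ℝ} {Ω U : Set (Cn n)}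
    {G : Cn n → Matrix (Fin n) (Fin n) ℂ} (h : IsWeakConic k β K Ω G)
    (hU : U ⊆ Ω \ divisor n k) : HolderMetricOn U G ∧ KahlerClosedOn U G ∧
      ∀ z ∈ U, QuasiIsometric K (modelWeight k β 0 z) (G z) := by
  refine ⟨?_, fun ψ h1 h2 h3 => h.kahler ψ h1 h2 (h3.trans hU), fun z hz =>
    h.quasiIsometric z (hU hz)⟩
  obtain ⟨α, h1, h2, h3⟩ := h.holder
  exact ⟨α, h1, h2, fun Q hQ hQU => h3 Q hQ (hQU.trans hU)⟩

theorem IsNearlyConic.mono {n k : ℕ} {β : Fin n → ℝ} {ε K : ℝ} {Ω U : Set (Cn n)}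
    {G : Cn n → Matrix (Fin n) (Fin n) ℂ} (h : IsNearlyConic k β ε K Ω G)
    (hU : U ⊆ Ω) : HolderMetricOn U G ∧ KahlerClosedOn U G ∧
      ∀ z ∈ U, QuasiIsometric K (modelWeight k β ε z) (G z) := by
  refine ⟨?_, fun ψ h1 h2 h3 => h.kahler ψ h1 h2 (h3.trans hU), fun z hz =>
    h.quasiIsometric z (hU hz)⟩
  obtain ⟨α, h1, h2, h3⟩ := h.holder
  exact ⟨α, h1, h2, fun Q hQ hQU => h3 Q hQ (hQU.trans hU)⟩

theorem differentiableWithinAt_det {I : Set ℝ} {t : ℝ} {A : ℝ → Matrix (Fin n) (Fin n) ℂ}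
    (h : ∀ i j, DifferentiableWithinAt ℝ (fun τ => A τ i j) I t) :
    DifferentiableWithinAt ℝ (fun τ => (A τ).det.re) I t := by
  have h1 : DifferentiableWithinAt ℝ (fun τ => (A τ).det) I t := by
    simp only [Matrix.det_apply']
    refine DifferentiableWithinAt.fun_sum fun σ _ => DifferentiableWithinAt.const_mul ?_ _
    exact DifferentiableWithinAt.fun_finsetProd fun i _ => h _ _
  exact Complex.reCLM.differentiableAt.comp_differentiableWithinAt t h1

/-- The barrier is independent of time and pluriharmonic, so the differential inequality for `u`
passes unchanged to the sum, which is moreover nonpositive on `O`. Only information off the divisor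
enters. -/
theorem energySubsolution_withBarrier
    (hβ : ∀ j : Fin n, (j : ℕ) < k → 0 < β j ∧ β j ≤ 1) (hε : 0 ≤ ε)
    (hε1 : ε ≤ 1) (hK : 0 < K) {Y : Cn n × ℝ} {r : ℝ}
    {G : ℝ → Cn n → Matrix (Fin n) (Fin n) ℂ} {u : Cn n × ℝ → ℝ}
    {V O : Set (Cn n)} (hV : V = Metric.ball Y.1 r \ divisor n k) (hOo : IsOpen O)
    (hG : ∀ t ∈ timeInterval Y.2 r, HolderMetricOn (polarMap k β ε ⁻¹' V) (G t) ∧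
      KahlerClosedOn (polarMap k β ε ⁻¹' V) (G t) ∧
      ∀ z ∈ polarMap k β ε ⁻¹' V, QuasiIsometric K (modelWeight k β ε z) (G t z))
    (hvol : VolumeGrowthLE K (polarMap k β ε ⁻¹' Metric.ball Y.1 r \ divisor n k)
      (timeInterval Y.2 r) G)
    (hu : IsWeakSubsolution k β ε G Y r u) {c τ : ℝ}
    (hO : ∀ x ∈ V ∩ O, ∀ t ∈ timeInterval Y.2 r, withBarrier k β ε c τ u (x, t) ≤ 0) :
    EnergySubsolution (ellipticityConst k β K) K V O (timeInterval Y.2 r)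
      (withBarrier k β ε c τ u)
      (fun p => derivWithin (fun τ => u (p.1, τ)) (timeInterval Y.2 r) p.2)
      (fun p => polarVolume k β ε (G p.2) p.1) := by
  set I := timeInterval Y.2 r with hI
  obtain ⟨α, hα, -, hreg⟩ := hu.regular
  rw [← hV] at hreg
  have hVd : V ⊆ (divisor n k)ᶜ := by rw [hV]; exact fun x hx => hx.2
  have hVo : IsOpen V := by
    rw [hV]
    exact Metric.isOpen_ball.inter (isOpen_compl_divisor n k)
  set U := polarMap k β ε ⁻¹' V with hU
  have hUd : U ⊆ (divisor n k)ᶜ := preimage_polarMap_subset hVd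
  have hUo : IsOpen U := isOpen_preimage_polarMap hβ hVd hVo
  have hUb : U ⊆ polarMap k β ε ⁻¹' Metric.ball Y.1 r \ divisor n k := fun z hz =>
    ⟨by have h : polarMap k β ε z ∈ V := hz
        rw [hV] at h
        exact h.1, hUd hz⟩
  have hinvU : ∀ x ∈ V, polarInv k β ε x ∈ U := fun x hx => by
    change polarMap k β ε _ ∈ V
    rwa [polarMap_polarInv hβ hε hε1 (hVd hx)]
  have hbar : ∀ x ∈ V, ContDiffAt ℝ 2 (fun x => logBarrier k c (polarInv k β ε x)) x :=
    fun x hx => (contDiffAt_logBarrier (hUd (hinvU x hx))).comp x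
      (contDiffAt_polarInv hβ hε hε1 (hVd hx))
  have hw2 : ∀ t ∈ I, ∀ x ∈ V, ContDiffAt ℝ 2 (fun x => withBarrier k β ε c τ u (x, t)) x :=
    fun t ht x hx => (hreg.space x hx t ht).add (contDiffAt_const.mul (hbar x hx))
  have hwt : ContinuousOn (fun p : Cn n × ℝ => derivWithin (fun τ => u (p.1, τ)) I p.2) (V ×ˢ I) :=
    hreg.holder_time.continuousOn hα hVo
  have hdiff : ∀ x ∈ V, ∀ t ∈ I,
      DifferentiableWithinAt ℝ (fun τ => (G τ (polarInv k β ε x)).det.re) I t := fun x hx t ht =>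
    differentiableWithinAt_det (hvol _ (hUb (hinvU x hx)) t ht).1
  have hunique : UniqueDiffOn ℝ I := uniqueDiffOn_Ioc _ _
  have hcontG := fun t ht => (hG t ht).1.continuousOn hUo
  refine ⟨hVo, hOo, hO, ?_, hwt, ?_, ?_, ?_, ?_, ?_, ?_⟩
  · refine (hreg.holder.continuousOn hα hVo).add (continuousOn_const.mul ?_)
    have h1 : ContinuousOn (fun x => logBarrier k c (polarInv k β ε x)) V := fun x hx =>
      (hbar x hx).continuousAt.continuousWithinAt
    exact h1.comp continuousOn_fst fun p hp => hp.1
  · exact fun x hx t ht => (hreg.time x hx t ht).hasDerivWithinAt.add_const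
      (τ * logBarrier k c (polarInv k β ε x))
  · exact fun t ht x hx => ((hw2 t ht x hx).of_le one_le_two).contDiffWithinAt
  -- No joint continuity of the metric in space and time is assumed: it is Hölder continuous in
  -- space at each time and differentiable in time at each point.
  · refine aestronglyMeasurable_of_continuousOn_sections hVo.measurableSet measurableSet_Ioc
      (fun t ht => ?_) fun x hx t ht => ?_
    · have h1 : ContinuousOn (fun z => (G t z).det.re) U :=
        Complex.continuous_re.comp_continuousOn (continuousOn_det (hcontG t ht))
      have h2 : ContinuousOn (fun z => (fderiv ℝ (polarMap k β ε) z).det) U := by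
        have h3 : ContDiffOn ℝ 1 (polarMap k β ε) U := fun z hz =>
          ((contDiffAt_polarMap hβ (hUd hz)).of_le one_le_two).contDiffWithinAt
        exact ContinuousLinearMap.continuous_det.comp_continuousOn
          (h3.continuousOn_fderiv_of_isOpen hUo le_rfl)
      have h4 := h1.div h2 fun z hz => (det_fderiv_polarMap_pos hβ (hUd hz)).ne'
      exact h4.comp (fun x hx =>
        (contDiffAt_polarInv hβ hε hε1 (hVd hx)).continuousAt.continuousWithinAt) hinvU
    · exact ((hdiff x hx t ht).continuousWithinAt).div_const _
  · exact fun x hx t ht => polarVolume_bounds hβ hK (hUd (hinvU x hx))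
      ((hG t ht).2.2 _ (hinvU x hx))
  · intro x hx t ht
    have hJ := det_fderiv_polarMap_pos (ε := ε) hβ (hUd (hinvU x hx))
    refine ⟨_, (hdiff x hx t ht).hasDerivWithinAt.div_const
      (fderiv ℝ (polarMap k β ε) (polarInv k β ε x)).det, ?_⟩
    rw [polarVolume, ← mul_div_assoc]
    exact div_le_div_of_nonneg_right (hvol _ (hUb (hinvU x hx)) t ht).2 hJ.le
  · intro t ht l hl φ hφ hφc hφs
    refine slice_energy_polar hβ hε hε1 hK hVd hVo hOo (hcontG t ht) (hG t ht).2.1 (hG t ht).2.2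
      (w := fun x => withBarrier k β ε c τ u (x, t))
      (wt := fun x => derivWithin (fun τ => u (x, τ)) I t)
      (fun x hx => (hw2 t ht x hx).contDiffWithinAt)
      (hwt.comp (f := fun x : Cn n => (x, t)) (by fun_prop) fun x hx => ⟨hx, ht⟩)
      (fun z hz => ?_) (fun x hx => hO x hx t ht) hl hφ hφc hφs
    have h1 := hu.subsolution z (hUb hz) t ht
    have h2 : (fun z => withBarrier k β ε c τ u (polarMap k β ε z, t)) =ᶠ[𝓝 z]
        fun z => u (polarMap k β ε z, t) + τ * logBarrier k c z := by
      filter_upwards [hUo.mem_nhds hz] with x hx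
      simp only [withBarrier]
      rw [polarInv_polarMap hβ (hUd hx)]
    rw [laplacian_congr h2, laplacian_add_const_mul
      (f := fun z => u (polarMap k β ε z, t)) ?_ (contDiffAt_logBarrier (hUd hz))
      (complexHessian_logBarrier (hUd hz))]
    · linarith
    · exact (hreg.space _ hz t ht).comp z (contDiffAt_polarMap hβ (hUd hz))

end


/-! ### Removal of the barrier and conclusion. -/

section

variable {n k : ℕ} {β : Fin n → ℝ} {ε K : ℝ}

theorem setIntegral_cylinder_eq (Y : Cn n × ℝ) (r : ℝ) (F : Cn n × ℝ → ℝ) :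
    ∫ p in cylinder Y r, F p
      = ∫ p in (Metric.ball Y.1 r \ divisor n k) ×ˢ timeInterval Y.2 r, F p := by
  refine setIntegral_congr_set ?_
  have h0 : (volume : Measure (Cn n × ℝ)) (divisor n k ×ˢ univ) = 0 := by
    rw [Measure.volume_eq_prod, Measure.prod_prod, volume_divisor, zero_mul]
  refine (ae_eq_set.2 ⟨measure_mono_null ?_ h0, ?_⟩)
  · rintro p ⟨hp, hp'⟩
    refine ⟨?_, mem_univ _⟩
    by_contra h
    exact hp' ⟨⟨hp.1, h⟩, hp.2⟩
  · have h1 : (Metric.ball Y.1 r \ divisor n k) ×ˢ timeInterval Y.2 r ⊆ cylinder Y r :=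
      prod_mono_left sdiff_subset
    rw [sdiff_eq_empty.2 h1, measure_empty]

/-- The constant comes from `EnergySubsolution.exists_mean_value` and is fixed before $\epsilon$,
the barrier parameter and its neighbourhood `O` are chosen. The barrier is nonpositive, so it only
decreases the integral on the right. -/
theorem exists_mean_value_polar (hn : 1 ≤ n)
    (hβ : ∀ j : Fin n, (j : ℕ) < k → 0 < β j ∧ β j ≤ 1) (hK : 0 < K) (R : ℝ) :
    ∃ N : ℝ, 0 < N ∧ ∀ (ε r : ℝ) (Y : Cn n × ℝ) (G : ℝ → Cn n → Matrix (Fin n) (Fin n) ℂ)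
      (u : Cn n × ℝ → ℝ), 0 ≤ ε → ε ≤ 1 → 0 < r → r ≤ R →
      (∀ t ∈ timeInterval Y.2 r,
        HolderMetricOn (polarMap k β ε ⁻¹' (Metric.ball Y.1 r \ divisor n k)) (G t) ∧
        KahlerClosedOn (polarMap k β ε ⁻¹' (Metric.ball Y.1 r \ divisor n k)) (G t) ∧
        ∀ z ∈ polarMap k β ε ⁻¹' (Metric.ball Y.1 r \ divisor n k),
          QuasiIsometric K (modelWeight k β ε z) (G t z)) →
      VolumeGrowthLE K (polarMap k β ε ⁻¹' Metric.ball Y.1 r \ divisor n k)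
        (timeInterval Y.2 r) G →
      IsWeakSubsolution k β ε G Y r u → Y.1 ∉ divisor n k →
      u Y * r ^ (2 * n + 2) ≤ N * ∫ p in cylinder Y r, max (u p) 0 := by
  obtain ⟨N, hN, hmv⟩ := EnergySubsolution.exists_mean_value (n := n) (R := R) hn
    (ellipticityConst_pos hβ hK) hK.le
  refine ⟨N, hN, fun ε r Y G u hε hε1 hr hrR hG hvol hu hY => ?_⟩
  set V := Metric.ball Y.1 r \ divisor n k with hV
  set I := timeInterval Y.2 r with hI
  have hVd : V ⊆ (divisor n k)ᶜ := fun x hx => hx.2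
  have hYV : Y.1 ∈ V := ⟨Metric.mem_ball_self hr, hY⟩
  obtain ⟨M, hM⟩ := hu.bounded
  obtain ⟨c, hc⟩ := exists_log_norm_polarInv_le hβ hε hε1 Y.1 hr
  have hVm : MeasurableSet V := Metric.isOpen_ball.measurableSet.diff
    (isOpen_compl_divisor n k).measurableSet.of_compl
  have hQm : MeasurableSet (V ×ˢ I) := hVm.prod measurableSet_Ioc
  have hle : ∀ τ : ℝ, 0 < τ → ∀ p ∈ V ×ˢ I, withBarrier k β ε c τ u p ≤ u p := fun τ hτ p hp =>
    add_le_of_nonpos_right (mul_nonpos_of_nonneg_of_nonpos hτ.le (logBarrier_nonpos (hc _ hp.1)))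
  have hfin : volume (V ×ˢ I) < ∞ := by
    refine lt_of_le_of_lt (measure_mono (prod_mono_left sdiff_subset)) ?_
    rw [Measure.volume_eq_prod, Measure.prod_prod]
    exact ENNReal.mul_lt_top measure_ball_lt_top measure_Ioc_lt_top
  have hM0 : 0 ≤ M := (abs_nonneg _).trans
    (hM _ hYV _ (⟨by nlinarith, le_rfl⟩ : Y.2 ∈ Ioc (Y.2 - r ^ 2) Y.2))
  have hint : ∀ f : Cn n × ℝ → ℝ, ContinuousOn f (V ×ˢ I) → (∀ p ∈ V ×ˢ I, f p ≤ M) →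
      IntegrableOn (fun p => max (f p) 0) (V ×ˢ I) := by
    intro f hf hfM
    refine IntegrableOn.of_bound hfin ((hf.sup continuousOn_const).aestronglyMeasurable hQm) M ?_
    refine (ae_restrict_iff' hQm).2 (Eventually.of_forall fun p hp => ?_)
    rw [Real.norm_of_nonneg (le_max_right _ _)]
    exact max_le (hfM p hp) hM0
  have huM : ∀ x ∈ V, ∀ t ∈ I, u (x, t) ≤ M := fun x hx t ht => (le_abs_self _).trans (hM x hx t ht)
  have hVo : IsOpen V := Metric.isOpen_ball.inter (isOpen_compl_divisor n k)
  have hucont : ContinuousOn u (V ×ˢ I) := by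
    obtain ⟨α, hα, -, hreg⟩ := hu.regular
    exact hreg.holder.continuousOn hα hVo
  have key : ∀ τ : ℝ, 0 < τ → withBarrier k β ε c τ u Y * r ^ (2 * n + 2)
      ≤ N * ∫ p in cylinder Y r, max (u p) 0 := by
    intro τ hτ
    obtain ⟨O, hOo, hDO, hO⟩ := exists_isOpen_withBarrier_nonpos hβ hε hε1 hVd hτ hc huM
    have H := energySubsolution_withBarrier hβ hε hε1 hK hV hOo hG hvol hu hO
    have hball : Metric.ball Y.1 r ⊆ V ∪ O := fun x hx => by
      by_cases hxd : x ∈ divisor n k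
      · exact Or.inr (hDO hxd)
      · exact Or.inl ⟨hx, hxd⟩
    have hbdd : ∀ x ∈ V, ∀ t ∈ I, withBarrier k β ε c τ u (x, t) ≤ M := fun x hx t ht =>
      (hle τ hτ (x, t) ⟨hx, ht⟩).trans (huM x hx t ht)
    have hmean := hmv H hr hrR hball sdiff_subset hYV ⟨M, hbdd⟩
    refine hmean.trans ?_
    rw [setIntegral_cylinder_eq (k := k)]
    refine mul_le_mul_of_nonneg_left (setIntegral_mono_on
      (hint _ H.cont fun p hp => (hle τ hτ p hp).trans (huM _ hp.1 _ hp.2))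
      (hint u hucont fun p hp => huM _ hp.1 _ hp.2) hQm fun p hp => ?_) hN.le
    exact max_le_max (hle τ hτ p hp) le_rfl
  -- At the fixed point `Y` off the divisor the barrier is finite, so its contribution vanishes as
  -- `τ` tends to zero.
  have hlim : Tendsto (fun τ : ℝ => withBarrier k β ε c τ u Y * r ^ (2 * n + 2)) (𝓝[>] 0)
      (𝓝 (u Y * r ^ (2 * n + 2))) := by
    have h1 : Continuous fun τ : ℝ => withBarrier k β ε c τ u Y * r ^ (2 * n + 2) := by
      unfold withBarrier
      fun_prop
    have h2 := (h1.tendsto 0).mono_left (nhdsWithin_le_nhds (s := Ioi 0))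
    simpa [withBarrier] using h2
  refine le_of_tendsto hlim ?_
  filter_upwards [self_mem_nhdsWithin] with τ hτ using key τ hτ

end

end ConicHeat

theorem mainTheorem7 (n k : ℕ) (hn : 1 ≤ n) (hk : k ≤ n) (β : Fin n → ℝ)
    (hβ : ∀ j : Fin n, (j : ℕ) < k → 0 < β j ∧ β j ≤ 1) (K : ℝ) (hK : 0 < K)
    (R : ℝ) (hR : 0 < R) :
    ∃ N : ℝ, 0 < N ∧
      ∀ (ε r : ℝ) (Y : ConicHeat.Cn n × ℝ)
        (G : ℝ → ConicHeat.Cn n → Matrix (Fin n) (Fin n) ℂ)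
        (u : ConicHeat.Cn n × ℝ → ℝ),
        0 < r → r ≤ R →
        ((ε = 0 ∧ ∀ t ∈ ConicHeat.timeInterval Y.2 r,
            ConicHeat.IsWeakConic k β K
              (ConicHeat.polarMap k β ε ⁻¹' Metric.ball Y.1 r) (G t)) ∨
          (0 < ε ∧ ε ≤ 1 ∧ ∀ t ∈ ConicHeat.timeInterval Y.2 r,
            ConicHeat.IsNearlyConic k β ε K
              (ConicHeat.polarMap k β ε ⁻¹' Metric.ball Y.1 r) (G t))) →
        ConicHeat.VolumeGrowthLE K
          (ConicHeat.polarMap k β ε ⁻¹' Metric.ball Y.1 r \ ConicHeat.divisor n k)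
          (ConicHeat.timeInterval Y.2 r) G →
        ConicHeat.IsWeakSubsolution k β ε G Y r u →
        Y.1 ∉ ConicHeat.divisor n k →
        u Y ≤ N / (volume (ConicHeat.cylinder Y r)).toReal *
          ∫ p in ConicHeat.cylinder Y r, max (u p) 0 := by
  obtain ⟨N, hN, h⟩ := ConicHeat.exists_mean_value_polar hn hβ hK R
  have hb : 0 < (volume (Metric.ball (0 : ConicHeat.Cn n) 1)).toReal :=
    ENNReal.toReal_pos (Metric.measure_ball_pos volume _ one_pos).ne' measure_ball_lt_top.ne
  refine ⟨N * (volume (Metric.ball (0 : ConicHeat.Cn n) 1)).toReal, by positivity,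
    fun ε r Y G u hr hrR hG hvol hu hY => ?_⟩
  have hsub : ConicHeat.polarMap k β ε ⁻¹' (Metric.ball Y.1 r \ ConicHeat.divisor n k)
      ⊆ ConicHeat.polarMap k β ε ⁻¹' Metric.ball Y.1 r \ ConicHeat.divisor n k := fun z hz =>
    ⟨hz.1, ConicHeat.preimage_polarMap_subset (fun x hx => hx.2) hz⟩
  have hmain : u Y * r ^ (2 * n + 2) ≤ N * ∫ p in ConicHeat.cylinder Y r, max (u p) 0 := by
    -- Weak-conic and nearly-conic metrics give the same data once restricted to the complement of
    -- the divisor, so both cases follow from one estimate.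
    rcases hG with ⟨rfl, hG⟩ | ⟨hε, hε1, hG⟩
    · exact h 0 r Y G u le_rfl zero_le_one hr hrR (fun t ht => (hG t ht).mono hsub) hvol hu hY
    · exact h ε r Y G u hε.le hε1 hr hrR
        (fun t ht => (hG t ht).mono (hsub.trans sdiff_subset)) hvol hu hY
  rw [ConicHeat.volume_cylinder Y hr, mul_comm N, mul_div_mul_left _ _ hb.ne', div_mul_eq_mul_div,
    le_div_iff₀ (by positivity)]
  exact hmain
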